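/- Let $\mathcal H=L^2(\mathbb R)$, let $Q$ be multiplication by $x$ and $P=-i\,d/dx$, with spectral measures $\mathsf Q,\mathsf P$. For a semispectral measure (normalized positive operator measure) $E$ on $\mathbb R$ and $\psi\in\mathcal H$ put $p^E_\psi(X)=\langle\psi|E(X)\psi\rangle$ and $\langle\psi|E[k]\psi\rangle=\int x^k\,dp^E_\psi$ when $x^k$ is $p^E_\psi$-integrable. Write $\langle\psi|Q^k\psi\rangle=\int x^k\,dp^{\mathsf Q}_\psi$ and $\langle\psi|P^k\psi\rangle=\int x^k\,dp^{\mathsf P}_\psi$; these agree with the operator expressions for $\psi$ in the domain of $Q^k$, respectively of $P^k$. Let $(W_{qp}\psi)(x)=e^{-iqp/2}e^{ipx}\psi(x-q)$. For a positive trace-one operator $T$ let $G^T(Z)=\frac1{2\pi}\int_Z W_{qp}TW_{qp}^*\,dq\,dp$ (weakly), which is a semispectral measure on $\mathbb R^2$, and let $G^T_1(X)=G^T(X\times\mathbb R)$ and $G^T_2(Y)=G^T(\mathbb R\times Y)$ be its marginals. Let $D$ be the linear span of the Hermite functions. (a) Let $T$ be such that $Q^k\sqrt T$ and $P^k\sqrt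 T$ are Hilbert–Schmidt operators for all $k\in\mathbb N$. Then there are real numbers $s^Q_{ki},s^P_{ki}$, depending only on $T$, with $s^Q_{k0}=s^P_{k0}=1$, such that for all $\psi\in\mathcal H$ and $k\in\mathbb N$: $x^k$ is $p^{G^T_1}_\psi$-integrable if and only if it is $p^{\mathsf Q}_\psi$-integrable, and in that case $$\langle\psi|G^T_1[k]\psi\rangle=\sum_{i=0}^k s^Q_{ki}\langle\psi|Q^{k-i}\psi\rangle,\qquad \langle\psi|Q^k\psi\rangle=\langle\psi|G^T_1[k]\psi\rangle-\sum_{i=1}^k s^Q_{ki}\langle\psi|Q^{k-i}\psi\rangle;$$ likewise with $G^T_2,\mathsf P,P,s^P$ in place of $G^T_1,\mathsf Q,Q,s^Q$. If $T=\sum_j t_j|\eta_j\rangle\langle\eta_j|$ is a spectral decomposition, and $f(q)=\sum_j t_j|\eta_j(-q)|^2$, $g(p)=\sum_j t_j|\hat\eta_j(-p)|^2$, where $\hat\eta(p)=(2\pi)^{-1/2}\int e^{-ipx}\eta(x)\,dx$, then $f$ and $g$ are probability densities with finite moments of all orders, $p^{G^T_1}_\psi=p^{\mathsf Q}_\psi*f$,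 $p^{G^T_2}_\psi=p^{\mathsf P}_\psi*g$, $s^Q_{ki}=\binom ki\int q^if(q)\,dq$ and $s^P_{ki}=\binom ki\int p^ig(p)\,dp$. (b) Let $\psi\in D$. Then $\psi$ is in the domain of all $Q^k$ and $P^k$, the measures $p^{\mathsf Q}_\psi$ and $p^{\mathsf P}_\psi$ are exponentially bounded ($\int e^{a|x|}\,dp<\infty$ for some $a>0$), and each is the only measure on $\mathbb R$ with its moment sequence. Consequently, for $T$ as in (a), $p^{\mathsf Q}_\psi$ is the only measure on $\mathbb R$ with finite moments whose moments $m_k$ satisfy $m_k=\langle\psi|G^T_1[k]\psi\rangle-\sum_{i=1}^k s^Q_{ki}m_{k-i}$ for all $k$, and similarly for $p^{\mathsf P}_\psi$ with $G^T_2$ and $s^P$. (c) $D$ is dense in $\mathcal H$, and the distributions $p^{\mathsf Q}_\psi$, $\psi\in D$ (or just their moments), determine $\mathsf Q$: a semispectral measure $E$ on $\mathbb R$ with the same distributions (or the same moments, all finite) in all $\psi\in D$ equals $\mathsf Q$. The same holds for $\mathsf P$. (d) The measurement models yield observables $G^T$ with $T$ as in (a). For $\lambda,\mu>0$ and unit vectors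 $\phi,\phi_1,\phi_2$ in the Schwartz space there are such operators $T$ with, for all $\psi\in\mathcal H$ and Borel sets $X,Y$: in the sequential model, $\langle\psi|G^T(X\times Y)\psi\rangle=\langle\Psi|\mathsf P(Y)\otimes\mathsf Q(\lambda X)\Psi\rangle$, where $\Psi(x,y)=\psi(x)\phi(y-\lambda x)$; in the Arthurs–Kelly model, $\langle\psi|G^T(X\times Y)\psi\rangle=\langle\Psi|I\otimes\mathsf Q(\lambda X)\otimes\mathsf P(\mu Y)\Psi\rangle$, where $\Psi(x,y,z)=\psi(x+\mu z)\phi_1(y-\lambda x)\phi_2(z)$. For the eight-port homodyne detector with parameter state $\sigma$, whose high-amplitude limit observable is $G^{C\sigma C^{-1}}$ with $(C\varphi)(x)=\overline{\varphi(x)}$: if $\sigma$ is a positive trace-one operator with $Q^k\sqrt\sigma$ and $P^k\sqrt\sigma$ Hilbert–Schmidt for all $k$, then $T=C\sigma C^{-1}$ has the same properties. -/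

import Mathlib

open MeasureTheory Set
open scoped ENNReal InnerProductSpace SchwartzMap

noncomputable section

/-- The Hilbert space `L²(ℝ)`. The inner product `⟪φ, ψ⟫_ℂ` is conjugate-linear in `φ`. -/
abbrev QHilbert : Type := Lp ℂ 2 (volume : Measure ℝ)

/-! ### Observables (semispectral measures) -/

/-- A semispectral measure (normalized positive operator measure) on `Ω` acting in `L²(ℝ)`:
for every `ψ`, the map `X ↦ ⟨ψ|E(X)ψ⟩` is a finite positive measure on the measurable sets, and
`E(Ω) = 1`; so it is a probability measure for unit vectors. The values of `effect` on
non-measurable sets carry no meaning. -/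
structure QObservable (Ω : Type) [MeasurableSpace Ω] where
  effect : Set Ω → QHilbert →L[ℂ] QHilbert
  effect_univ : effect univ = ContinuousLinearMap.id ℂ QHilbert
  exists_measure : ∀ ψ : QHilbert, ∃ μ : Measure Ω, IsFiniteMeasure μ ∧
    ∀ X, MeasurableSet X → ⟪ψ, effect X ψ⟫_ℂ = ((μ.real X : ℝ) : ℂ)

namespace QObservable

/-- The measure `p^E_ψ : X ↦ ⟨ψ|E(X)ψ⟩`. -/
def dist {Ω : Type} [MeasurableSpace Ω] (E : QObservable Ω) (ψ : QHilbert) : Measure Ω :=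
  (E.exists_measure ψ).choose

theorem isFiniteMeasure_dist {Ω : Type} [MeasurableSpace Ω] (E : QObservable Ω) (ψ : QHilbert) :
    IsFiniteMeasure (E.dist ψ) :=
  (E.exists_measure ψ).choose_spec.1

theorem inner_effect {Ω : Type} [MeasurableSpace Ω] (E : QObservable Ω) (ψ : QHilbert)
    {X : Set Ω} (hX : MeasurableSet X) :
    ⟪ψ, E.effect X ψ⟫_ℂ = (((E.dist ψ).real X : ℝ) : ℂ) :=
  (E.exists_measure ψ).choose_spec.2 X hX

/-- A sharp observable (spectral measure): all effects are orthogonal projections. -/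
def IsSharp {Ω : Type} [MeasurableSpace Ω] (E : QObservable Ω) : Prop :=
  ∀ X, MeasurableSet X → IsStarProjection (E.effect X)

/-- Two semispectral measures are the same when they agree on all measurable sets. -/
def SameAs {Ω : Type} [MeasurableSpace Ω] (E F : QObservable Ω) : Prop :=
  ∀ X, MeasurableSet X → E.effect X = F.effect X

/-- The first marginal `X ↦ M(X × ℝ)`. -/
def fst (M : QObservable (ℝ × ℝ)) : QObservable ℝ where
  effect X := M.effect (X ×ˢ univ)
  effect_univ := by rw [univ_prod_univ]; exact M.effect_univ
  exists_measure ψ := by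
    have := M.isFiniteMeasure_dist ψ
    refine ⟨(M.dist ψ).map Prod.fst, inferInstance, fun X hX => ?_⟩
    rw [M.inner_effect ψ (hX.prod MeasurableSet.univ), map_measureReal_apply measurable_fst hX,
      prod_univ]

/-- The second marginal `Y ↦ M(ℝ × Y)`. -/
def snd (M : QObservable (ℝ × ℝ)) : QObservable ℝ where
  effect Y := M.effect (univ ×ˢ Y)
  effect_univ := by rw [univ_prod_univ]; exact M.effect_univ
  exists_measure ψ := by
    have := M.isFiniteMeasure_dist ψ
    refine ⟨(M.dist ψ).map Prod.snd, inferInstance, fun X hX => ?_⟩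
    rw [M.inner_effect ψ (MeasurableSet.univ.prod hX), map_measureReal_apply measurable_snd hX,
      univ_prod]

/-- The `k`-th absolute moment of `p^E_ψ` is finite. -/
def HasMoment (E : QObservable ℝ) (k : ℕ) (ψ : QHilbert) : Prop :=
  Integrable (fun x : ℝ => x ^ k) (E.dist ψ)

/-- The number `⟨ψ|E[k]ψ⟩ = ∫ x^k dp^E_ψ` (meaningful when `E.HasMoment k ψ`). -/
def moment (E : QObservable ℝ) (k : ℕ) (ψ : QHilbert) : ℝ :=
  ∫ x, x ^ k ∂(E.dist ψ)

end QObservable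

/-! ### Multiplication operators, position and momentum -/

theorem memLp_mul_of_norm_le_one (m : ℝ → ℂ) (hm : Measurable m) (hb : ∀ x, ‖m x‖ ≤ 1)
    (ψ : QHilbert) : MemLp (fun x => m x * ψ x) 2 (volume : Measure ℝ) := by
  refine MemLp.of_le (Lp.memLp ψ)
    (hm.aestronglyMeasurable.mul (Lp.memLp ψ).aestronglyMeasurable) (.of_forall fun x => ?_)
  rw [norm_mul]
  exact mul_le_of_le_one_left (norm_nonneg _) (hb x)

/-- Multiplication by a measurable function `m` with `|m| ≤ 1`. -/
def mulOp (m : ℝ → ℂ) (hm : Measurable m) (hb : ∀ x, ‖m x‖ ≤ 1) : QHilbert →L[ℂ] QHilbert :=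
  LinearMap.mkContinuous
    { toFun := fun ψ => (memLp_mul_of_norm_le_one m hm hb ψ).toLp
      map_add' := fun φ ψ => by
        rw [← MemLp.toLp_add, MemLp.toLp_eq_toLp_iff]
        filter_upwards [Lp.coeFn_add φ ψ] with x hx
        simp only [hx, Pi.add_apply]; ring
      map_smul' := fun c ψ => by
        rw [RingHom.id_apply, ← MemLp.toLp_const_smul, MemLp.toLp_eq_toLp_iff]
        filter_upwards [Lp.coeFn_smul c ψ] with x hx
        simp only [hx, Pi.smul_apply, smul_eq_mul]; ring }
    1 (fun ψ => by
      rw [one_mul]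
      refine Lp.norm_le_norm_of_ae_le ?_
      filter_upwards [(memLp_mul_of_norm_le_one m hm hb ψ).coeFn_toLp] with x hx
      simp only [LinearMap.coe_mk, AddHom.coe_mk]
      rw [hx, norm_mul]
      exact mul_le_of_le_one_left (norm_nonneg _) (hb x))

theorem coeFn_mulOp (m : ℝ → ℂ) (hm : Measurable m) (hb : ∀ x, ‖m x‖ ≤ 1) (ψ : QHilbert) :
    mulOp m hm hb ψ =ᵐ[volume] fun x => m x * ψ x :=
  (memLp_mul_of_norm_le_one m hm hb ψ).coeFn_toLp

open Classical in
/-- The operator `χ_X(Q)`: multiplication by the characteristic function of the measurable set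
`X` (and, by convention, `0` if `X` is not measurable). -/
def indicatorOp (X : Set ℝ) : QHilbert →L[ℂ] QHilbert :=
  if hX : MeasurableSet X then
    mulOp (X.indicator fun _ => 1) (measurable_const.indicator hX)
      (fun x => by by_cases h : x ∈ X <;> simp [h])
  else 0

theorem coeFn_indicatorOp {X : Set ℝ} (hX : MeasurableSet X) (ψ : QHilbert) :
    indicatorOp X ψ =ᵐ[volume] X.indicator ψ := by
  unfold indicatorOp
  rw [dif_pos hX]
  filter_upwards [coeFn_mulOp (X.indicator fun _ => 1) (measurable_const.indicator hX)
    (fun x => by by_cases h : x ∈ X <;> simp [h]) ψ] with x hx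
  rw [hx]
  by_cases h : x ∈ X <;> simp [h]

theorem indicatorOp_univ : indicatorOp univ = ContinuousLinearMap.id ℂ QHilbert := by
  ext1 ψ
  refine Lp.ext ?_
  filter_upwards [coeFn_indicatorOp MeasurableSet.univ ψ] with x hx
  simp [hx]

theorem inner_indicatorOp (ψ : QHilbert) : ∃ μ : Measure ℝ, IsFiniteMeasure μ ∧
    ∀ X, MeasurableSet X → ⟪ψ, indicatorOp X ψ⟫_ℂ = ((μ.real X : ℝ) : ℂ) := by
  have hi : Integrable (fun x => ‖ψ x‖ ^ 2) (volume : Measure ℝ) :=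
    (memLp_two_iff_integrable_sq_norm (Lp.memLp ψ).aestronglyMeasurable).1 (Lp.memLp ψ)
  refine ⟨volume.withDensity fun x => ENNReal.ofReal (‖ψ x‖ ^ 2),
    isFiniteMeasure_withDensity_ofReal hi.2, fun X hX => ?_⟩
  rw [L2.inner_def]
  have h1 : ∫ x, ⟪ψ x, indicatorOp X ψ x⟫_ℂ = ∫ x, X.indicator (fun x => ((‖ψ x‖ ^ 2 : ℝ) : ℂ)) x := by
    refine integral_congr_ae ?_
    filter_upwards [coeFn_indicatorOp hX ψ] with x hx
    rw [hx]
    by_cases h : x ∈ X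
    · simp only [h, indicator_of_mem, inner_self_eq_norm_sq_to_K]
      push_cast
      rfl
    · simp [h]
  rw [h1, integral_indicator hX, integral_complex_ofReal, measureReal_def,
    withDensity_apply _ hX,
    integral_eq_lintegral_of_nonneg_ae (.of_forall fun x => by positivity)
      hi.aestronglyMeasurable.restrict]

/-- The position observable: the spectral measure `X ↦ χ_X(Q)` of the position operator. -/
def positionObservable : QObservable ℝ where
  effect := indicatorOp
  effect_univ := indicatorOp_univ
  exists_measure := inner_indicatorOp

/-- The Fourier–Plancherel operator in Mathlib's normalization,
`(𝓕ψ)(ξ) = ∫ e^{-2πixξ} ψ(x) dx`. The variable `ξ` corresponds to the momentum `p = 2πξ`, and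
the unitary Fourier transform `ψ̂(p) = (2π)^{-1/2} ∫ e^{-ipx} ψ(x) dx` is
`ψ̂(p) = (2π)^{-1/2} (𝓕ψ)(p / 2π)`. -/
def fourierL2 : QHilbert ≃ₗᵢ[ℂ] QHilbert := Lp.fourierTransformₗᵢ ℝ ℂ

/-- The momentum observable: the spectral measure of the momentum operator `P = -i d/dx`. Here
`χ_Y(P)` is, in Fourier space, multiplication by the characteristic function of
`{ξ | 2πξ ∈ Y}`. -/
def momentumObservable : QObservable ℝ where
  effect Y := (fourierL2.symm : QHilbert →L[ℂ] QHilbert) ∘L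
    indicatorOp ((fun ξ : ℝ => 2 * Real.pi * ξ) ⁻¹' Y) ∘L (fourierL2 : QHilbert →L[ℂ] QHilbert)
  effect_univ := by
    rw [preimage_univ, indicatorOp_univ]
    ext1 ψ
    simp
  exists_measure ψ := by
    obtain ⟨μ, hμ, h⟩ := inner_indicatorOp (fourierL2 ψ)
    have hm : Measurable fun ξ : ℝ => 2 * Real.pi * ξ := by fun_prop
    refine ⟨μ.map fun ξ : ℝ => 2 * Real.pi * ξ, inferInstance, fun Y hY => ?_⟩
    rw [map_measureReal_apply hm hY, ← h _ (hm hY)]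
    conv_lhs => rw [← fourierL2.inner_map_map]
    simp

/-- The operator `Q^k`: multiplication by `x^k`, on its maximal domain. -/
def positionPow (k : ℕ) : QHilbert →ₗ.[ℂ] QHilbert where
  domain :=
    { carrier := {ψ | MemLp (fun x : ℝ => (x : ℂ) ^ k * ψ x) 2 volume}
      add_mem' := fun {φ ψ} hφ hψ => by
        refine (MemLp.ae_eq ?_ (MemLp.add hφ hψ))
        filter_upwards [Lp.coeFn_add φ ψ] with x hx
        simp only [hx, Pi.add_apply]; ring
      zero_mem' := by
        refine MemLp.ae_eq ?_ (MemLp.zero (ε := ℂ))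
        filter_upwards [Lp.coeFn_zero ℂ 2 (volume : Measure ℝ)] with x hx
        simp
      smul_mem' := fun c ψ hψ => by
        refine (MemLp.ae_eq ?_ (MemLp.const_smul hψ c))
        filter_upwards [Lp.coeFn_smul c ψ] with x hx
        simp only [hx, Pi.smul_apply, smul_eq_mul]; ring }
  toFun :=
    { toFun := fun ψ => MemLp.toLp _ ψ.2
      map_add' := fun φ ψ => by
        rw [← MemLp.toLp_add, MemLp.toLp_eq_toLp_iff]
        filter_upwards [Lp.coeFn_add (φ : QHilbert) (ψ : QHilbert)] with x hx
        simp only [Submodule.coe_add, hx, Pi.add_apply]; ring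
      map_smul' := fun c ψ => by
        rw [RingHom.id_apply, ← MemLp.toLp_const_smul, MemLp.toLp_eq_toLp_iff]
        filter_upwards [Lp.coeFn_smul c (ψ : QHilbert)] with x hx
        simp only [Submodule.coe_smul, hx, Pi.smul_apply, smul_eq_mul]; ring }

/-- The operator `P^k` on its maximal domain: in Fourier space, multiplication by `(2πξ)^k`. -/
def momentumPow (k : ℕ) : QHilbert →ₗ.[ℂ] QHilbert where
  domain := (positionPow k).domain.comap (fourierL2.toLinearEquiv : QHilbert →ₗ[ℂ] QHilbert)
  toFun :=
    { toFun := fun ψ =>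
        ((2 * Real.pi : ℂ) ^ k) • fourierL2.symm (positionPow k ⟨fourierL2 ψ, ψ.2⟩)
      map_add' := fun φ ψ => by
        rw [← smul_add, ← map_add, ← LinearPMap.map_add]
        congr 3
        exact Subtype.ext (map_add fourierL2 (φ : QHilbert) (ψ : QHilbert))
      map_smul' := fun c ψ => by
        have h : ∀ u v : (positionPow k).domain, (u : QHilbert) = c • (v : QHilbert) →
            fourierL2.symm (positionPow k u) = c • fourierL2.symm (positionPow k v) := by
          intro u v huv
          rw [show u = c • v from Subtype.ext huv, LinearPMap.map_smul, map_smul]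
        rw [RingHom.id_apply, smul_comm c,
          h _ ⟨fourierL2 (ψ : QHilbert), ψ.2⟩ (map_smul fourierL2 c (ψ : QHilbert))] }

/-! ### Weyl operators and covariant phase space observables -/

/-- The translation `ψ ↦ ψ(· - q)`. -/
def translationOp (q : ℝ) : QHilbert →L[ℂ] QHilbert :=
  (Lp.compMeasurePreservingₗᵢ ℂ (fun x : ℝ => x - q)
    (measurePreserving_sub_right volume q)).toContinuousLinearMap

theorem norm_weylPhase_le (z : ℝ × ℝ) (x : ℝ) :
    ‖Complex.exp (((z.2 * x - z.1 * z.2 / 2 : ℝ) : ℂ) * Complex.I)‖ ≤ 1 :=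
  (Complex.norm_exp_ofReal_mul_I _).le

/-- The Weyl operator `W_{qp} = e^{iqp/2} e^{-iqP} e^{ipQ}`, that is,
`(W_{qp} ψ)(x) = e^{-iqp/2} e^{ipx} ψ(x - q)`. -/
def weylOp (z : ℝ × ℝ) : QHilbert →L[ℂ] QHilbert :=
  mulOp (fun x => Complex.exp (((z.2 * x - z.1 * z.2 / 2 : ℝ) : ℂ) * Complex.I))
    (by fun_prop) (norm_weylPhase_le z) ∘L translationOp z.1

theorem coeFn_weylOp (q p : ℝ) (ψ : QHilbert) :
    weylOp (q, p) ψ =ᵐ[volume]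
      fun x => Complex.exp (((p * x - q * p / 2 : ℝ) : ℂ) * Complex.I) * ψ (x - q) := by
  have h := Lp.coeFn_compMeasurePreserving ψ
    (measurePreserving_sub_right (volume : Measure ℝ) q)
  refine (coeFn_mulOp _ (by fun_prop) (norm_weylPhase_le (q, p)) (translationOp q ψ)).trans ?_
  filter_upwards [h] with x hx
  exact congrArg _ hx

/-- The positive square root `√T` of a positive operator. -/
def opSqrt {H : Type*} [NormedAddCommGroup H] [InnerProductSpace ℂ H] [CompleteSpace H]
    (T : H →L[ℂ] H) : H →L[ℂ] H :=
  CFC.sqrt T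

/-- A state: a positive operator of trace one, the trace being `∑ ⟨b_i|T b_i⟩` for an orthonormal
basis `b`. -/
def IsQState (T : QHilbert →L[ℂ] QHilbert) : Prop :=
  T.IsPositive ∧ ∃ (ι : Type) (b : HilbertBasis ι ℂ QHilbert),
    HasSum (fun i => ⟪b i, T (b i)⟫_ℂ) 1

/-- Hilbert–Schmidt operators: `∑ ‖A b_i‖² < ∞` for an orthonormal basis `b`. -/
def IsHilbertSchmidt (A : QHilbert →L[ℂ] QHilbert) : Prop :=
  ∃ (ι : Type) (b : HilbertBasis ι ℂ QHilbert), Summable fun i => ‖A (b i)‖ ^ 2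

/-- For an unbounded operator `A` and a bounded operator `B`: the product `A B` is an everywhere
defined Hilbert–Schmidt operator. -/
def IsHilbertSchmidtProd (A : QHilbert →ₗ.[ℂ] QHilbert) (B : QHilbert →L[ℂ] QHilbert) : Prop :=
  ∃ C : QHilbert →L[ℂ] QHilbert, IsHilbertSchmidt C ∧
    ∀ ψ, ∃ h : B ψ ∈ A.domain, A ⟨B ψ, h⟩ = C ψ

/-- The operators `Q^k √T` and `P^k √T` are Hilbert–Schmidt for all `k`. -/
def HasHSMoments (T : QHilbert →L[ℂ] QHilbert) : Prop :=
  ∀ k, IsHilbertSchmidtProd (positionPow k) (opSqrt T) ∧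
    IsHilbertSchmidtProd (momentumPow k) (opSqrt T)

/-- `G` is the covariant phase space observable `G^T` generated by `T`:
`G(Z) = (2π)⁻¹ ∫_Z W_{qp} T W_{qp}^* dq dp`, the integral being understood weakly. -/
def IsPhaseSpaceObservable (T : QHilbert →L[ℂ] QHilbert) (G : QObservable (ℝ × ℝ)) : Prop :=
  ∀ Z, MeasurableSet Z → ∀ φ ψ : QHilbert,
    IntegrableOn (fun z => ⟪φ, (weylOp z ∘L T ∘L ContinuousLinearMap.adjoint (weylOp z)) ψ⟫_ℂ) Z ∧
    ⟪φ, G.effect Z ψ⟫_ℂ = (1 / (2 * Real.pi) : ℂ) *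
      ∫ z in Z, ⟪φ, (weylOp z ∘L T ∘L ContinuousLinearMap.adjoint (weylOp z)) ψ⟫_ℂ

/-- `T = ∑ t_j |η_j⟩⟨η_j|` with `t_j ≥ 0` and `η_j` orthonormal. -/
def IsSpectralDecomposition (T : QHilbert →L[ℂ] QHilbert) (t : ℕ → ℝ) (η : ℕ → QHilbert) : Prop :=
  (∀ j, 0 ≤ t j) ∧ Orthonormal ℂ η ∧
    ∀ ψ, HasSum (fun j => (t j : ℂ) • ⟪η j, ψ⟫_ℂ • η j) (T ψ)

/-- The measure with density `f(q) = ∑ t_j |η_j(-q)|²`. -/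
def positionNoise (t : ℕ → ℝ) (η : ℕ → QHilbert) : Measure ℝ :=
  volume.withDensity fun q => ∑' j, ENNReal.ofReal (t j) * ‖η j (-q)‖ₑ ^ 2

/-- The measure with density `g(p) = ∑ t_j |η̂_j(-p)|²`, where
`η̂(p) = (2π)^{-1/2} (𝓕η)(p / 2π)`. -/
def momentumNoise (t : ℕ → ℝ) (η : ℕ → QHilbert) : Measure ℝ :=
  volume.withDensity fun p => ∑' j, ENNReal.ofReal (t j) *
    (ENNReal.ofReal (1 / (2 * Real.pi)) * ‖fourierL2 (η j) (-p / (2 * Real.pi))‖ₑ ^ 2)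

/-! ### Hermite functions, exponential boundedness -/

/-- The normalized Hermite function `(2^n n! √π)^{-1/2} H_n(x) e^{-x²/2}`, written with the
probabilists' Hermite polynomials: `H_n(x) = 2^{n/2} He_n(√2 x)`. -/
def hermiteFunction (n : ℕ) (x : ℝ) : ℝ :=
  (Real.sqrt (n.factorial * Real.sqrt Real.pi))⁻¹ *
    Polynomial.aeval (Real.sqrt 2 * x) (Polynomial.hermite n) * Real.exp (-x ^ 2 / 2)

/-- The linear hull of the Hermite functions in `L²(ℝ)`. -/
def hermiteSpan : Submodule ℂ QHilbert :=
  Submodule.span ℂ {ψ | ∃ n, ψ =ᵐ[volume] fun x => (hermiteFunction n x : ℂ)}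

/-- A measure `μ` on `ℝ` is exponentially bounded: `∫ e^{a|x|} dμ < ∞` for some `a > 0`. -/
def IsExpBounded (μ : Measure ℝ) : Prop :=
  ∃ a : ℝ, 0 < a ∧ Integrable (fun x : ℝ => Real.exp (a * |x|)) μ

/-- `μ` is the only measure on `ℝ` that has its moment sequence. -/
def IsMomentDeterminate (μ : Measure ℝ) : Prop :=
  (∀ k : ℕ, Integrable (fun x : ℝ => x ^ k) μ) ∧
  ∀ ν : Measure ℝ, (∀ k : ℕ, Integrable (fun x : ℝ => x ^ k) ν ∧
    ∫ x, x ^ k ∂ν = ∫ x, x ^ k ∂μ) → ν = μ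

/-! ### The measurement models -/

/-- `(2π)^{-1/2} ∫ e^{-ipx} u(x) dx`. -/
def fourierHat (u : ℝ → ℂ) (p : ℝ) : ℂ :=
  ((Real.sqrt (2 * Real.pi))⁻¹ : ℂ) * ∫ x : ℝ, Complex.exp (-(p * x : ℝ) * Complex.I) * u x

/-- Sequential model. The coupling `e^{-iλ Q ⊗ P₀}` turns `ψ ⊗ φ` into
`Ψ(x, y) = ψ(x) φ(y - λx)`. -/
def sequentialState (lam : ℝ) (φ : 𝓢(ℝ, ℂ)) (ψ : QHilbert) (x y : ℝ) : ℂ :=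
  ψ x * φ (y - lam * x)

/-- The probability `⟨Ψ|P(Y) ⊗ Q₀(λX)Ψ⟩` that the probe position is found in `λX` and that a
subsequent sharp measurement of the momentum of the object gives a value in `Y`. -/
def sequentialProb (lam : ℝ) (φ : 𝓢(ℝ, ℂ)) (ψ : QHilbert) (X Y : Set ℝ) : ℝ≥0∞ :=
  ∫⁻ y in {y | y / lam ∈ X}, ∫⁻ p in Y, ‖fourierHat (fun x => sequentialState lam φ ψ x y) p‖ₑ ^ 2

/-- Arthurs–Kelly model. The coupling `e^{-iλ Q ⊗ P₁ ⊗ I} e^{iμ P ⊗ I ⊗ Q₂}` turns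
`ψ ⊗ φ₁ ⊗ φ₂` into `Ψ(x, y, z) = ψ(x + μz) φ₁(y - λx) φ₂(z)`. -/
def arthursKellyState (lam mu : ℝ) (φ₁ φ₂ : 𝓢(ℝ, ℂ)) (ψ : QHilbert) (x y z : ℝ) : ℂ :=
  ψ (x + mu * z) * φ₁ (y - lam * x) * φ₂ z

/-- The probability `⟨Ψ|I ⊗ Q(λX) ⊗ P(μY)Ψ⟩` that the position of the first probe is found in
`λX` and the momentum of the second probe in `μY`. -/
def arthursKellyProb (lam mu : ℝ) (φ₁ φ₂ : 𝓢(ℝ, ℂ)) (ψ : QHilbert) (X Y : Set ℝ) : ℝ≥0∞ :=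
  ∫⁻ x, ∫⁻ y in {y | y / lam ∈ X}, ∫⁻ p in {p | p / mu ∈ Y},
    ‖fourierHat (fun z => arthursKellyState lam mu φ₁ φ₂ ψ x y z) p‖ₑ ^ 2

/-- Complex conjugation `(Cψ)(x) = conj (ψ(x))` on `L²(ℝ)`. -/
def conjL2 : QHilbert →L[ℝ] QHilbert :=
  ContinuousLinearMap.compLpL 2 volume (Complex.conjCLE : ℂ →L[ℝ] ℂ)

theorem coeFn_conjL2 (ψ : QHilbert) :
    conjL2 ψ =ᵐ[volume] fun x => (starRingEnd ℂ) (ψ x) :=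
  ContinuousLinearMap.coeFn_compLpL (𝕜 := ℝ) (Complex.conjCLE : ℂ →L[ℝ] ℂ) ψ

theorem conjL2_smul (c : ℂ) (ψ : QHilbert) :
    conjL2 (c • ψ) = (starRingEnd ℂ) c • conjL2 ψ := by
  refine Lp.ext ?_
  filter_upwards [coeFn_conjL2 (c • ψ), Lp.coeFn_smul c ψ,
    Lp.coeFn_smul ((starRingEnd ℂ) c) (conjL2 ψ), coeFn_conjL2 ψ] with x h1 h2 h3 h4
  rw [h1, h2, h3, Pi.smul_apply, Pi.smul_apply, h4, smul_eq_mul, smul_eq_mul, map_mul]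

theorem norm_conjL2 (ψ : QHilbert) : ‖conjL2 ψ‖ ≤ ‖ψ‖ := by
  refine Lp.norm_le_norm_of_ae_le ?_
  filter_upwards [coeFn_conjL2 ψ] with x hx
  rw [hx, RCLike.norm_conj]

/-- `σ ↦ C σ C⁻¹` (note `C⁻¹ = C`). In the high-amplitude limit the eight-port homodyne detector
with parameter state `σ` measures the phase space observable generated by `C σ C⁻¹`. -/
def conjOp (σ : QHilbert →L[ℂ] QHilbert) : QHilbert →L[ℂ] QHilbert :=
  LinearMap.mkContinuous
    { toFun := fun ψ => conjL2 (σ (conjL2 ψ))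
      map_add' := fun φ ψ => by rw [map_add, map_add, map_add]
      map_smul' := fun c ψ => by
        rw [conjL2_smul, map_smul, conjL2_smul, Complex.conj_conj, RingHom.id_apply] }
    ‖σ‖ (fun ψ => (norm_conjL2 _).trans ((σ.le_opNorm _).trans
      (mul_le_mul_of_nonneg_left (norm_conjL2 ψ) (norm_nonneg σ))))

end

open MeasureTheory Set
open scoped ENNReal InnerProductSpace SchwartzMap

noncomputable section

/-! ### Distributions of observables -/

/-! A state enters only through decompositions T = ∫ |u_s⟩⟨u_s| dν(s) (`IsFrame`). Spectral
decompositions, the vectors √T b_i for a basis b, and the mixtures that arise in the measurement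
models are all of this kind. Quantities tr(A T A*) = ∫ ‖A u_s‖² dν do not depend on the
decomposition (`IsFrame.lintegral_enorm_apply_sq_eq`); the trace and the noise distributions f, g
are such quantities.

For T = |u⟩⟨u| the density of G^T in the state ψ is |⟨W_{qp}u|ψ⟩|²/2π. At fixed q the inner product
is, up to a phase, the Fourier integral in p of conj(u(x-q)) ψ(x). Plancherel in p therefore gives
the first marginal as the position distribution of ψ convolved with the reflected position
distribution of u (`lintegral_enorm_inner_weylOp_sq`). The Fourier transform carries Weyl operators
to Weyl operators with q and p exchanged (`fourierL2_weylOp`), which gives the second marginal.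
Averaging over s yields convolution with f and with g.

Part (a) is then about sums of independent variables: the binomial formula gives the moments, and
Fubini gives back integrability of x^k for the sharp distribution. The Hilbert–Schmidt condition
says exactly that the noise has finite even moments (`IsFrame.isHilbertSchmidtProd_iff`). The
leading coefficient is 1, so the triangular system for the moments can be solved recursively.

For (b), exponential boundedness can be read off from the even moments through the series of cosh,
so a competitor with the same moments is exponentially bounded too. Both complex moment generating
functions are then analytic on a common strip and have equal derivatives at 0, and the identity
theorem makes the characteristic functions equal. Elements of D are polynomials times e^{-x²/2}, and
their Fourier transforms are of the same type.

For (c), if ψ is orthogonal to D then e^{-x²/2}ψ has vanishing moments, hence vanishing Fourier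
transform, so ψ = 0. Density and polarization then recover the effects. For (d), both models lead to
mixtures of translates of one Schwartz function (`exists_isPhaseSpaceObservable_of_translates`), and
conjugation by C carries frames to frames. -/

theorem measure_eq_of_real_eq {Ω : Type*} [MeasurableSpace Ω] {μ ν : Measure Ω}
    [IsFiniteMeasure μ] [IsFiniteMeasure ν]
    (h : ∀ X, MeasurableSet X → μ.real X = ν.real X) : μ = ν := by
  ext X hX
  exact (measureReal_eq_measureReal_iff).1 (h X hX)

namespace QObservable

variable {Ω : Type} [MeasurableSpace Ω]

instance (E : QObservable Ω) (ψ : QHilbert) : IsFiniteMeasure (E.dist ψ) :=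
  E.isFiniteMeasure_dist ψ

theorem dist_eq_of_inner (E : QObservable Ω) (ψ : QHilbert) (μ : Measure Ω) [IsFiniteMeasure μ]
    (h : ∀ X, MeasurableSet X → ⟪ψ, E.effect X ψ⟫_ℂ = ((μ.real X : ℝ) : ℂ)) : E.dist ψ = μ := by
  refine measure_eq_of_real_eq fun X hX => ?_
  exact_mod_cast (E.inner_effect ψ hX).symm.trans (h X hX)

theorem dist_univ (E : QObservable Ω) (ψ : QHilbert) :
    E.dist ψ univ = ‖ψ‖ₑ ^ 2 := by
  have h := E.inner_effect ψ MeasurableSet.univ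
  rw [E.effect_univ, ContinuousLinearMap.id_apply, inner_self_eq_norm_sq_to_K] at h
  have h' : ‖ψ‖ ^ 2 = (E.dist ψ).real univ :=
    Complex.ofReal_injective (by rw [← h]; simp)
  rw [← ENNReal.ofReal_toReal (measure_ne_top (E.dist ψ) univ), ← measureReal_def, ← h',
    ENNReal.ofReal_pow (norm_nonneg _), ofReal_norm]

theorem fst_dist (M : QObservable (ℝ × ℝ)) (ψ : QHilbert) :
    M.fst.dist ψ = (M.dist ψ).map Prod.fst := by
  refine dist_eq_of_inner _ _ _ fun X hX => ?_
  rw [map_measureReal_apply measurable_fst hX, ← prod_univ]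
  exact M.inner_effect ψ (hX.prod MeasurableSet.univ)

theorem snd_dist (M : QObservable (ℝ × ℝ)) (ψ : QHilbert) :
    M.snd.dist ψ = (M.dist ψ).map Prod.snd := by
  refine dist_eq_of_inner _ _ _ fun X hX => ?_
  rw [map_measureReal_apply measurable_snd hX, ← univ_prod]
  exact M.inner_effect ψ (MeasurableSet.univ.prod hX)

/-- The quadratic forms of the effects agree on D, hence everywhere by continuity. Over ℂ,
polarization recovers an operator from its quadratic form. -/
theorem effect_eq_of_inner_eq (E F : QObservable Ω) {D : Submodule ℂ QHilbert}
    (hD : Dense (D : Set QHilbert)) (h : ∀ ψ ∈ D, E.dist ψ = F.dist ψ) : E.SameAs F := by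
  intro X hX
  have h1 : ∀ ψ : QHilbert, ⟪ψ, E.effect X ψ⟫_ℂ = ⟪ψ, F.effect X ψ⟫_ℂ := by
    have := Continuous.ext_on hD
      (f := fun ψ : QHilbert => ⟪ψ, E.effect X ψ⟫_ℂ) (g := fun ψ => ⟪ψ, F.effect X ψ⟫_ℂ)
      (by fun_prop) (by fun_prop)
      (fun ψ hψ => by
        dsimp only
        rw [E.inner_effect ψ hX, F.inner_effect ψ hX, h ψ hψ])
    exact fun ψ => congrFun this ψ
  have h2 : (E.effect X : QHilbert →ₗ[ℂ] QHilbert) = (F.effect X : QHilbert →ₗ[ℂ] QHilbert) := by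
    rw [← ext_inner_map]
    intro ψ
    rw [← inner_conj_symm, ContinuousLinearMap.coe_coe, h1 ψ, inner_conj_symm]
    rfl
  exact ContinuousLinearMap.coe_injective h2

end QObservable

/-! ### Position and momentum distributions -/

theorem enorm_sq_eq_ofReal (z : ℂ) : ‖z‖ₑ ^ 2 = ENNReal.ofReal (‖z‖ ^ 2) := by
  rw [ENNReal.ofReal_pow (norm_nonneg _), ofReal_norm]

theorem lintegral_enorm_sq_eq (ψ : QHilbert) : ∫⁻ x, ‖ψ x‖ₑ ^ 2 = ‖ψ‖ₑ ^ 2 := by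
  have h := Lp.enorm_def ψ
  rw [eLpNorm_eq_lintegral_rpow_enorm_toReal (by norm_num) (by norm_num)] at h
  rw [h]
  norm_num
  rw [← ENNReal.rpow_natCast, ← ENNReal.rpow_mul]
  norm_num

instance isFiniteMeasure_withDensity_enorm_sq (ψ : QHilbert) :
    IsFiniteMeasure (volume.withDensity fun x => ‖ψ x‖ₑ ^ 2) :=
  isFiniteMeasure_withDensity (by
    rw [lintegral_enorm_sq_eq]; exact ENNReal.pow_ne_top enorm_ne_top)

theorem enorm_indicatorOp_sq {X : Set ℝ} (hX : MeasurableSet X) (ψ : QHilbert) :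
    ‖indicatorOp X ψ‖ₑ ^ 2 = ∫⁻ x in X, ‖ψ x‖ₑ ^ 2 := by
  rw [← lintegral_enorm_sq_eq, ← lintegral_indicator hX]
  refine lintegral_congr_ae ?_
  filter_upwards [coeFn_indicatorOp hX ψ] with x hx
  rw [hx]
  by_cases h : x ∈ X <;> simp [h]

theorem inner_indicatorOp_left {X : Set ℝ} (hX : MeasurableSet X) (φ ψ : QHilbert) :
    ⟪indicatorOp X φ, ψ⟫_ℂ = ⟪φ, indicatorOp X ψ⟫_ℂ := by
  rw [L2.inner_def, L2.inner_def]
  refine integral_congr_ae ?_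
  filter_upwards [coeFn_indicatorOp hX ψ, coeFn_indicatorOp hX φ] with x h1 h2
  rw [h1, h2]
  by_cases h : x ∈ X <;> simp [h]

theorem indicatorOp_indicatorOp {X : Set ℝ} (hX : MeasurableSet X) (ψ : QHilbert) :
    indicatorOp X (indicatorOp X ψ) = indicatorOp X ψ := by
  refine Lp.ext ?_
  filter_upwards [coeFn_indicatorOp hX ψ, coeFn_indicatorOp hX (indicatorOp X ψ)] with x h1 h2
  rw [h2]
  by_cases h : x ∈ X <;> simp [h, h1]

theorem inner_indicatorOp_self {X : Set ℝ} (hX : MeasurableSet X) (ψ : QHilbert) :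
    ⟪ψ, indicatorOp X ψ⟫_ℂ =
      (((volume.withDensity fun x => ‖ψ x‖ₑ ^ 2).real X : ℝ) : ℂ) := by
  rw [← indicatorOp_indicatorOp hX, ← inner_indicatorOp_left hX, inner_self_eq_norm_sq_to_K,
    measureReal_def, withDensity_apply _ hX, ← enorm_indicatorOp_sq hX, ENNReal.toReal_pow,
    toReal_enorm]
  simp

theorem positionObservable_dist (ψ : QHilbert) :
    positionObservable.dist ψ = volume.withDensity fun x => ‖ψ x‖ₑ ^ 2 :=
  QObservable.dist_eq_of_inner _ _ _ fun _ hX => inner_indicatorOp_self hX ψ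

theorem measurable_enorm_sq (ψ : QHilbert) : Measurable fun x => ‖ψ x‖ₑ ^ 2 :=
  (Lp.stronglyMeasurable ψ).measurable.enorm.pow_const 2

theorem lintegral_positionObservable_dist (ψ : QHilbert) {g : ℝ → ℝ≥0∞} (hg : Measurable g) :
    ∫⁻ x, g x ∂(positionObservable.dist ψ) = ∫⁻ x, ‖ψ x‖ₑ ^ 2 * g x := by
  rw [positionObservable_dist, lintegral_withDensity_eq_lintegral_mul _ (measurable_enorm_sq ψ) hg]
  rfl

theorem measurable_two_pi_mul : Measurable fun ξ : ℝ => 2 * Real.pi * ξ := by fun_prop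

theorem inner_fourierL2_symm (φ ψ : QHilbert) :
    ⟪φ, fourierL2.symm ψ⟫_ℂ = ⟪fourierL2 φ, ψ⟫_ℂ := by
  rw [← fourierL2.inner_map_map, LinearIsometryEquiv.apply_symm_apply]

theorem momentumObservable_dist (ψ : QHilbert) :
    momentumObservable.dist ψ =
      (positionObservable.dist (fourierL2 ψ)).map fun ξ : ℝ => 2 * Real.pi * ξ := by
  refine QObservable.dist_eq_of_inner _ _ _ fun Y hY => ?_
  rw [map_measureReal_apply measurable_two_pi_mul hY,
    ← positionObservable.inner_effect _ (measurable_two_pi_mul hY)]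
  exact inner_fourierL2_symm _ _

theorem isStarProjection_indicatorOp {X : Set ℝ} (hX : MeasurableSet X) :
    IsStarProjection (indicatorOp X) := by
  constructor
  · ext1 ψ
    exact indicatorOp_indicatorOp hX ψ
  · rw [ContinuousLinearMap.isSelfAdjoint_iff_isSymmetric]
    exact fun φ ψ => inner_indicatorOp_left hX φ ψ

theorem positionObservable_isSharp : positionObservable.IsSharp :=
  fun _ hX => isStarProjection_indicatorOp hX

theorem momentumObservable_isSharp : momentumObservable.IsSharp := by
  intro Y hY
  have hX := measurable_two_pi_mul hY
  constructor
  · ext1 ψ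
    change fourierL2.symm (indicatorOp _ (fourierL2 (fourierL2.symm (indicatorOp _ (fourierL2 ψ)))))
      = fourierL2.symm (indicatorOp _ (fourierL2 ψ))
    rw [LinearIsometryEquiv.apply_symm_apply, indicatorOp_indicatorOp hX]
  · rw [ContinuousLinearMap.isSelfAdjoint_iff_isSymmetric]
    intro φ ψ
    change ⟪fourierL2.symm (indicatorOp _ (fourierL2 φ)), ψ⟫_ℂ
      = ⟪φ, fourierL2.symm (indicatorOp _ (fourierL2 ψ))⟫_ℂ
    rw [inner_fourierL2_symm, ← inner_conj_symm, inner_fourierL2_symm, inner_conj_symm,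
      inner_indicatorOp_left hX]

/-! ### Moments -/

theorem integrable_positionObservable_dist_iff (ψ : QHilbert) {g : ℝ → ℝ} :
    Integrable g (positionObservable.dist ψ) ↔ Integrable fun x => ‖ψ x‖ ^ 2 * g x := by
  rw [positionObservable_dist, integrable_withDensity_iff_integrable_smul' (measurable_enorm_sq ψ)
    (.of_forall fun x => ENNReal.pow_lt_top enorm_lt_top)]
  refine integrable_congr (.of_forall fun x => ?_)
  simp

theorem integral_positionObservable_dist (ψ : QHilbert) (g : ℝ → ℝ) :
    ∫ x, g x ∂(positionObservable.dist ψ) = ∫ x, ‖ψ x‖ ^ 2 * g x := by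
  rw [positionObservable_dist, integral_withDensity_eq_integral_toReal_smul (measurable_enorm_sq ψ)
    (.of_forall fun x => ENNReal.pow_lt_top enorm_lt_top)]
  refine integral_congr_ae (.of_forall fun x => ?_)
  simp

theorem coeFn_positionPow (k : ℕ) (ψ : (positionPow k).domain) :
    positionPow k ψ =ᵐ[volume] fun x : ℝ => (x : ℂ) ^ k * (ψ : QHilbert) x :=
  MemLp.coeFn_toLp ψ.2

theorem positionObservable_hasMoment_and_inner (k : ℕ) (ψ : (positionPow k).domain) :
    positionObservable.HasMoment k ψ ∧
      ⟪(ψ : QHilbert), positionPow k ψ⟫_ℂ = ((positionObservable.moment k ψ : ℝ) : ℂ) := by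
  have he : (fun x => ⟪(ψ : QHilbert) x, positionPow k ψ x⟫_ℂ) =ᵐ[volume]
      fun x => ((‖(ψ : QHilbert) x‖ ^ 2 * x ^ k : ℝ) : ℂ) := by
    filter_upwards [coeFn_positionPow k ψ] with x hx
    rw [hx, ← smul_eq_mul, inner_smul_right, inner_self_eq_norm_sq_to_K]
    push_cast
    ring_nf
    rfl
  constructor
  · rw [QObservable.HasMoment, integrable_positionObservable_dist_iff]
    have h := (L2.integrable_inner (𝕜 := ℂ) (ψ : QHilbert) (positionPow k ψ)).congr he
    exact h.re
  · rw [QObservable.moment, integral_positionObservable_dist, L2.inner_def, integral_congr_ae he,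
      integral_complex_ofReal]

theorem momentumObservable_hasMoment_iff (k : ℕ) (ψ : QHilbert) :
    momentumObservable.HasMoment k ψ ↔ positionObservable.HasMoment k (fourierL2 ψ) := by
  rw [QObservable.HasMoment, momentumObservable_dist, integrable_map_measure
    (by fun_prop) measurable_two_pi_mul.aemeasurable]
  simp only [Function.comp_def, mul_pow]
  rw [integrable_const_mul_iff (by
    simp [isUnit_iff_ne_zero, Real.pi_ne_zero])]
  rfl

theorem momentumObservable_moment (k : ℕ) (ψ : QHilbert) :
    momentumObservable.moment k ψ =
      (2 * Real.pi) ^ k * positionObservable.moment k (fourierL2 ψ) := by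
  rw [QObservable.moment, momentumObservable_dist, integral_map
    measurable_two_pi_mul.aemeasurable (by fun_prop), QObservable.moment,
    ← integral_const_mul]
  simp only [mul_pow]

theorem momentumObservable_hasMoment_and_inner (k : ℕ) (ψ : (momentumPow k).domain) :
    momentumObservable.HasMoment k ψ ∧
      ⟪(ψ : QHilbert), momentumPow k ψ⟫_ℂ = ((momentumObservable.moment k ψ : ℝ) : ℂ) := by
  obtain ⟨h1, h2⟩ := positionObservable_hasMoment_and_inner k ⟨fourierL2 ψ, ψ.2⟩
  refine ⟨(momentumObservable_hasMoment_iff k _).2 h1, ?_⟩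
  rw [momentumObservable_moment]
  change ⟪(ψ : QHilbert), ((2 * Real.pi : ℂ) ^ k) •
    fourierL2.symm (positionPow k ⟨fourierL2 ψ, ψ.2⟩)⟫_ℂ = _
  rw [inner_smul_right, inner_fourierL2_symm, h2]
  push_cast
  rfl

/-- Expressing domains through distributions lets position and momentum be treated by one argument
later on. -/
theorem mem_positionPow_domain_iff (k : ℕ) (ψ : QHilbert) :
    ψ ∈ (positionPow k).domain ↔
      ∫⁻ x, ‖x ^ k‖ₑ ^ 2 ∂(positionObservable.dist ψ) < ∞ := by
  rw [lintegral_positionObservable_dist _ (by fun_prop)]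
  change MemLp (fun x : ℝ => (x : ℂ) ^ k * ψ x) 2 volume ↔ _
  have hm : AEStronglyMeasurable (fun x : ℝ => (x : ℂ) ^ k * ψ x) volume :=
    (by fun_prop : Continuous fun x : ℝ => (x : ℂ) ^ k).aestronglyMeasurable.mul
      (Lp.aestronglyMeasurable ψ)
  rw [MemLp, and_iff_right hm, eLpNorm_lt_top_iff_lintegral_rpow_enorm_lt_top (by norm_num)
    (by norm_num)]
  have : ∀ x : ℝ, ‖(x : ℂ) ^ k * ψ x‖ₑ ^ (2 : ℝ≥0∞).toReal = ‖ψ x‖ₑ ^ 2 * ‖x ^ k‖ₑ ^ 2 := by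
    intro x
    have h : ‖(x : ℂ)‖ₑ = ‖x‖ₑ := by
      rw [← ofReal_norm, ← ofReal_norm, Complex.norm_real]
    simp only [ENNReal.toReal_ofNat, ENNReal.rpow_ofNat, enorm_mul, enorm_pow, h]
    ring
  simp only [this]

theorem mem_momentumPow_domain_iff (k : ℕ) (ψ : QHilbert) :
    ψ ∈ (momentumPow k).domain ↔ fourierL2 ψ ∈ (positionPow k).domain :=
  Iff.rfl

/-! ### The Fourier–Plancherel operator -/

open scoped FourierTransform

theorem fourierL2_toLp (f : 𝓢(ℝ, ℂ)) : fourierL2 (f.toLp 2) = (𝓕 f).toLp 2 :=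
  SchwartzMap.toLp_fourier_eq f

/-- The L² transform agrees with the transform of tempered distributions, which acts by moving `𝓕`
onto the test function. -/
theorem integral_schwartz_smul_fourierL2 (f : QHilbert) (g : 𝓢(ℝ, ℂ)) :
    ∫ x, g x • fourierL2 f x = ∫ x, (𝓕 g) x • f x := by
  have h := congrArg (fun T => T g) (Lp.fourier_toTemperedDistribution_eq f)
  simp only [TemperedDistribution.fourier_apply] at h
  rw [Lp.toTemperedDistribution_apply, Lp.toTemperedDistribution_apply] at h
  exact h.symm

theorem integral_schwartz_smul_fourier {h : ℝ → ℂ} (hh : Integrable h) (g : 𝓢(ℝ, ℂ)) :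
    ∫ x, g x • 𝓕 h x = ∫ x, (𝓕 g) x • h x := by
  have := VectorFourier.integral_fourierIntegral_smul_eq_flip (L := innerₗ ℝ)
    Real.continuous_fourierChar continuous_inner (g.integrable (μ := volume)) hh
  rw [flip_innerₗ] at this
  rw [SchwartzMap.fourier_coe]
  exact this.symm

/-- On `L¹ ∩ L²` the Fourier–Plancherel operator is given by the Fourier integral. -/
theorem fourierL2_toLp_ae_eq {h : ℝ → ℂ} (h1 : Integrable h) (h2 : MemLp h 2) :
    fourierL2 h2.toLp =ᵐ[volume] 𝓕 h := by
  have hc : Continuous (𝓕 h) :=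
    VectorFourier.fourierIntegral_continuous Real.continuous_fourierChar
      (L := innerₗ ℝ) continuous_inner h1
  -- Both sides are locally integrable, so it is enough to test them against smooth compactly
  -- supported functions; on either side `𝓕` moves onto the test function.
  refine ae_eq_of_integral_contDiff_smul_eq ((Lp.memLp _).locallyIntegrable (by norm_num))
    hc.locallyIntegrable fun g hg hgc => ?_
  have hgc' : HasCompactSupport (fun x => (g x : ℂ)) := hgc.comp_left Complex.ofReal_zero
  let G : 𝓢(ℝ, ℂ) := hgc'.toSchwartzMap (Complex.ofRealCLM.contDiff.comp hg)
  have e1 := integral_schwartz_smul_fourierL2 h2.toLp G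
  have e2 := integral_schwartz_smul_fourier h1 G
  have e3 : ∫ x, (𝓕 G) x • h2.toLp h x = ∫ x, (𝓕 G) x • h x :=
    integral_congr_ae (by filter_upwards [h2.coeFn_toLp] with x hx; rw [hx])
  rw [e3, ← e2] at e1
  exact e1

theorem lintegral_enorm_fourier_sq {h : ℝ → ℂ} (h1 : Integrable h) (h2 : MemLp h 2) :
    ∫⁻ ξ, ‖𝓕 h ξ‖ₑ ^ 2 = ∫⁻ x, ‖h x‖ₑ ^ 2 := by
  calc ∫⁻ ξ, ‖𝓕 h ξ‖ₑ ^ 2 = ∫⁻ ξ, ‖fourierL2 h2.toLp ξ‖ₑ ^ 2 :=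
        lintegral_congr_ae (by
          filter_upwards [fourierL2_toLp_ae_eq h1 h2] with x hx; rw [hx])
    _ = ∫⁻ x, ‖h2.toLp h x‖ₑ ^ 2 := by
        rw [lintegral_enorm_sq_eq, lintegral_enorm_sq_eq, ← ofReal_norm, ← ofReal_norm,
          LinearIsometryEquiv.norm_map]
    _ = _ := lintegral_congr_ae (by filter_upwards [h2.coeFn_toLp] with x hx; rw [hx])

/-- A dilation is a measurable embedding, so the change of variables holds for arbitrary `f`. -/
theorem lintegral_comp_mul_left (f : ℝ → ℝ≥0∞) {c : ℝ} (hc : 0 < c) :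
    ∫⁻ x, f x = ENNReal.ofReal c * ∫⁻ x, f (c * x) := by
  have h := Real.map_volume_mul_left hc.ne'
  have he : MeasurableEmbedding fun x : ℝ => c * x :=
    (Homeomorph.mulLeft₀ c hc.ne').measurableEmbedding
  rw [← he.lintegral_map, h, lintegral_smul_measure, smul_eq_mul, ← mul_assoc,
    abs_of_pos (inv_pos.2 hc), ← ENNReal.ofReal_mul hc.le, mul_inv_cancel₀ hc.ne',
    ENNReal.ofReal_one, one_mul]

theorem fourier_div_two_pi (h : ℝ → ℂ) (p : ℝ) :
    𝓕 h (p / (2 * Real.pi)) = ∫ x : ℝ, Complex.exp (-(p * x : ℝ) * Complex.I) * h x := by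
  rw [Real.fourier_real_eq_integral_exp_smul]
  refine integral_congr_ae (.of_forall fun x => ?_)
  dsimp only
  rw [smul_eq_mul]
  congr 2
  have : -2 * Real.pi * x * (p / (2 * Real.pi)) = -(p * x) := by
    field_simp
  rw [this]
  push_cast
  ring

/-- Plancherel's theorem for the transform `∫ e^{-ipx} h(x) dx`. -/
theorem lintegral_enorm_integral_exp_sq {h : ℝ → ℂ} (h1 : Integrable h) (h2 : MemLp h 2) :
    ∫⁻ p : ℝ, ‖∫ x : ℝ, Complex.exp (-(p * x : ℝ) * Complex.I) * h x‖ₑ ^ 2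
      = ENNReal.ofReal (2 * Real.pi) * ∫⁻ x, ‖h x‖ₑ ^ 2 := by
  rw [lintegral_comp_mul_left _ Real.two_pi_pos, ← lintegral_enorm_fourier_sq h1 h2]
  congr 1
  refine lintegral_congr fun ξ => ?_
  rw [← fourier_div_two_pi]
  congr 3
  field_simp

/-! ### Weyl operators -/

theorem norm_weylOp (z : ℝ × ℝ) (ψ : QHilbert) : ‖weylOp z ψ‖ = ‖ψ‖ := by
  have h : ‖translationOp z.1 ψ‖ = ‖ψ‖ := LinearIsometry.norm_map _ _
  rw [← h]
  refine le_antisymm ?_ ?_ <;>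
  · refine Lp.norm_le_norm_of_ae_le ?_
    filter_upwards [coeFn_mulOp _ (by fun_prop) (norm_weylPhase_le z) (translationOp z.1 ψ)]
      with x hx
    rw [show weylOp z ψ x = _ from hx, norm_mul, Complex.norm_exp_ofReal_mul_I, one_mul]

/-- Translation and modulation exchange roles, (q, p) becoming (p/2π, -2πq). The symmetric phase
e^{-iqp/2} is what makes the result a Weyl operator again, with no extra factor. -/
theorem fourier_weyl (f : ℝ → ℂ) (q p ξ : ℝ) :
    𝓕 (fun x : ℝ => Complex.exp (((p * x - q * p / 2 : ℝ) : ℂ) * Complex.I) * f (x - q)) ξ =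
      Complex.exp (((-2 * Real.pi * q * ξ - (p / (2 * Real.pi)) * (-2 * Real.pi * q) / 2 : ℝ) : ℂ)
        * Complex.I) * 𝓕 f (ξ - p / (2 * Real.pi)) := by
  rw [Real.fourier_real_eq_integral_exp_smul, Real.fourier_real_eq_integral_exp_smul,
    ← integral_const_mul, ← integral_add_right_eq_self _ q]
  refine integral_congr_ae (.of_forall fun x => ?_)
  simp only [smul_eq_mul, ← mul_assoc, ← Complex.exp_add, ← add_mul, add_sub_cancel_right]
  congr 3
  have := Complex.ofReal_ne_zero.2 Real.pi_ne_zero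
  push_cast
  field_simp
  ring

/-- Both sides are continuous in ψ, so the Fourier integral needs to be computed only for Schwartz
functions. -/
theorem fourierL2_weylOp (q p : ℝ) (ψ : QHilbert) :
    fourierL2 (weylOp (q, p) ψ) =
      weylOp (p / (2 * Real.pi), -2 * Real.pi * q) (fourierL2 ψ) := by
  have hd := SchwartzMap.denseRange_toLpCLM (E := ℝ) (F := ℂ) (p := 2) (μ := volume)
    ENNReal.ofNat_ne_top
  refine congrFun (f := fun ψ => fourierL2 (weylOp (q, p) ψ)) (hd.equalizer
    (fourierL2.continuous.comp (weylOp (q, p)).continuous)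
    (h := fun ψ => weylOp (p / (2 * Real.pi), -2 * Real.pi * q) (fourierL2 ψ))
    ((weylOp (p / (2 * Real.pi), -2 * Real.pi * q)).continuous.comp fourierL2.continuous) ?_) ψ
  ext1 f
  simp only [Function.comp_apply, SchwartzMap.toLpCLM_apply]
  rw [fourierL2_toLp]
  have hm := measurePreserving_sub_right (volume : Measure ℝ) q
  have hm' := measurePreserving_sub_right (volume : Measure ℝ) (p / (2 * Real.pi))
  set h : ℝ → ℂ := fun x =>
    Complex.exp (((p * x - q * p / 2 : ℝ) : ℂ) * Complex.I) * f (x - q) with hh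
  have hae : weylOp (q, p) (f.toLp 2) =ᵐ[volume] h := by
    filter_upwards [coeFn_weylOp q p (f.toLp 2),
      hm.quasiMeasurePreserving.ae (f.coeFn_toLp 2 volume)] with x h1 h2
    rw [h1, h2]
  have h2 : MemLp h 2 := (memLp_congr_ae hae).1 (Lp.memLp _)
  have h1 : Integrable h := by
    have := (f.integrable (μ := volume)).comp_sub_right q
    refine this.bdd_mul (c := 1) (by fun_prop) (.of_forall fun x => ?_)
    exact (Complex.norm_exp_ofReal_mul_I _).le
  have e : weylOp (q, p) (f.toLp 2) = h2.toLp :=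
    Lp.ext (hae.trans h2.coeFn_toLp.symm)
  refine Lp.ext ?_
  rw [e]
  filter_upwards [fourierL2_toLp_ae_eq h1 h2,
    coeFn_weylOp (p / (2 * Real.pi)) (-2 * Real.pi * q) ((𝓕 f).toLp 2),
    hm'.quasiMeasurePreserving.ae ((𝓕 f).coeFn_toLp 2 volume)] with x e1 e2 e3
  rw [e1, e2, e3, hh, fourier_weyl, SchwartzMap.fourier_coe]

/-! ### Strong continuity of the Weyl operators -/

theorem continuous_translationOp :
    Continuous fun a : ℝ × QHilbert => translationOp a.1 a.2 := by
  let c : ℝ → C(ℝ, ℝ) := fun q => ⟨fun x => x - q, by fun_prop⟩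
  have hc : Continuous c := ContinuousMap.continuous_of_continuous_uncurry _ (by
    change Continuous fun a : ℝ × ℝ => a.2 - a.1
    fun_prop)
  have h := Lp.compMeasurePreserving_continuous (volume : Measure ℝ) (volume : Measure ℝ) ℂ
    (p := 2) (by norm_num)
  have h2 : Continuous fun a : ℝ × QHilbert =>
      ((a.2, ⟨c a.1, measurePreserving_sub_right volume a.1⟩) :
        QHilbert × {f : C(ℝ, ℝ) // MeasurePreserving f volume volume}) :=
    continuous_snd.prodMk ((hc.comp continuous_fst).subtype_mk _)
  exact h.comp h2

theorem weylOp_zero_right (q : ℝ) (ψ : QHilbert) : weylOp (q, 0) ψ = translationOp q ψ := by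
  refine Lp.ext ?_
  filter_upwards [coeFn_mulOp _ (by fun_prop) (norm_weylPhase_le (q, 0)) (translationOp q ψ)]
    with x hx
  rw [show weylOp (q, 0) ψ x = _ from hx]
  simp

/-- A modulation is a translation conjugated by the Fourier transform; strong continuity of the Weyl
operators thus reduces to that of translations. -/
theorem weylOp_eq_smul (z : ℝ × ℝ) (ψ : QHilbert) :
    weylOp z ψ = Complex.exp ((-(z.1 * z.2 / 2) : ℝ) * Complex.I) •
      fourierL2.symm (translationOp (z.2 / (2 * Real.pi)) (fourierL2 (translationOp z.1 ψ))) := by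
  have h := fourierL2_weylOp 0 z.2 (translationOp z.1 ψ)
  rw [mul_zero, weylOp_zero_right] at h
  rw [← h, LinearIsometryEquiv.symm_apply_apply]
  refine Lp.ext ?_
  filter_upwards [Lp.coeFn_smul (Complex.exp ((-(z.1 * z.2 / 2) : ℝ) * Complex.I))
      (weylOp (0, z.2) (translationOp z.1 ψ)),
    coeFn_mulOp _ (by fun_prop) (norm_weylPhase_le z) (translationOp z.1 ψ),
    coeFn_weylOp 0 z.2 (translationOp z.1 ψ)] with x h1 h2 h3
  rw [h1, show weylOp z ψ x = _ from h2, Pi.smul_apply, h3, sub_zero, smul_eq_mul, ← mul_assoc,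
    ← Complex.exp_add]
  congr 2
  push_cast
  ring

/-- Continuity jointly in z and ψ supplies the joint measurability that Tonelli's theorem requires
for frames over phase space. -/
theorem continuous_weylOp : Continuous fun a : (ℝ × ℝ) × QHilbert => weylOp a.1 a.2 := by
  simp only [weylOp_eq_smul]
  have h1 : Continuous fun a : (ℝ × ℝ) × QHilbert => translationOp a.1.1 a.2 :=
    continuous_translationOp.comp ((continuous_fst.comp continuous_fst).prodMk continuous_snd)
  have h2 : Continuous fun a : (ℝ × ℝ) × QHilbert =>
      Complex.exp ((-(a.1.1 * a.1.2 / 2) : ℝ) * Complex.I) := by fun_prop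
  have h3 : Continuous fun a : (ℝ × ℝ) × QHilbert => a.1.2 / (2 * Real.pi) := by fun_prop
  exact h2.smul (fourierL2.symm.continuous.comp (continuous_translationOp.comp
    (h3.prodMk (fourierL2.continuous.comp h1))))

theorem continuous_weylOp_inner (ψ : QHilbert) :
    Continuous fun a : (ℝ × ℝ) × QHilbert => ⟪weylOp a.1 a.2, ψ⟫_ℂ :=
  continuous_weylOp.inner continuous_const

theorem measurable_weylOp_inner {S : Type*} [MeasurableSpace S] {u : S → QHilbert}
    (hu : StronglyMeasurable u) (ψ : QHilbert) :
    Measurable fun a : S × (ℝ × ℝ) => ‖⟪weylOp a.2 (u a.1), ψ⟫_ℂ‖ₑ ^ 2 := by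
  have h1 : StronglyMeasurable fun a : S × (ℝ × ℝ) => a.2 := measurable_snd.stronglyMeasurable
  have h2 : StronglyMeasurable fun a : S × (ℝ × ℝ) => u a.1 := hu.comp_measurable measurable_fst
  have h := (continuous_weylOp_inner ψ).comp_stronglyMeasurable (h1.prodMk h2)
  exact Measurable.pow_const (Measurable.enorm h.measurable) 2

theorem measurable_weylOp_inner_single (u ψ : QHilbert) :
    Measurable fun z : ℝ × ℝ => ‖⟪weylOp z u, ψ⟫_ℂ‖ₑ ^ 2 := by
  have hc : Continuous fun z : ℝ × ℝ => ⟪weylOp z u, ψ⟫_ℂ :=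
    (continuous_weylOp.comp (continuous_id.prodMk continuous_const)).inner continuous_const
  exact hc.measurable.enorm.pow_const 2

/-! ### The orthogonality relations -/

/-- For fixed q this is a Fourier integral in p of ψ seen through the window u, which brings
Plancherel's theorem to bear. -/
theorem inner_weylOp (q p : ℝ) (u ψ : QHilbert) :
    ⟪weylOp (q, p) u, ψ⟫_ℂ = Complex.exp (((q * p / 2 : ℝ) : ℂ) * Complex.I) *
      ∫ x : ℝ, Complex.exp (-(p * x : ℝ) * Complex.I) * ((starRingEnd ℂ) (u (x - q)) * ψ x) := by
  rw [L2.inner_def, ← integral_const_mul]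
  refine integral_congr_ae ?_
  filter_upwards [coeFn_weylOp q p u] with x hx
  have he : (starRingEnd ℂ) (Complex.exp (((p * x - q * p / 2 : ℝ) : ℂ) * Complex.I)) =
      Complex.exp (((q * p / 2 : ℝ) : ℂ) * Complex.I) *
        Complex.exp (-(p * x : ℝ) * Complex.I) := by
    rw [← Complex.exp_conj, ← Complex.exp_add, map_mul, Complex.conj_ofReal, Complex.conj_I]
    congr 1
    push_cast
    ring
  rw [hx, RCLike.inner_apply, map_mul, he]
  ring

theorem enorm_inner_weylOp (q p : ℝ) (u ψ : QHilbert) :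
    ‖⟪weylOp (q, p) u, ψ⟫_ℂ‖ₑ =
      ‖∫ x : ℝ, Complex.exp (-(p * x : ℝ) * Complex.I) *
        ((starRingEnd ℂ) (u (x - q)) * ψ x)‖ₑ := by
  rw [inner_weylOp, enorm_mul, ← ofReal_norm, Complex.norm_exp_ofReal_mul_I, ENNReal.ofReal_one,
    one_mul]

theorem coeFn_translationOp (q : ℝ) (u : QHilbert) :
    translationOp q u =ᵐ[volume] fun x => u (x - q) :=
  Lp.coeFn_compMeasurePreserving u (measurePreserving_sub_right (volume : Measure ℝ) q)

theorem measurable_coeFn (u : QHilbert) : Measurable u := (Lp.stronglyMeasurable u).measurable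

theorem measurable_density (u ψ : QHilbert) :
    Measurable fun a : ℝ × ℝ => ‖u (a.2 - a.1)‖ₑ ^ 2 * ‖ψ a.2‖ₑ ^ 2 := by
  have := measurable_coeFn u
  have := measurable_coeFn ψ
  fun_prop

theorem conv_reflected_apply (u ψ : QHilbert) {X : Set ℝ} (hX : MeasurableSet X) :
    ((positionObservable.dist ψ).conv ((positionObservable.dist u).map Neg.neg)) X =
      ∫⁻ q in X, ∫⁻ x, ‖u (x - q)‖ₑ ^ 2 * ‖ψ x‖ₑ ^ 2 := by
  have hm1 : Measurable (X.indicator (1 : ℝ → ℝ≥0∞)) := measurable_one.indicator hX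
  rw [← lintegral_indicator_one hX, Measure.lintegral_conv hm1]
  have h1 : ∀ x : ℝ, ∫⁻ y, X.indicator 1 (x + y) ∂((positionObservable.dist u).map Neg.neg) =
      ∫⁻ q in X, ‖u (x - q)‖ₑ ^ 2 := by
    intro x
    rw [lintegral_map (by fun_prop) measurable_neg, lintegral_positionObservable_dist _
      (by fun_prop), ← lintegral_indicator hX, ← lintegral_sub_left_eq_self _ x]
    refine lintegral_congr fun q => ?_
    by_cases h : q ∈ X <;> simp [h]
  simp only [h1]
  have hm := measurable_density u ψ
  have := measurable_coeFn u
  rw [lintegral_positionObservable_dist, lintegral_lintegral_swap hm.aemeasurable]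
  · refine lintegral_congr fun x => ?_
    rw [lintegral_mul_const _ (by fun_prop), mul_comm]
  · have h2 : Measurable fun a : ℝ × ℝ => ‖u (a.1 - a.2)‖ₑ ^ 2 := by fun_prop
    exact h2.lintegral_prod_right'

/-- Plancherel in p at fixed q leaves ∫ |u(x-q)|²|ψ(x)|² dx, the density of the convolution. -/
theorem lintegral_enorm_inner_weylOp_sq (u ψ : QHilbert) {X : Set ℝ} (hX : MeasurableSet X) :
    ∫⁻ q in X, ∫⁻ p, ‖⟪weylOp (q, p) u, ψ⟫_ℂ‖ₑ ^ 2 = ENNReal.ofReal (2 * Real.pi) *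
      ((positionObservable.dist ψ).conv ((positionObservable.dist u).map Neg.neg)) X := by
  have hm := measurable_density u ψ
  have hu := measurable_coeFn u
  have hψ := measurable_coeFn ψ
  -- The windowed function is integrable for every q, but square integrable only for almost every q.
  -- The latter follows from the finite total mass of the convolution.
  have hfin : ∀ᵐ q, ∫⁻ x, ‖u (x - q)‖ₑ ^ 2 * ‖ψ x‖ₑ ^ 2 < ∞ := by
    refine ae_lt_top hm.lintegral_prod_right' ?_
    rw [← setLIntegral_univ, ← conv_reflected_apply u ψ MeasurableSet.univ]
    exact measure_ne_top _ _
  rw [conv_reflected_apply u ψ hX, ← lintegral_const_mul _ hm.lintegral_prod_right']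
  refine lintegral_congr_ae (ae_restrict_of_ae ?_)
  filter_upwards [hfin] with q hq
  have he : ∀ x, ‖(starRingEnd ℂ) (u (x - q)) * ψ x‖ₑ ^ 2 = ‖u (x - q)‖ₑ ^ 2 * ‖ψ x‖ₑ ^ 2 := by
    intro x
    rw [enorm_mul, mul_pow, RCLike.enorm_conj]
  have h1 : Integrable fun x => (starRingEnd ℂ) (u (x - q)) * ψ x := by
    refine (L2.integrable_inner (𝕜 := ℂ) (translationOp q u) ψ).congr ?_
    filter_upwards [coeFn_translationOp q u] with x hx
    rw [hx, RCLike.inner_apply, mul_comm]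
  have h2 : MemLp (fun x => (starRingEnd ℂ) (u (x - q)) * ψ x) 2 := by
    refine ⟨h1.aestronglyMeasurable, ?_⟩
    rw [eLpNorm_lt_top_iff_lintegral_rpow_enorm_lt_top (by norm_num) (by norm_num)]
    simpa only [ENNReal.toReal_ofNat, ENNReal.rpow_ofNat, he] using hq
  simp only [enorm_inner_weylOp]
  rw [lintegral_enorm_integral_exp_sq h1 h2]
  simp only [he]

theorem map_mul_left_conv (c : ℝ) (μ ν : Measure ℝ) [SFinite μ] [SFinite ν] :
    (μ.conv ν).map (fun x => c * x) = (μ.map fun x => c * x).conv (ν.map fun x => c * x) :=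
  Measure.map_conv_addMonoidHom (AddMonoidHom.mulLeft c) (measurable_const_mul c)

/-- The Fourier transform exchanges the two phase space variables, which reduces this to the
position case for the transformed vectors; the dilation by 2π translates ξ into p = 2πξ. -/
theorem lintegral_enorm_inner_weylOp_sq' (u ψ : QHilbert) {Y : Set ℝ} (hY : MeasurableSet Y) :
    ∫⁻ p in Y, ∫⁻ q, ‖⟪weylOp (q, p) u, ψ⟫_ℂ‖ₑ ^ 2 = ENNReal.ofReal (2 * Real.pi) *
      ((momentumObservable.dist ψ).conv ((momentumObservable.dist u).map Neg.neg)) Y := by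
  have h2 : ((positionObservable.dist (fourierL2 u)).map fun ξ : ℝ => 2 * Real.pi * ξ).map Neg.neg
      = ((positionObservable.dist (fourierL2 u)).map Neg.neg).map fun ξ : ℝ => 2 * Real.pi * ξ := by
    rw [Measure.map_map measurable_neg measurable_two_pi_mul,
      Measure.map_map measurable_two_pi_mul measurable_neg]
    congr 1
    ext x
    simp
  rw [momentumObservable_dist, momentumObservable_dist, h2, ← map_mul_left_conv,
    Measure.map_apply measurable_two_pi_mul hY, ← lintegral_enorm_inner_weylOp_sq _ _
    (measurable_two_pi_mul hY), ← lintegral_indicator hY,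
    lintegral_comp_mul_left _ Real.two_pi_pos, ← lintegral_indicator (measurable_two_pi_mul hY)]
  have hpi := Real.pi_ne_zero
  rw [← lintegral_const_mul' _ _ ENNReal.ofReal_ne_top]
  refine lintegral_congr fun p => ?_
  by_cases h : 2 * Real.pi * p ∈ Y
  · rw [indicator_of_mem h, indicator_of_mem (show p ∈ _ ⁻¹' Y from h)]
    have h3 : ∀ q, ‖⟪weylOp (q, 2 * Real.pi * p) u, ψ⟫_ℂ‖ₑ ^ 2 =
        ‖⟪weylOp (p, -(2 * Real.pi * q)) (fourierL2 u), fourierL2 ψ⟫_ℂ‖ₑ ^ 2 := by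
      intro q
      rw [← fourierL2.inner_map_map, fourierL2_weylOp]
      congr 6
      · field_simp
      · ring
    simp only [h3]
    -- The factor 2π is the Jacobian of q ↦ 2πq, and reflection invariance of Lebesgue measure
    -- removes the sign.
    rw [← lintegral_comp_mul_left (fun q => ‖⟪weylOp (p, -q) (fourierL2 u), fourierL2 ψ⟫_ℂ‖ₑ ^ 2)
      Real.two_pi_pos]
    exact lintegral_neg_eq_self (fun q => ‖⟪weylOp (p, q) (fourierL2 u), fourierL2 ψ⟫_ℂ‖ₑ ^ 2)
  · rw [indicator_of_notMem h, indicator_of_notMem (show p ∉ _ ⁻¹' Y from h), mul_zero]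

theorem conv_univ (μ ν : Measure ℝ) [IsFiniteMeasure μ] [IsFiniteMeasure ν] :
    (μ.conv ν) univ = μ univ * ν univ := by
  rw [Measure.conv, Measure.map_apply (by fun_prop) MeasurableSet.univ, preimage_univ,
    ← univ_prod_univ, Measure.prod_prod]

/-- Moyal's identity: the mass of a convolution is the product of the masses. -/
theorem lintegral_enorm_inner_weylOp_sq_univ (u ψ : QHilbert) :
    ∫⁻ z, ‖⟪weylOp z u, ψ⟫_ℂ‖ₑ ^ 2 = ENNReal.ofReal (2 * Real.pi) * (‖ψ‖ₑ ^ 2 * ‖u‖ₑ ^ 2) := by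
  have h := lintegral_enorm_inner_weylOp_sq u ψ MeasurableSet.univ
  rw [conv_univ, Measure.map_apply measurable_neg MeasurableSet.univ, preimage_univ,
    QObservable.dist_univ, QObservable.dist_univ, setLIntegral_univ] at h
  rw [← h, Measure.volume_eq_prod, lintegral_prod _
    (measurable_weylOp_inner_single u ψ).aemeasurable]

/-! ### Positive operators and frames -/

/-- Distinct members are at distance √2, so balls of radius 1/2 around them are disjoint open sets.
-/
theorem Orthonormal.countable_of_separable {H ι : Type*} [NormedAddCommGroup H]
    [InnerProductSpace ℂ H] [TopologicalSpace.SeparableSpace H] {v : ι → H}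
    (hv : Orthonormal ℂ v) : Countable ι := by
  refine Pairwise.countable_of_isOpen_disjoint (s := fun i => Metric.ball (v i) (1 / 2))
    (fun i j hij => Metric.ball_disjoint_ball ?_) (fun _ => Metric.isOpen_ball)
    (fun i => ⟨v i, Metric.mem_ball_self (by norm_num)⟩)
  have h : dist (v i) (v j) ^ 2 = 2 := by
    rw [dist_eq_norm, @norm_sub_sq ℂ, hv.1 i, hv.1 j, hv.2 hij]
    norm_num
  have h0 : 0 ≤ dist (v i) (v j) := dist_nonneg
  nlinarith

instance : TopologicalSpace.SeparableSpace QHilbert := by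
  have : Fact ((2 : ℝ≥0∞) ≠ ∞) := ⟨by norm_num⟩
  have : SecondCountableTopology QHilbert := inferInstance
  infer_instance

theorem countable_hilbertBasis {ι : Type*} (b : HilbertBasis ι ℂ QHilbert) : Countable ι :=
  b.orthonormal.countable_of_separable

theorem HilbertBasis.tsum_enorm_inner_sq {ι : Type*} (b : HilbertBasis ι ℂ QHilbert)
    (ψ : QHilbert) : ∑' i, ‖⟪b i, ψ⟫_ℂ‖ₑ ^ 2 = ‖ψ‖ₑ ^ 2 := by
  have h := (b.hasSum_inner_mul_inner ψ ψ).mapL Complex.reCLM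
  have h2 : HasSum (fun i => ‖⟪b i, ψ⟫_ℂ‖ ^ 2) (‖ψ‖ ^ 2) := by
    convert h using 1
    · ext i
      change _ = (⟪ψ, b i⟫_ℂ * ⟪b i, ψ⟫_ℂ).re
      rw [← inner_conj_symm, RCLike.norm_conj, Complex.mul_conj']
      norm_cast
    · exact norm_sq_eq_re_inner (𝕜 := ℂ) ψ
  simp only [enorm_sq_eq_ofReal]
  rw [← ENNReal.ofReal_tsum_of_nonneg (fun i => by positivity) h2.summable, h2.tsum_eq,
    ENNReal.ofReal_pow (norm_nonneg _), ofReal_norm]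

section opSqrt

variable {H : Type*} [NormedAddCommGroup H] [InnerProductSpace ℂ H] [CompleteSpace H]

theorem opSqrt_mul_self {T : H →L[ℂ] H} (hT : T.IsPositive) (ψ : H) :
    opSqrt T (opSqrt T ψ) = T ψ := by
  have h := CFC.sqrt_mul_sqrt_self T ((ContinuousLinearMap.nonneg_iff_isPositive T).2 hT)
  exact congrArg (fun A : H →L[ℂ] H => A ψ) h

theorem inner_opSqrt (T : H →L[ℂ] H) (φ ψ : H) :
    ⟪opSqrt T φ, ψ⟫_ℂ = ⟪φ, opSqrt T ψ⟫_ℂ :=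
  ((ContinuousLinearMap.nonneg_iff_isPositive _).1 (CFC.sqrt_nonneg T)).isSymmetric φ ψ

end opSqrt

theorem inner_eq_inner_opSqrt {T : QHilbert →L[ℂ] QHilbert} (hT : T.IsPositive) (φ ψ : QHilbert) :
    ⟪φ, T ψ⟫_ℂ = ⟪opSqrt T φ, opSqrt T ψ⟫_ℂ := by
  rw [inner_opSqrt, opSqrt_mul_self hT]

theorem inner_self_eq_norm_opSqrt_sq {T : QHilbert →L[ℂ] QHilbert} (hT : T.IsPositive)
    (ψ : QHilbert) : ⟪ψ, T ψ⟫_ℂ = ((‖opSqrt T ψ‖ ^ 2 : ℝ) : ℂ) := by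
  rw [inner_eq_inner_opSqrt hT, inner_self_eq_norm_sq_to_K]
  simp

/-- `T = ∫ |u_s⟩⟨u_s| dν(s)`, weakly, for a positive operator `T`. -/
structure IsFrame {S : Type*} [MeasurableSpace S] (ν : Measure S) (u : S → QHilbert)
    (T : QHilbert →L[ℂ] QHilbert) : Prop where
  isPositive : T.IsPositive
  stronglyMeasurable : StronglyMeasurable u
  lintegral_eq : ∀ ψ, ∫⁻ s, ‖⟪u s, ψ⟫_ℂ‖ₑ ^ 2 ∂ν = ‖opSqrt T ψ‖ₑ ^ 2

namespace IsFrame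

variable {S : Type*} [MeasurableSpace S] {ν : Measure S} {u : S → QHilbert}
  {T : QHilbert →L[ℂ] QHilbert}

/-- Both sides are tr(A T A*), by Parseval and Tonelli. The right side mentions only T, so the left
side is the same for every frame of T. -/
theorem lintegral_enorm_apply_sq (h : IsFrame ν u T) (A : QHilbert →L[ℂ] QHilbert)
    {ι : Type*} (b : HilbertBasis ι ℂ QHilbert) :
    ∫⁻ s, ‖A (u s)‖ₑ ^ 2 ∂ν = ∑' i, ‖opSqrt T (ContinuousLinearMap.adjoint A (b i))‖ₑ ^ 2 := by
  have := countable_hilbertBasis b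
  simp only [← b.tsum_enorm_inner_sq (A _)]
  rw [lintegral_tsum]
  · refine tsum_congr fun i => ?_
    rw [← h.lintegral_eq]
    refine lintegral_congr fun s => ?_
    rw [← inner_conj_symm, RCLike.enorm_conj, ContinuousLinearMap.adjoint_inner_right]
  · intro i
    have hA := A.continuous.comp_stronglyMeasurable h.stronglyMeasurable
    exact ((stronglyMeasurable_const.inner hA).measurable.enorm.pow_const 2).aemeasurable

end IsFrame

theorem isFrame_count_iff {ι : Type*} [MeasurableSpace ι] [DiscreteMeasurableSpace ι]
    [Countable ι] {u : ι → QHilbert} {T : QHilbert →L[ℂ] QHilbert} :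
    IsFrame Measure.count u T ↔
      T.IsPositive ∧ ∀ ψ, ∑' i, ‖⟪u i, ψ⟫_ℂ‖ₑ ^ 2 = ‖opSqrt T ψ‖ₑ ^ 2 := by
  have hm : ∀ ψ, ∫⁻ s, ‖⟪u s, ψ⟫_ℂ‖ₑ ^ 2 ∂Measure.count = ∑' i, ‖⟪u i, ψ⟫_ℂ‖ₑ ^ 2 := fun ψ =>
    lintegral_count _
  constructor
  · intro h
    exact ⟨h.isPositive, fun ψ => by rw [← hm, h.lintegral_eq]⟩
  · rintro ⟨h1, h2⟩
    exact ⟨h1, StronglyMeasurable.of_discrete, fun ψ => by rw [hm, h2]⟩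

theorem isFrame_opSqrt {T : QHilbert →L[ℂ] QHilbert} (hT : T.IsPositive)
    {ι : Type*} [MeasurableSpace ι] [DiscreteMeasurableSpace ι] (b : HilbertBasis ι ℂ QHilbert) :
    IsFrame Measure.count (fun i => opSqrt T (b i)) T := by
  have := countable_hilbertBasis b
  refine isFrame_count_iff.2 ⟨hT, fun ψ => ?_⟩
  simp only [inner_opSqrt]
  exact b.tsum_enorm_inner_sq _

theorem isFrame_of_isSpectralDecomposition {T : QHilbert →L[ℂ] QHilbert} (hT : T.IsPositive)
    {t : ℕ → ℝ} {η : ℕ → QHilbert} (h : IsSpectralDecomposition T t η) :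
    IsFrame Measure.count (fun j => (Real.sqrt (t j) : ℂ) • η j) T := by
  refine isFrame_count_iff.2 ⟨hT, fun ψ => ?_⟩
  have h1 := ((h.2.2 ψ).mapL (innerSL ℂ ψ)).mapL Complex.reCLM
  have h2 : HasSum (fun j => ‖⟪(Real.sqrt (t j) : ℂ) • η j, ψ⟫_ℂ‖ ^ 2) (‖opSqrt T ψ‖ ^ 2) := by
    convert h1 using 1
    · ext j
      change _ = (⟪ψ, (t j : ℂ) • ⟪η j, ψ⟫_ℂ • η j⟫_ℂ).re
      rw [inner_smul_right, inner_smul_right, inner_smul_left, norm_mul, mul_pow,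
        ← inner_conj_symm ψ, Complex.mul_conj', RCLike.norm_conj, Complex.norm_real,
        Real.norm_eq_abs, sq_abs, Real.sq_sqrt (h.1 j)]
      norm_cast
    · change _ = (⟪ψ, T ψ⟫_ℂ).re
      rw [inner_self_eq_norm_opSqrt_sq hT, Complex.ofReal_re]
  simp only [enorm_sq_eq_ofReal]
  rw [← ENNReal.ofReal_tsum_of_nonneg (fun i => by positivity) h2.summable, h2.tsum_eq,
    ENNReal.ofReal_pow (norm_nonneg _), ofReal_norm]

theorem IsFrame.lintegral_enorm_apply_sq_eq {S S' : Type*} [MeasurableSpace S] [MeasurableSpace S']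
    {ν : Measure S} {u : S → QHilbert} {ν' : Measure S'} {u' : S' → QHilbert}
    {T : QHilbert →L[ℂ] QHilbert} (h : IsFrame ν u T) (h' : IsFrame ν' u' T)
    (A : QHilbert →L[ℂ] QHilbert) :
    ∫⁻ s, ‖A (u s)‖ₑ ^ 2 ∂ν = ∫⁻ s, ‖A (u' s)‖ₑ ^ 2 ∂ν' := by
  obtain ⟨w, b, -⟩ := exists_hilbertBasis ℂ QHilbert
  rw [h.lintegral_enorm_apply_sq A b, h'.lintegral_enorm_apply_sq A b]

/-- The trace formula with A the identity. It also shows that the trace condition does not depend on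
the basis chosen in `IsQState`. -/
theorem IsFrame.isQState_iff {S : Type*} [MeasurableSpace S]
    {ν : Measure S} {u : S → QHilbert} {T : QHilbert →L[ℂ] QHilbert} (h : IsFrame ν u T) :
    IsQState T ↔ ∫⁻ s, ‖u s‖ₑ ^ 2 ∂ν = 1 := by
  have key : ∀ (ι : Type) (b : HilbertBasis ι ℂ QHilbert),
      HasSum (fun i => ⟪b i, T (b i)⟫_ℂ) 1 ↔ ∫⁻ s, ‖u s‖ₑ ^ 2 ∂ν = 1 := by
    intro ι b
    have e := h.lintegral_enorm_apply_sq (ContinuousLinearMap.id ℂ QHilbert) b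
    simp only [ContinuousLinearMap.id_apply, ContinuousLinearMap.adjoint_id] at e
    rw [e]
    simp only [inner_self_eq_norm_opSqrt_sq h.isPositive, ← ofReal_norm,
      ← ENNReal.ofReal_pow (norm_nonneg _)]
    rw [← Complex.ofReal_one, Complex.hasSum_ofReal]
    constructor
    · intro hs
      rw [← ENNReal.ofReal_tsum_of_nonneg (fun i => by positivity) hs.summable, hs.tsum_eq,
        ENNReal.ofReal_one]
    · intro hs
      have h1 : Summable fun i => ‖opSqrt T (b i)‖ ^ 2 := by
        have := ENNReal.summable_toReal (hs.trans_ne ENNReal.one_ne_top)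
        simpa only [ENNReal.toReal_ofReal (sq_nonneg _)] using this
      rw [← ENNReal.ofReal_tsum_of_nonneg (fun i => by positivity) h1, ENNReal.ofReal_eq_one] at hs
      rw [← hs]
      exact h1.hasSum
  constructor
  · rintro ⟨-, ι, b, hb⟩
    exact (key ι b).1 hb
  · intro hs
    obtain ⟨w, b, -⟩ := exists_hilbertBasis ℂ QHilbert
    exact ⟨h.isPositive, w, b, (key w b).2 hs⟩

/-! ### Sharp observables and noise measures -/

/-- For a projection, ⟨ψ|Eψ⟩ = ‖Eψ‖². Probabilities become squared norms of bounded operators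
applied to ψ, to which the trace formula applies. -/
theorem QObservable.IsSharp.dist_apply {O : QObservable ℝ} (hO : O.IsSharp) (ψ : QHilbert)
    {X : Set ℝ} (hX : MeasurableSet X) : O.dist ψ X = ‖O.effect X ψ‖ₑ ^ 2 := by
  have h := O.inner_effect ψ hX
  have hp := hO X hX
  have h1 : O.effect X (O.effect X ψ) = O.effect X ψ :=
    congrArg (fun A : QHilbert →L[ℂ] QHilbert => A ψ) hp.isIdempotentElem.eq
  have h2 := (ContinuousLinearMap.isSelfAdjoint_iff_isSymmetric.1 hp.isSelfAdjoint)
    ψ (O.effect X ψ)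
  simp only [ContinuousLinearMap.coe_coe] at h2
  rw [h1] at h2
  rw [← h2, inner_self_eq_norm_sq_to_K] at h
  have h' : ‖O.effect X ψ‖ ^ 2 = (O.dist ψ).real X :=
    Complex.ofReal_injective (by rw [← h]; simp)
  rw [← ENNReal.ofReal_toReal (measure_ne_top (O.dist ψ) X), ← measureReal_def, ← h',
    ENNReal.ofReal_pow (norm_nonneg _), ofReal_norm]

theorem QObservable.IsSharp.measurable_dist {O : QObservable ℝ} (hO : O.IsSharp)
    {S : Type*} [MeasurableSpace S] {u : S → QHilbert} (hu : StronglyMeasurable u) :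
    Measurable fun s => O.dist (u s) := by
  refine Measure.measurable_of_measurable_coe _ fun X hX => ?_
  simp only [hO.dist_apply _ hX]
  exact ((O.effect X).continuous.comp_stronglyMeasurable hu).enorm.pow_const 2

/-- The mixture of the reflected distributions of `O` in the vectors `u_s`. -/
def noiseMeasure (O : QObservable ℝ) {S : Type*} [MeasurableSpace S] (ν : Measure S)
    (u : S → QHilbert) : Measure ℝ :=
  ν.bind fun s => (O.dist (u s)).map Neg.neg

theorem measurable_reflected_dist {O : QObservable ℝ} (hO : O.IsSharp)
    {S : Type*} [MeasurableSpace S] {u : S → QHilbert} (hu : StronglyMeasurable u) :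
    Measurable fun s => (O.dist (u s)).map Neg.neg :=
  (Measure.measurable_map _ measurable_neg).comp (hO.measurable_dist hu)

theorem noiseMeasure_apply {O : QObservable ℝ} (hO : O.IsSharp)
    {S : Type*} [MeasurableSpace S] {ν : Measure S} {u : S → QHilbert} (hu : StronglyMeasurable u)
    {X : Set ℝ} (hX : MeasurableSet X) :
    noiseMeasure O ν u X = ∫⁻ s, ‖O.effect (Neg.neg ⁻¹' X) (u s)‖ₑ ^ 2 ∂ν := by
  rw [noiseMeasure, Measure.bind_apply hX (measurable_reflected_dist hO hu).aemeasurable]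
  refine lintegral_congr fun s => ?_
  rw [Measure.map_apply measurable_neg hX, hO.dist_apply _ (measurable_neg hX)]

theorem lintegral_noiseMeasure {O : QObservable ℝ} (hO : O.IsSharp)
    {S : Type*} [MeasurableSpace S] {ν : Measure S} {u : S → QHilbert} (hu : StronglyMeasurable u)
    {g : ℝ → ℝ≥0∞} (hg : Measurable g) :
    ∫⁻ x, g x ∂(noiseMeasure O ν u) = ∫⁻ s, ∫⁻ x, g (-x) ∂(O.dist (u s)) ∂ν := by
  rw [noiseMeasure, Measure.lintegral_bind (measurable_reflected_dist hO hu).aemeasurable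
    hg.aemeasurable]
  refine lintegral_congr fun s => ?_
  rw [lintegral_map hg measurable_neg]

/-- On each Borel set the noise is tr(E T E) for a projection E, hence independent of the frame.
Taking a spectral decomposition as one of the frames identifies the noise with f or g. -/
theorem IsFrame.noiseMeasure_eq {O : QObservable ℝ} (hO : O.IsSharp)
    {S S' : Type*} [MeasurableSpace S] [MeasurableSpace S']
    {ν : Measure S} {u : S → QHilbert} {ν' : Measure S'} {u' : S' → QHilbert}
    {T : QHilbert →L[ℂ] QHilbert} (h : IsFrame ν u T) (h' : IsFrame ν' u' T) :
    noiseMeasure O ν u = noiseMeasure O ν' u' := by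
  ext X hX
  rw [noiseMeasure_apply hO h.stronglyMeasurable hX,
    noiseMeasure_apply hO h'.stronglyMeasurable hX, h.lintegral_enorm_apply_sq_eq h']

theorem IsFrame.isProbabilityMeasure_noiseMeasure {O : QObservable ℝ} (hO : O.IsSharp)
    {S : Type*} [MeasurableSpace S]
    {ν : Measure S} {u : S → QHilbert} {T : QHilbert →L[ℂ] QHilbert} (h : IsFrame ν u T)
    (hT : IsQState T) : IsProbabilityMeasure (noiseMeasure O ν u) := by
  constructor
  rw [noiseMeasure_apply hO h.stronglyMeasurable MeasurableSet.univ, preimage_univ, O.effect_univ]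
  exact h.isQState_iff.1 hT

/-- Convolution is additive in each factor, so by Tonelli it commutes with mixing over s. -/
theorem conv_noiseMeasure_apply {O : QObservable ℝ} (hO : O.IsSharp)
    {S : Type*} [MeasurableSpace S] {ν : Measure S} {u : S → QHilbert} (hu : StronglyMeasurable u)
    [IsFiniteMeasure (noiseMeasure O ν u)] (μ : Measure ℝ) [IsFiniteMeasure μ]
    {X : Set ℝ} (hX : MeasurableSet X) :
    (μ.conv (noiseMeasure O ν u)) X =
      ∫⁻ s, (μ.conv ((O.dist (u s)).map Neg.neg)) X ∂ν := by
  have hm1 : Measurable (X.indicator (1 : ℝ → ℝ≥0∞)) := measurable_one.indicator hX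
  have hm2 : Measurable fun y => ∫⁻ x, X.indicator (1 : ℝ → ℝ≥0∞) (y + x) ∂μ :=
    (hm1.comp measurable_add).lintegral_prod_right'
  rw [Measure.conv_comm, ← lintegral_indicator_one hX, Measure.lintegral_conv hm1, noiseMeasure,
    Measure.lintegral_bind (measurable_reflected_dist hO hu).aemeasurable hm2.aemeasurable]
  refine lintegral_congr fun s => ?_
  rw [Measure.conv_comm, ← lintegral_indicator_one hX, Measure.lintegral_conv hm1]

theorem smul_enorm_sq (t : ℝ) (ht : 0 ≤ t) (z : ℂ) :
    ‖(Real.sqrt t : ℂ) * z‖ₑ ^ 2 = ENNReal.ofReal t * ‖z‖ₑ ^ 2 := by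
  rw [enorm_mul, mul_pow]
  congr 1
  rw [enorm_sq_eq_ofReal, Complex.norm_real, Real.norm_eq_abs, sq_abs, Real.sq_sqrt ht]

theorem positionNoise_eq_noiseMeasure {t : ℕ → ℝ} (ht : ∀ j, 0 ≤ t j) (η : ℕ → QHilbert) :
    positionNoise t η = noiseMeasure positionObservable Measure.count
      (fun j => (Real.sqrt (t j) : ℂ) • η j) := by
  ext X hX
  have hm : ∀ j, Measurable (η j) := fun j => measurable_coeFn _
  rw [noiseMeasure_apply positionObservable_isSharp StronglyMeasurable.of_discrete hX,
    lintegral_count, positionNoise, withDensity_apply _ hX, lintegral_tsum]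
  · refine tsum_congr fun j => ?_
    change _ = ‖indicatorOp _ _‖ₑ ^ 2
    rw [enorm_indicatorOp_sq (measurable_neg hX), ← lintegral_indicator hX,
      ← lintegral_indicator (measurable_neg hX), ← lintegral_neg_eq_self]
    refine lintegral_congr_ae ?_
    filter_upwards [Lp.coeFn_smul (Real.sqrt (t j) : ℂ) (η j)] with x hx
    by_cases h : -x ∈ X
    · rw [indicator_of_mem h, indicator_of_mem (show x ∈ Neg.neg ⁻¹' X from h), hx,
        Pi.smul_apply, smul_eq_mul, smul_enorm_sq _ (ht j), neg_neg]
    · rw [indicator_of_notMem h, indicator_of_notMem (show x ∉ Neg.neg ⁻¹' X from h)]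
  · intro j
    have := hm j
    fun_prop

theorem noiseMeasure_momentumObservable {S : Type*} [MeasurableSpace S] (ν : Measure S)
    {u : S → QHilbert} (hu : StronglyMeasurable u) :
    noiseMeasure momentumObservable ν u =
      (noiseMeasure positionObservable ν fun s => fourierL2 (u s)).map
        fun ξ : ℝ => 2 * Real.pi * ξ := by
  ext X hX
  have hu' : StronglyMeasurable fun s => fourierL2 (u s) :=
    fourierL2.continuous.comp_stronglyMeasurable hu
  rw [Measure.map_apply measurable_two_pi_mul hX, noiseMeasure_apply positionObservable_isSharp hu'
    (measurable_two_pi_mul hX), noiseMeasure_apply momentumObservable_isSharp hu hX]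
  refine lintegral_congr fun s => ?_
  change ‖fourierL2.symm (indicatorOp _ _)‖ₑ ^ 2 = ‖indicatorOp _ _‖ₑ ^ 2
  rw [← ofReal_norm, LinearIsometryEquiv.norm_map, ofReal_norm]
  congr 4
  ext x
  simp

theorem momentumNoise_eq_map (t : ℕ → ℝ) (η : ℕ → QHilbert) :
    momentumNoise t η = (positionNoise t fun j => fourierL2 (η j)).map
      fun ξ : ℝ => 2 * Real.pi * ξ := by
  ext X hX
  have hpi := Real.pi_ne_zero
  rw [Measure.map_apply measurable_two_pi_mul hX, momentumNoise, positionNoise,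
    withDensity_apply _ hX, withDensity_apply _ (measurable_two_pi_mul hX),
    ← lintegral_indicator hX, lintegral_comp_mul_left _ Real.two_pi_pos,
    ← lintegral_indicator (measurable_two_pi_mul hX),
    ← lintegral_const_mul' _ _ ENNReal.ofReal_ne_top]
  refine lintegral_congr fun x => ?_
  by_cases h : 2 * Real.pi * x ∈ X
  · rw [indicator_of_mem h, indicator_of_mem (show x ∈ _ ⁻¹' X from h), ← ENNReal.tsum_mul_left]
    refine tsum_congr fun j => ?_
    rw [mul_left_comm, ← mul_assoc (ENNReal.ofReal (2 * Real.pi)),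
      ← ENNReal.ofReal_mul Real.two_pi_pos.le, mul_one_div_cancel Real.two_pi_pos.ne',
      ENNReal.ofReal_one, one_mul]
    congr 4
    field_simp
  · rw [indicator_of_notMem h, indicator_of_notMem (show x ∉ _ ⁻¹' X from h), mul_zero]

theorem momentumNoise_eq_noiseMeasure {t : ℕ → ℝ} (ht : ∀ j, 0 ≤ t j) (η : ℕ → QHilbert) :
    momentumNoise t η = noiseMeasure momentumObservable Measure.count
      (fun j => (Real.sqrt (t j) : ℂ) • η j) := by
  rw [momentumNoise_eq_map, noiseMeasure_momentumObservable _ StronglyMeasurable.of_discrete,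
    positionNoise_eq_noiseMeasure ht]
  simp only [map_smul]

/-! ### Covariant phase space observables -/

theorem weylOp_weylOp_neg (z : ℝ × ℝ) (ψ : QHilbert) : weylOp z (weylOp (-z) ψ) = ψ := by
  obtain ⟨q, p⟩ := z
  have hm := measurePreserving_sub_right (volume : Measure ℝ) q
  refine Lp.ext ?_
  filter_upwards [coeFn_weylOp q p (weylOp (-q, -p) ψ),
    hm.quasiMeasurePreserving.ae (coeFn_weylOp (-q) (-p) ψ)] with x h1 h2
  rw [Prod.neg_mk, h1, h2, ← mul_assoc, ← Complex.exp_add, sub_neg_eq_add, sub_add_cancel,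
    ← add_mul, ← Complex.ofReal_add]
  have : p * x - q * p / 2 + (-p * (x - q) - -q * -p / 2) = 0 := by ring
  rw [this]
  simp

theorem inner_weylOp_weylOp (z : ℝ × ℝ) (φ ψ : QHilbert) :
    ⟪weylOp z φ, weylOp z ψ⟫_ℂ = ⟪φ, ψ⟫_ℂ :=
  (LinearMap.norm_map_iff_inner_map_map (weylOp z)).1 (norm_weylOp z) φ ψ

theorem inner_weylOp_eq (z : ℝ × ℝ) (φ ψ : QHilbert) :
    ⟪weylOp z φ, ψ⟫_ℂ = ⟪φ, weylOp (-z) ψ⟫_ℂ := by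
  rw [← inner_weylOp_weylOp z φ, weylOp_weylOp_neg]

theorem adjoint_weylOp (z : ℝ × ℝ) : ContinuousLinearMap.adjoint (weylOp z) = weylOp (-z) := by
  refine (ContinuousLinearMap.eq_adjoint_iff _ _).2 (fun φ ψ => ?_) |>.symm
  rw [inner_weylOp_eq, neg_neg]

theorem inner_weylOp_conj (T : QHilbert →L[ℂ] QHilbert) (z : ℝ × ℝ) (φ ψ : QHilbert) :
    ⟪φ, (weylOp z ∘L T ∘L ContinuousLinearMap.adjoint (weylOp z)) ψ⟫_ℂ =
      ⟪weylOp (-z) φ, T (weylOp (-z) ψ)⟫_ℂ := by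
  rw [adjoint_weylOp, inner_weylOp_eq, neg_neg]
  rfl

theorem continuous_weylOp_neg (ψ : QHilbert) : Continuous fun z => weylOp (-z) ψ := by
  have h : Continuous fun z : ℝ × ℝ => (-z, ψ) := continuous_neg.prodMk continuous_const
  have h' := continuous_weylOp.comp h
  simpa only [Function.comp_def] using h'

theorem continuous_inner_weylOp_conj (T : QHilbert →L[ℂ] QHilbert) (φ ψ : QHilbert) :
    Continuous fun z =>
      ⟪φ, (weylOp z ∘L T ∘L ContinuousLinearMap.adjoint (weylOp z)) ψ⟫_ℂ := by
  simp only [inner_weylOp_conj]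
  exact (continuous_weylOp_neg φ).inner (T.continuous.comp (continuous_weylOp_neg ψ))

theorem continuous_opSqrt_weylOp (T : QHilbert →L[ℂ] QHilbert) (ψ : QHilbert) :
    Continuous fun z => opSqrt T (weylOp (-z) ψ) :=
  (opSqrt T).continuous.comp (continuous_weylOp_neg ψ)

namespace IsFrame

variable {S : Type*} [MeasurableSpace S] {ν : Measure S} {u : S → QHilbert}
  {T : QHilbert →L[ℂ] QHilbert}

theorem lintegral_weylOp_eq (h : IsFrame ν u T) (z : ℝ × ℝ) (ψ : QHilbert) :
    ∫⁻ s, ‖⟪weylOp z (u s), ψ⟫_ℂ‖ₑ ^ 2 ∂ν = ‖opSqrt T (weylOp (-z) ψ)‖ₑ ^ 2 := by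
  simp only [inner_weylOp_eq]
  exact h.lintegral_eq _

/-- Moyal's identity averaged over the frame, where ∫ ‖u_s‖² dν = 1. It provides both the
integrability of the weak integral defining G^T and its normalization. -/
theorem lintegral_opSqrt_weylOp [SFinite ν] (h : IsFrame ν u T) (hT : IsQState T)
    (ψ : QHilbert) :
    ∫⁻ z, ‖opSqrt T (weylOp (-z) ψ)‖ₑ ^ 2 = ENNReal.ofReal (2 * Real.pi) * ‖ψ‖ₑ ^ 2 := by
  simp only [← h.lintegral_weylOp_eq]
  rw [lintegral_lintegral_swap]
  · simp only [lintegral_enorm_inner_weylOp_sq_univ, ← mul_assoc]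
    rw [lintegral_const_mul _ (h.stronglyMeasurable.enorm.pow_const 2), h.isQState_iff.1 hT,
      mul_one]
  · exact ((measurable_weylOp_inner h.stronglyMeasurable ψ).comp measurable_swap).aemeasurable

end IsFrame

theorem IsQState.exists_frame {T : QHilbert →L[ℂ] QHilbert} (hT : IsQState T) :
    ∃ u : ℕ → QHilbert, IsFrame Measure.count u T := by
  obtain ⟨w, b, -⟩ := exists_hilbertBasis ℂ QHilbert
  have hc : Countable w := countable_hilbertBasis b
  obtain ⟨f, hf⟩ := hc.exists_injective_nat
  -- Zero vectors fill the indices outside the range of `f`; they contribute nothing to the sums.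
  refine ⟨Function.extend f (fun i => opSqrt T (b i)) 0, isFrame_count_iff.2 ⟨hT.1, fun ψ => ?_⟩⟩
  rw [← (b.tsum_enorm_inner_sq (opSqrt T ψ))]
  simp only [← inner_opSqrt]
  rw [← hf.tsum_eq]
  · simp only [hf.extend_apply]
  · intro n hn
    by_contra h
    rw [Function.mem_support, Function.extend_apply' _ _ _ (by simpa using h)] at hn
    simp at hn

theorem integrable_norm_opSqrt_weylOp_sq {T : QHilbert →L[ℂ] QHilbert} (hT : IsQState T)
    (ψ : QHilbert) : Integrable fun z => ‖opSqrt T (weylOp (-z) ψ)‖ ^ 2 := by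
  obtain ⟨u, hu⟩ := hT.exists_frame
  refine ⟨((continuous_opSqrt_weylOp T ψ).norm.pow 2).aestronglyMeasurable, ?_⟩
  rw [HasFiniteIntegral]
  simp only [enorm_pow, enorm_norm]
  rw [hu.lintegral_opSqrt_weylOp hT]
  exact ENNReal.mul_lt_top ENNReal.ofReal_lt_top (ENNReal.pow_lt_top enorm_lt_top)

theorem integral_norm_opSqrt_weylOp_sq {T : QHilbert →L[ℂ] QHilbert} (hT : IsQState T)
    (ψ : QHilbert) : ∫ z, ‖opSqrt T (weylOp (-z) ψ)‖ ^ 2 = 2 * Real.pi * ‖ψ‖ ^ 2 := by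
  obtain ⟨u, hu⟩ := hT.exists_frame
  rw [integral_eq_lintegral_of_nonneg_ae (.of_forall fun z => sq_nonneg _)
    ((continuous_opSqrt_weylOp T ψ).norm.pow 2).aestronglyMeasurable]
  simp only [ENNReal.ofReal_pow (norm_nonneg _), ofReal_norm]
  rw [hu.lintegral_opSqrt_weylOp hT, ENNReal.toReal_mul,
    ENNReal.toReal_ofReal Real.two_pi_pos.le, ENNReal.toReal_pow, toReal_enorm]

/-- Cauchy–Schwarz for √T, then 2ab ≤ a² + b². The bound is integrable over phase space and so
dominates the off-diagonal matrix elements. -/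
theorem norm_inner_weylOp_conj_le {T : QHilbert →L[ℂ] QHilbert} (hT : T.IsPositive)
    (z : ℝ × ℝ) (φ ψ : QHilbert) :
    ‖⟪φ, (weylOp z ∘L T ∘L ContinuousLinearMap.adjoint (weylOp z)) ψ⟫_ℂ‖ ≤
      (‖opSqrt T (weylOp (-z) φ)‖ ^ 2 + ‖opSqrt T (weylOp (-z) ψ)‖ ^ 2) / 2 := by
  rw [inner_weylOp_conj, inner_eq_inner_opSqrt hT]
  refine (norm_inner_le_norm _ _).trans ?_
  nlinarith [sq_nonneg (‖opSqrt T (weylOp (-z) φ)‖ - ‖opSqrt T (weylOp (-z) ψ)‖)]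

theorem integrable_inner_weylOp_conj {T : QHilbert →L[ℂ] QHilbert} (hT : IsQState T)
    (φ ψ : QHilbert) : Integrable fun z =>
      ⟪φ, (weylOp z ∘L T ∘L ContinuousLinearMap.adjoint (weylOp z)) ψ⟫_ℂ :=
  (((integrable_norm_opSqrt_weylOp_sq hT φ).add
    (integrable_norm_opSqrt_weylOp_sq hT ψ)).div_const 2).mono'
    (continuous_inner_weylOp_conj T φ ψ).aestronglyMeasurable
    (.of_forall fun z => norm_inner_weylOp_conj_le hT.1 z φ ψ)

theorem inner_weylOp_conj_self {T : QHilbert →L[ℂ] QHilbert} (hT : T.IsPositive)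
    (z : ℝ × ℝ) (ψ : QHilbert) :
    ⟪ψ, (weylOp z ∘L T ∘L ContinuousLinearMap.adjoint (weylOp z)) ψ⟫_ℂ =
      ((‖opSqrt T (weylOp (-z) ψ)‖ ^ 2 : ℝ) : ℂ) := by
  rw [inner_weylOp_conj, inner_self_eq_norm_opSqrt_sq hT]

/-- The sesquilinear form `(φ, ψ) ↦ (2π)⁻¹ ∫_Z ⟨φ|W_{qp} T W_{qp}^* ψ⟩ dq dp`. -/
def phaseSpaceForm (T : QHilbert →L[ℂ] QHilbert) (Z : Set (ℝ × ℝ)) (φ ψ : QHilbert) : ℂ :=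
  (1 / (2 * Real.pi) : ℂ) *
    ∫ z in Z, ⟪φ, (weylOp z ∘L T ∘L ContinuousLinearMap.adjoint (weylOp z)) ψ⟫_ℂ

theorem norm_phaseSpaceForm_le_add {T : QHilbert →L[ℂ] QHilbert} (hT : IsQState T)
    (Z : Set (ℝ × ℝ)) (φ ψ : QHilbert) :
    ‖phaseSpaceForm T Z φ ψ‖ ≤ (‖φ‖ ^ 2 + ‖ψ‖ ^ 2) / 2 := by
  have hφ := integrable_norm_opSqrt_weylOp_sq hT φ
  have hψ := integrable_norm_opSqrt_weylOp_sq hT ψ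
  have h1 : ‖∫ z in Z, ⟪φ, (weylOp z ∘L T ∘L ContinuousLinearMap.adjoint (weylOp z)) ψ⟫_ℂ‖ ≤
      2 * Real.pi * ((‖φ‖ ^ 2 + ‖ψ‖ ^ 2) / 2) := by
    refine (norm_integral_le_of_norm_le ((hφ.add hψ).div_const 2).integrableOn
      (.of_forall fun z => norm_inner_weylOp_conj_le hT.1 z φ ψ)).trans ?_
    refine (setIntegral_le_integral ((hφ.add hψ).div_const 2)
      (.of_forall fun z => ?_)).trans_eq ?_
    · simp only [Pi.zero_apply, Pi.add_apply]
      positivity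
    · simp only [Pi.add_apply]
      rw [integral_div, integral_add hφ hψ, integral_norm_opSqrt_weylOp_sq hT,
        integral_norm_opSqrt_weylOp_sq hT]
      ring
  have h2 : ‖(1 / (2 * Real.pi) : ℂ)‖ = 1 / (2 * Real.pi) := by
    rw [norm_div, norm_mul, Complex.norm_real, Real.norm_of_nonneg Real.pi_pos.le]
    simp
  rw [phaseSpaceForm, norm_mul, h2]
  have hpi := Real.two_pi_pos
  rw [div_mul_eq_mul_div, one_mul, div_le_iff₀ hpi]
  linarith

/-- The bundled version of `phaseSpaceForm`. -/
def phaseSpaceFormₛₗ {T : QHilbert →L[ℂ] QHilbert} (hT : IsQState T) (Z : Set (ℝ × ℝ)) :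
    QHilbert →ₗ⋆[ℂ] QHilbert →ₗ[ℂ] ℂ :=
  LinearMap.mk₂'ₛₗ (starRingEnd ℂ) (RingHom.id ℂ) (phaseSpaceForm T Z)
    (fun φ φ' ψ => by
      simp only [phaseSpaceForm, inner_add_left]
      rw [integral_add (integrable_inner_weylOp_conj hT φ ψ).integrableOn
        (integrable_inner_weylOp_conj hT φ' ψ).integrableOn, mul_add])
    (fun c φ ψ => by
      simp only [phaseSpaceForm, inner_smul_left]
      rw [integral_const_mul, mul_left_comm, smul_eq_mul])
    (fun φ ψ ψ' => by
      simp only [phaseSpaceForm, map_add, inner_add_right]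
      rw [integral_add (integrable_inner_weylOp_conj hT φ ψ).integrableOn
        (integrable_inner_weylOp_conj hT φ ψ').integrableOn, mul_add])
    (fun c φ ψ => by
      simp only [phaseSpaceForm, map_smul, inner_smul_right]
      rw [integral_const_mul, mul_left_comm, RingHom.id_apply, smul_eq_mul])

theorem norm_phaseSpaceForm_le {T : QHilbert →L[ℂ] QHilbert} (hT : IsQState T)
    (Z : Set (ℝ × ℝ)) (φ ψ : QHilbert) :
    ‖phaseSpaceFormₛₗ hT Z φ ψ‖ ≤ 1 * ‖φ‖ * ‖ψ‖ := by
  rcases eq_or_ne φ 0 with rfl | hφ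
  · simp
  rcases eq_or_ne ψ 0 with rfl | hψ
  · simp
  -- For unit vectors the additive bound equals 1; sesquilinearity rescales it to the product bound.
  have h := norm_phaseSpaceForm_le_add hT Z (((‖φ‖⁻¹ : ℝ) : ℂ) • φ) (((‖ψ‖⁻¹ : ℝ) : ℂ) • ψ)
  change ‖phaseSpaceFormₛₗ hT Z (((‖φ‖⁻¹ : ℝ) : ℂ) • φ) (((‖ψ‖⁻¹ : ℝ) : ℂ) • ψ)‖ ≤ _ at h
  rw [map_smulₛₗ, map_smulₛₗ, LinearMap.smul_apply] at h
  simp only [norm_smul, RingHom.id_apply, Complex.conj_ofReal, Complex.norm_real, norm_inv, norm_norm] at h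
  have h1 := norm_pos_iff.2 hφ
  have h2 := norm_pos_iff.2 hψ
  rw [inv_mul_cancel₀ h1.ne', inv_mul_cancel₀ h2.ne', inv_mul_le_iff₀ h2,
    inv_mul_le_iff₀ h1] at h
  linarith

/-- The operators `G^T(Z)`. -/
def phaseSpaceEffect {T : QHilbert →L[ℂ] QHilbert} (hT : IsQState T) (Z : Set (ℝ × ℝ)) :
    QHilbert →L[ℂ] QHilbert :=
  -- The Riesz construction puts the operator into the left slot of the inner product; the adjoint
  -- moves it to the right slot.
  ContinuousLinearMap.adjoint (InnerProductSpace.continuousLinearMapOfBilin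
    ((phaseSpaceFormₛₗ hT Z).mkContinuous₂ 1 (norm_phaseSpaceForm_le hT Z)))

theorem inner_phaseSpaceEffect {T : QHilbert →L[ℂ] QHilbert} (hT : IsQState T)
    (Z : Set (ℝ × ℝ)) (φ ψ : QHilbert) :
    ⟪φ, phaseSpaceEffect hT Z ψ⟫_ℂ = phaseSpaceForm T Z φ ψ := by
  rw [phaseSpaceEffect, ContinuousLinearMap.adjoint_inner_right,
    InnerProductSpace.continuousLinearMapOfBilin_apply]
  rfl

/-- The density of the distribution of `G^T` in the vector state `ψ`. -/
def phaseSpaceDensity (T : QHilbert →L[ℂ] QHilbert) (ψ : QHilbert) (z : ℝ × ℝ) : ℝ≥0∞ :=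
  ENNReal.ofReal (1 / (2 * Real.pi)) * ‖opSqrt T (weylOp (-z) ψ)‖ₑ ^ 2

theorem ofReal_inv_mul_ofReal_two_pi :
    ENNReal.ofReal (1 / (2 * Real.pi)) * ENNReal.ofReal (2 * Real.pi) = 1 := by
  rw [← ENNReal.ofReal_mul (by positivity), one_div_mul_cancel Real.two_pi_pos.ne',
    ENNReal.ofReal_one]

theorem lintegral_phaseSpaceDensity {T : QHilbert →L[ℂ] QHilbert} (hT : IsQState T)
    (ψ : QHilbert) : ∫⁻ z, phaseSpaceDensity T ψ z = ‖ψ‖ₑ ^ 2 := by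
  obtain ⟨u, hu⟩ := hT.exists_frame
  simp only [phaseSpaceDensity]
  rw [lintegral_const_mul' _ _ ENNReal.ofReal_ne_top, hu.lintegral_opSqrt_weylOp hT, ← mul_assoc,
    ofReal_inv_mul_ofReal_two_pi, one_mul]

theorem isFiniteMeasure_phaseSpaceDensity {T : QHilbert →L[ℂ] QHilbert} (hT : IsQState T)
    (ψ : QHilbert) : IsFiniteMeasure (volume.withDensity (phaseSpaceDensity T ψ)) :=
  isFiniteMeasure_withDensity (by
    rw [lintegral_phaseSpaceDensity hT]; exact ENNReal.pow_ne_top enorm_ne_top)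

theorem phaseSpaceForm_self {T : QHilbert →L[ℂ] QHilbert} (hT : IsQState T)
    {Z : Set (ℝ × ℝ)} (hZ : MeasurableSet Z) (ψ : QHilbert) :
    phaseSpaceForm T Z ψ ψ =
      (((volume.withDensity (phaseSpaceDensity T ψ)).real Z : ℝ) : ℂ) := by
  rw [phaseSpaceForm]
  simp only [inner_weylOp_conj_self hT.1]
  rw [integral_complex_ofReal, measureReal_def, withDensity_apply _ hZ]
  simp only [phaseSpaceDensity]
  rw [lintegral_const_mul' _ _ ENNReal.ofReal_ne_top, ENNReal.toReal_mul,
    ENNReal.toReal_ofReal (by positivity), integral_eq_lintegral_of_nonneg_ae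
    (.of_forall fun z => sq_nonneg _)
    ((continuous_opSqrt_weylOp T ψ).norm.pow 2).aestronglyMeasurable]
  simp only [ENNReal.ofReal_pow (norm_nonneg _), ofReal_norm]
  push_cast
  rfl

theorem phaseSpaceEffect_univ {T : QHilbert →L[ℂ] QHilbert} (hT : IsQState T) :
    phaseSpaceEffect hT univ = ContinuousLinearMap.id ℂ QHilbert := by
  refine ContinuousLinearMap.coe_injective ((ext_inner_map _ _).1 fun ψ => ?_)
  rw [← inner_conj_symm, ContinuousLinearMap.coe_coe, inner_phaseSpaceEffect,
    phaseSpaceForm_self hT MeasurableSet.univ, measureReal_def,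
    withDensity_apply _ MeasurableSet.univ, setLIntegral_univ, lintegral_phaseSpaceDensity hT]
  simp [inner_self_eq_norm_sq_to_K]

/-- The phase space observable `G^T` generated by the state `T`. -/
def phaseSpaceObservable {T : QHilbert →L[ℂ] QHilbert} (hT : IsQState T) :
    QObservable (ℝ × ℝ) where
  effect := phaseSpaceEffect hT
  effect_univ := phaseSpaceEffect_univ hT
  exists_measure ψ := ⟨_, isFiniteMeasure_phaseSpaceDensity hT ψ, fun Z hZ => by
    rw [inner_phaseSpaceEffect, phaseSpaceForm_self hT hZ]⟩

theorem isPhaseSpaceObservable_phaseSpaceObservable {T : QHilbert →L[ℂ] QHilbert}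
    (hT : IsQState T) : IsPhaseSpaceObservable T (phaseSpaceObservable hT) := fun Z _ φ ψ =>
  ⟨(integrable_inner_weylOp_conj hT φ ψ).integrableOn, inner_phaseSpaceEffect hT Z φ ψ⟩

theorem IsPhaseSpaceObservable.sameAs {T : QHilbert →L[ℂ] QHilbert} {G G' : QObservable (ℝ × ℝ)}
    (h : IsPhaseSpaceObservable T G) (h' : IsPhaseSpaceObservable T G') : G'.SameAs G := by
  intro Z hZ
  ext1 ψ
  refine ext_inner_left ℂ fun φ => ?_
  rw [(h Z hZ φ ψ).2, (h' Z hZ φ ψ).2]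

theorem IsPhaseSpaceObservable.dist_eq {T : QHilbert →L[ℂ] QHilbert} (hT : IsQState T)
    {G : QObservable (ℝ × ℝ)} (h : IsPhaseSpaceObservable T G) (ψ : QHilbert) :
    G.dist ψ = volume.withDensity (phaseSpaceDensity T ψ) := by
  have := isFiniteMeasure_phaseSpaceDensity hT ψ
  refine QObservable.dist_eq_of_inner _ _ _ fun Z hZ => ?_
  rw [(h Z hZ ψ ψ).2, ← phaseSpaceForm_self hT hZ]
  rfl

/-! ### The distributions of the marginals -/

namespace IsPhaseSpaceObservable

variable {S : Type*} [MeasurableSpace S] {ν : Measure S} [SFinite ν] {u : S → QHilbert}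
  {T : QHilbert →L[ℂ] QHilbert} {G : QObservable (ℝ × ℝ)}

theorem dist_apply (h : IsPhaseSpaceObservable T G) (hT : IsQState T) (hu : IsFrame ν u T)
    (ψ : QHilbert) {Z : Set (ℝ × ℝ)} (hZ : MeasurableSet Z) :
    G.dist ψ Z = ENNReal.ofReal (1 / (2 * Real.pi)) *
      ∫⁻ s, (∫⁻ z in Z, ‖⟪weylOp z (u s), ψ⟫_ℂ‖ₑ ^ 2) ∂ν := by
  rw [h.dist_eq hT, withDensity_apply _ hZ]
  simp only [phaseSpaceDensity]
  rw [lintegral_const_mul' _ _ ENNReal.ofReal_ne_top, lintegral_lintegral_swap]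
  · simp only [hu.lintegral_weylOp_eq]
  · exact (measurable_weylOp_inner hu.stronglyMeasurable ψ).aemeasurable

/-- The p-integral is carried out first, separately for every frame vector; the factors 1/2π and 2π
cancel. -/
theorem fst_dist (h : IsPhaseSpaceObservable T G) (hT : IsQState T) (hu : IsFrame ν u T)
    (ψ : QHilbert) : G.fst.dist ψ =
      (positionObservable.dist ψ).conv (noiseMeasure positionObservable ν u) := by
  have := hu.isProbabilityMeasure_noiseMeasure positionObservable_isSharp hT
  ext X hX
  rw [QObservable.fst_dist, Measure.map_apply measurable_fst hX, ← prod_univ,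
    h.dist_apply hT hu ψ (hX.prod MeasurableSet.univ),
    conv_noiseMeasure_apply positionObservable_isSharp hu.stronglyMeasurable _ hX,
    ← lintegral_const_mul' _ _ ENNReal.ofReal_ne_top]
  refine lintegral_congr fun s => ?_
  rw [Measure.volume_eq_prod, setLIntegral_prod _
    (measurable_weylOp_inner_single (u s) ψ).aemeasurable]
  simp only [setLIntegral_univ]
  rw [lintegral_enorm_inner_weylOp_sq (u s) ψ hX, ← mul_assoc, ofReal_inv_mul_ofReal_two_pi,
    one_mul]

theorem snd_dist (h : IsPhaseSpaceObservable T G) (hT : IsQState T) (hu : IsFrame ν u T)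
    (ψ : QHilbert) : G.snd.dist ψ =
      (momentumObservable.dist ψ).conv (noiseMeasure momentumObservable ν u) := by
  have := hu.isProbabilityMeasure_noiseMeasure momentumObservable_isSharp hT
  ext Y hY
  rw [QObservable.snd_dist, Measure.map_apply measurable_snd hY, ← univ_prod,
    h.dist_apply hT hu ψ (MeasurableSet.univ.prod hY),
    conv_noiseMeasure_apply momentumObservable_isSharp hu.stronglyMeasurable _ hY,
    ← lintegral_const_mul' _ _ ENNReal.ofReal_ne_top]
  refine lintegral_congr fun s => ?_
  rw [Measure.volume_eq_prod, setLIntegral_prod_symm _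
    (measurable_weylOp_inner_single (u s) ψ).aemeasurable]
  simp only [setLIntegral_univ]
  rw [lintegral_enorm_inner_weylOp_sq' (u s) ψ hY, ← mul_assoc, ofReal_inv_mul_ofReal_two_pi,
    one_mul]

end IsPhaseSpaceObservable

/-! ### Moments of convolutions -/

/-- Integrability of the k-th power is recast as membership in L^k, which is closed under sums and,
for finite measures, monotone in k. -/
theorem integrable_pow_iff_memLp {α : Type*} [MeasurableSpace α] {μ : Measure α}
    [IsFiniteMeasure μ] {g : α → ℝ} (hg : AEStronglyMeasurable g μ) (k : ℕ) :
    Integrable (fun x => g x ^ k) μ ↔ MemLp g k μ := by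
  rcases eq_or_ne k 0 with rfl | hk
  · simp [memLp_zero_iff_aestronglyMeasurable, hg]
  · have h := integrable_norm_rpow_iff hg (p := k) (by exact_mod_cast hk) (by simp)
    have hp : AEStronglyMeasurable (fun x => g x ^ k) μ := hg.pow k
    rw [← h, ← integrable_norm_iff hp]
    simp

theorem integrable_pow_of_le {μ : Measure ℝ} [IsFiniteMeasure μ] {k j : ℕ}
    (h : Integrable (fun x : ℝ => x ^ k) μ) (hj : j ≤ k) :
    Integrable (fun x : ℝ => x ^ j) μ := by
  have hm : AEStronglyMeasurable (fun x : ℝ => x) μ := aestronglyMeasurable_id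
  rw [integrable_pow_iff_memLp hm] at h ⊢
  exact h.mono_exponent (by exact_mod_cast hj)

/-- If (x+y)^k is integrable for the product, then by Fubini some single y makes x + y an L^k
function of x, and subtracting the constant y leaves x in L^k. Conversely, x + y is a sum of two L^k
functions on the product. -/
theorem integrable_pow_conv_iff {μ f : Measure ℝ} [IsFiniteMeasure μ] [IsProbabilityMeasure f]
    {k : ℕ} (hf : Integrable (fun x : ℝ => x ^ k) f) :
    Integrable (fun x : ℝ => x ^ k) (μ.conv f) ↔ Integrable (fun x : ℝ => x ^ k) μ := by
  have hm : ∀ ρ : Measure ℝ, AEStronglyMeasurable (fun x : ℝ => x) ρ :=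
    fun ρ => aestronglyMeasurable_id
  rw [Measure.conv, integrable_map_measure (by fun_prop) (by fun_prop)]
  constructor
  · intro h
    obtain ⟨y, hy⟩ := h.prod_left_ae.exists
    simp only [Function.comp_apply] at hy
    have hs : AEStronglyMeasurable (fun x : ℝ => x + y) μ := by fun_prop
    rw [integrable_pow_iff_memLp hs] at hy
    rw [integrable_pow_iff_memLp (hm μ)]
    have h2 := hy.sub (memLp_const y)
    simpa only [Pi.sub_def, add_sub_cancel_right] using h2
  · intro h
    rw [integrable_pow_iff_memLp (hm _)] at h hf
    change Integrable (fun z : ℝ × ℝ => (z.1 + z.2) ^ k) (μ.prod f)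
    rw [integrable_pow_iff_memLp (by fun_prop)]
    exact (h.comp_fst f).add (hf.comp_snd μ)

theorem integral_pow_conv {μ f : Measure ℝ} [IsFiniteMeasure μ] [IsProbabilityMeasure f]
    {k : ℕ} (hf : Integrable (fun x : ℝ => x ^ k) f) (hμ : Integrable (fun x : ℝ => x ^ k) μ) :
    ∫ x, x ^ k ∂(μ.conv f) = ∑ i ∈ Finset.range (k + 1),
      ((k.choose i : ℝ) * ∫ x, x ^ i ∂f) * ∫ x, x ^ (k - i) ∂μ := by
  rw [Measure.conv, integral_map (by fun_prop) (by fun_prop)]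
  have h : ∀ z : ℝ × ℝ, (z.1 + z.2) ^ k = ∑ i ∈ Finset.range (k + 1),
      (k.choose i : ℝ) * (z.1 ^ (k - i) * z.2 ^ i) := by
    intro z
    rw [add_comm, add_pow]
    exact Finset.sum_congr rfl fun i _ => by ring
  simp only [h]
  rw [integral_finsetSum]
  · refine Finset.sum_congr rfl fun i _ => ?_
    rw [integral_const_mul, integral_prod_mul (fun x : ℝ => x ^ (k - i)) (fun x : ℝ => x ^ i)]
    ring
  · intro i hi
    refine Integrable.const_mul ?_ _
    exact (integrable_pow_of_le hμ (Nat.sub_le k i)).mul_prod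
      (integrable_pow_of_le hf (Nat.lt_succ_iff.1 (Finset.mem_range.1 hi)))

/-! ### The Hilbert–Schmidt conditions in terms of the noise measures -/

/-- The operator norm is at most the Hilbert–Schmidt norm, and ∫ ‖A u_s‖² dν is the squared
Hilbert–Schmidt norm of A√T. -/
theorem IsFrame.enorm_apply_opSqrt_sq_le {S : Type*} [MeasurableSpace S] {ν : Measure S}
    {u : S → QHilbert} {T : QHilbert →L[ℂ] QHilbert} (h : IsFrame ν u T)
    (A : QHilbert →L[ℂ] QHilbert) (ψ : QHilbert) :
    ‖A (opSqrt T ψ)‖ₑ ^ 2 ≤ ‖ψ‖ₑ ^ 2 * ∫⁻ s, ‖A (u s)‖ₑ ^ 2 ∂ν := by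
  obtain ⟨w, b, -⟩ := exists_hilbertBasis ℂ QHilbert
  rw [h.lintegral_enorm_apply_sq A b, ← b.tsum_enorm_inner_sq, ← ENNReal.tsum_mul_left]
  refine ENNReal.tsum_le_tsum fun i => ?_
  rw [← ContinuousLinearMap.adjoint_inner_left, ← inner_opSqrt, mul_comm, ← mul_pow]
  gcongr
  rw [← ofReal_norm, ← ofReal_norm, ← ofReal_norm, ← ENNReal.ofReal_mul (norm_nonneg _)]
  exact ENNReal.ofReal_le_ofReal (norm_inner_le_norm _ _)

theorem map_neg_noiseMeasure_apply {O : QObservable ℝ} (hO : O.IsSharp)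
    {S : Type*} [MeasurableSpace S] {ν : Measure S} {u : S → QHilbert} (hu : StronglyMeasurable u)
    {X : Set ℝ} (hX : MeasurableSet X) :
    (noiseMeasure O ν u).map Neg.neg X = ∫⁻ s, ‖O.effect X (u s)‖ₑ ^ 2 ∂ν := by
  rw [Measure.map_apply measurable_neg hX, noiseMeasure_apply hO hu (measurable_neg hX)]
  congr! 6
  ext x
  simp

/-- The Hilbert–Schmidt bound for spectral projections. It puts all vectors √Tψ into the domain of
an unbounded operator as soon as the noise has the corresponding moment. -/
theorem IsFrame.dist_opSqrt_le {O : QObservable ℝ} (hO : O.IsSharp)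
    {S : Type*} [MeasurableSpace S] {ν : Measure S}
    {u : S → QHilbert} {T : QHilbert →L[ℂ] QHilbert} (h : IsFrame ν u T) (ψ : QHilbert) :
    O.dist (opSqrt T ψ) ≤ ‖ψ‖ₑ ^ 2 • (noiseMeasure O ν u).map Neg.neg := by
  refine Measure.le_iff.2 fun X hX => ?_
  rw [Measure.smul_apply, map_neg_noiseMeasure_apply hO h.stronglyMeasurable hX,
    hO.dist_apply _ hX, smul_eq_mul]
  exact h.enorm_apply_opSqrt_sq_le _ _

theorem enorm_neg_pow_sq (k : ℕ) (x : ℝ) : ‖(-x) ^ k‖ₑ ^ 2 = ‖x ^ k‖ₑ ^ 2 := by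
  rw [enorm_pow, enorm_neg, enorm_pow]

/-- Formally, ‖A√T‖² in Hilbert–Schmidt norm is the sum of the 2k-th moments of O in the vectors √T
b_i, that is, the 2k-th moment of the noise; even moments do not see the reflection. For the
converse, domination by the noise shows that A√T is everywhere defined and bounded. -/
theorem IsFrame.isHilbertSchmidtProd_iff {O : QObservable ℝ} (hO : O.IsSharp)
    {A : QHilbert →ₗ.[ℂ] QHilbert} {k : ℕ}
    (hdom : ∀ ψ, ψ ∈ A.domain ↔ ∫⁻ x, ‖x ^ k‖ₑ ^ 2 ∂(O.dist ψ) < ∞)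
    (hnorm : ∀ ψ : A.domain, ‖A ψ‖ₑ ^ 2 = ∫⁻ x, ‖x ^ k‖ₑ ^ 2 ∂(O.dist ψ))
    {S : Type*} [MeasurableSpace S] {ν : Measure S}
    {u : S → QHilbert} {T : QHilbert →L[ℂ] QHilbert} (h : IsFrame ν u T) :
    IsHilbertSchmidtProd A (opSqrt T) ↔ ∫⁻ x, ‖x ^ k‖ₑ ^ 2 ∂(noiseMeasure O ν u) < ∞ := by
  have hg : Measurable fun x : ℝ => ‖x ^ k‖ₑ ^ 2 := by fun_prop
  have hb : ∀ (ι : Type) (b : HilbertBasis ι ℂ QHilbert),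
      ∫⁻ x, ‖x ^ k‖ₑ ^ 2 ∂(noiseMeasure O ν u) =
        ∑' i, ∫⁻ x, ‖x ^ k‖ₑ ^ 2 ∂(O.dist (opSqrt T (b i))) := by
    intro ι b
    -- With the discrete σ-algebra on the index set, the vectors √T b_i form a frame for counting
    -- measure.
    let _ : MeasurableSpace ι := ⊤
    have := countable_hilbertBasis b
    have h' := isFrame_opSqrt h.isPositive b
    rw [h.noiseMeasure_eq hO h', lintegral_noiseMeasure hO h'.stronglyMeasurable hg,
      lintegral_count]
    simp only [enorm_neg_pow_sq]
  constructor
  · rintro ⟨C, ⟨ι, b, hC⟩, hAC⟩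
    rw [hb ι b]
    have : ∀ i, ∫⁻ x, ‖x ^ k‖ₑ ^ 2 ∂(O.dist (opSqrt T (b i))) =
        ENNReal.ofReal (‖C (b i)‖ ^ 2) := by
      intro i
      obtain ⟨hd, he⟩ := hAC (b i)
      rw [← hnorm ⟨_, hd⟩, he, ENNReal.ofReal_pow (norm_nonneg _), ofReal_norm]
    simp only [this]
    exact hC.tsum_ofReal_lt_top
  · intro hM
    set M := ∫⁻ x, ‖x ^ k‖ₑ ^ 2 ∂(noiseMeasure O ν u) with hMdef
    have hle : ∀ ψ, ∫⁻ x, ‖x ^ k‖ₑ ^ 2 ∂(O.dist (opSqrt T ψ)) ≤ ‖ψ‖ₑ ^ 2 * M := by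
      intro ψ
      refine (lintegral_mono' (h.dist_opSqrt_le hO ψ) le_rfl).trans_eq ?_
      rw [lintegral_smul_measure, lintegral_map hg measurable_neg]
      simp only [enorm_neg_pow_sq, smul_eq_mul]
      rfl
    have hd : ∀ ψ, opSqrt T ψ ∈ A.domain := fun ψ => (hdom _).2
      ((hle ψ).trans_lt (ENNReal.mul_lt_top (ENNReal.pow_lt_top enorm_lt_top) hM))
    let C₀ : QHilbert →ₗ[ℂ] QHilbert :=
      A.toFun ∘ₗ ((opSqrt T : QHilbert →ₗ[ℂ] QHilbert).codRestrict A.domain hd)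
    have hC₀ : ∀ ψ, ‖C₀ ψ‖ₑ ^ 2 ≤ ‖ψ‖ₑ ^ 2 * M := fun ψ => (hnorm ⟨_, hd ψ⟩).trans_le (hle ψ)
    have hbound : ∀ ψ, ‖C₀ ψ‖ ≤ Real.sqrt M.toReal * ‖ψ‖ := by
      intro ψ
      have h1 := ENNReal.toReal_mono (ENNReal.mul_ne_top (ENNReal.pow_ne_top enorm_ne_top) hM.ne)
        (hC₀ ψ)
      rw [ENNReal.toReal_mul, ENNReal.toReal_pow, ENNReal.toReal_pow, toReal_enorm,
        toReal_enorm] at h1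
      refine abs_le_of_sq_le_sq' ?_ (by positivity) |>.2
      rw [mul_pow, Real.sq_sqrt ENNReal.toReal_nonneg]
      linarith
    obtain ⟨w, b, -⟩ := exists_hilbertBasis ℂ QHilbert
    refine ⟨C₀.mkContinuous _ hbound, ⟨w, b, ?_⟩, fun ψ => ⟨hd ψ, rfl⟩⟩
    have h1 : ∑' i, ‖C₀ (b i)‖ₑ ^ 2 < ∞ := by
      have : ∀ i, ‖C₀ (b i)‖ₑ ^ 2 = ∫⁻ x, ‖x ^ k‖ₑ ^ 2 ∂(O.dist (opSqrt T (b i))) := fun i =>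
        hnorm ⟨_, hd (b i)⟩
      simp only [this]
      rw [← hb]
      exact hM
    have h2 := ENNReal.summable_toReal h1.ne
    simp only [ENNReal.toReal_pow, toReal_enorm] at h2
    exact h2

theorem enorm_positionPow_sq (k : ℕ) (ψ : (positionPow k).domain) :
    ‖positionPow k ψ‖ₑ ^ 2 =
      ∫⁻ x, ‖x ^ k‖ₑ ^ 2 ∂(positionObservable.dist (ψ : QHilbert)) := by
  rw [lintegral_positionObservable_dist _ (by fun_prop), ← lintegral_enorm_sq_eq]
  refine lintegral_congr_ae ?_
  filter_upwards [coeFn_positionPow k ψ] with x hx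
  have h : ‖(x : ℂ)‖ₑ = ‖x‖ₑ := by
    rw [← ofReal_norm, ← ofReal_norm, Complex.norm_real]
  rw [hx, enorm_mul, enorm_pow, enorm_pow, h]
  ring

theorem lintegral_momentumObservable_dist_pow (k : ℕ) (ψ : QHilbert) :
    ∫⁻ x, ‖x ^ k‖ₑ ^ 2 ∂(momentumObservable.dist ψ) =
      ENNReal.ofReal ((2 * Real.pi) ^ k) ^ 2 *
        ∫⁻ x, ‖x ^ k‖ₑ ^ 2 ∂(positionObservable.dist (fourierL2 ψ)) := by
  rw [momentumObservable_dist, lintegral_map (by fun_prop) measurable_two_pi_mul,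
    ← lintegral_const_mul _ (by fun_prop)]
  refine lintegral_congr fun x => ?_
  rw [mul_pow (2 * Real.pi), enorm_mul, mul_pow, ← ofReal_norm ((2 * Real.pi) ^ k),
    Real.norm_of_nonneg (by positivity)]

theorem mem_momentumPow_domain_iff_lintegral (k : ℕ) (ψ : QHilbert) :
    ψ ∈ (momentumPow k).domain ↔
      ∫⁻ x, ‖x ^ k‖ₑ ^ 2 ∂(momentumObservable.dist ψ) < ∞ := by
  rw [mem_momentumPow_domain_iff, mem_positionPow_domain_iff,
    lintegral_momentumObservable_dist_pow]
  have h1 : ENNReal.ofReal ((2 * Real.pi) ^ k) ^ 2 ≠ 0 := by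
    have := Real.pi_pos
    simp only [ne_eq, pow_eq_zero_iff, OfNat.ofNat_ne_zero, not_false_eq_true,
      ENNReal.ofReal_eq_zero, not_le]
    positivity
  have h2 : ENNReal.ofReal ((2 * Real.pi) ^ k) ^ 2 < ∞ := ENNReal.pow_lt_top ENNReal.ofReal_lt_top
  constructor
  · exact fun h => ENNReal.mul_lt_top h2 h
  · exact fun h => ENNReal.lt_top_of_mul_ne_top_right h.ne h1

theorem enorm_momentumPow_sq (k : ℕ) (ψ : (momentumPow k).domain) :
    ‖momentumPow k ψ‖ₑ ^ 2 =
      ∫⁻ x, ‖x ^ k‖ₑ ^ 2 ∂(momentumObservable.dist (ψ : QHilbert)) := by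
  have hpi := Real.pi_pos
  have hd : fourierL2 (ψ : QHilbert) ∈ (positionPow k).domain := ψ.2
  have he : momentumPow k ψ =
      ((2 * Real.pi : ℂ) ^ k) • fourierL2.symm (positionPow k ⟨fourierL2 (ψ : QHilbert), hd⟩) := rfl
  rw [he, lintegral_momentumObservable_dist_pow, ← enorm_positionPow_sq k ⟨_, hd⟩, enorm_smul,
    mul_pow]
  congr 2
  · rw [← ofReal_norm, norm_pow, norm_mul, Complex.norm_real, Real.norm_of_nonneg hpi.le]
    simp
  · rw [← ofReal_norm, LinearIsometryEquiv.norm_map, ofReal_norm]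

theorem IsFrame.hasHSMoments_iff {S : Type*} [MeasurableSpace S] {ν : Measure S}
    {u : S → QHilbert} {T : QHilbert →L[ℂ] QHilbert} (h : IsFrame ν u T) :
    HasHSMoments T ↔
      ∀ k : ℕ, ∫⁻ x, ‖x ^ k‖ₑ ^ 2 ∂(noiseMeasure positionObservable ν u) < ∞ ∧
        ∫⁻ x, ‖x ^ k‖ₑ ^ 2 ∂(noiseMeasure momentumObservable ν u) < ∞ := by
  refine forall_congr' fun k => and_congr ?_ ?_
  · exact h.isHilbertSchmidtProd_iff positionObservable_isSharp (mem_positionPow_domain_iff k)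
      (enorm_positionPow_sq k)
  · exact h.isHilbertSchmidtProd_iff momentumObservable_isSharp
      (mem_momentumPow_domain_iff_lintegral k) (enorm_momentumPow_sq k)

theorem integrable_pow_of_lintegral {μ : Measure ℝ} [IsFiniteMeasure μ] {k : ℕ}
    (h : ∫⁻ x, ‖x ^ k‖ₑ ^ 2 ∂μ < ∞) : Integrable (fun x : ℝ => x ^ k) μ := by
  have h2 : Integrable (fun x : ℝ => x ^ (k * 2)) μ := by
    refine ⟨by fun_prop, ?_⟩
    simpa only [HasFiniteIntegral, pow_mul, enorm_pow] using h
  exact integrable_pow_of_le h2 (by omega)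

/-! ### Moments of noisy distributions and their inversion -/

theorem moments_of_dist_eq_conv {O M : QObservable ℝ} {f : Measure ℝ} [IsProbabilityMeasure f]
    (hf : ∀ k : ℕ, Integrable (fun x : ℝ => x ^ k) f)
    (h : ∀ ψ, M.dist ψ = (O.dist ψ).conv f) (ψ : QHilbert) (k : ℕ) :
    (M.HasMoment k ψ ↔ O.HasMoment k ψ) ∧
      (O.HasMoment k ψ →
        M.moment k ψ = ∑ i ∈ Finset.range (k + 1),
          ((k.choose i : ℝ) * ∫ x, x ^ i ∂f) * O.moment (k - i) ψ ∧
        O.moment k ψ = M.moment k ψ - ∑ i ∈ Finset.Icc 1 k,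
          ((k.choose i : ℝ) * ∫ x, x ^ i ∂f) * O.moment (k - i) ψ) := by
  have h1 : O.HasMoment k ψ → M.moment k ψ = ∑ i ∈ Finset.range (k + 1),
      ((k.choose i : ℝ) * ∫ x, x ^ i ∂f) * O.moment (k - i) ψ := by
    intro hk
    rw [QObservable.moment, h]
    exact integral_pow_conv (hf k) hk
  refine ⟨?_, fun hk => ⟨h1 hk, ?_⟩⟩
  · rw [QObservable.HasMoment, h]
    exact integrable_pow_conv_iff (hf k)
  -- The term i = 0 has coefficient 1 because f has mass one; it is split off and the formula is
  -- solved for it.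
  · rw [h1 hk, Finset.range_eq_Ico, Finset.sum_eq_sum_Ico_succ_bot (Nat.succ_pos k)]
    simp only [Nat.choose_zero_right, Nat.cast_one, pow_zero, integral_const, probReal_univ,
      smul_eq_mul, mul_one, Nat.sub_zero, one_mul]
    rw [show Finset.Ico (0 + 1) (k + 1) = Finset.Icc 1 k from rfl]
    ring

/-- Since i starts at 1, only indices below k occur on the right; for k = 0 the sum is empty and
fixes the initial value. -/
theorem moments_eq_of_recursion {s : ℕ → ℕ → ℝ} {g m m' : ℕ → ℝ}
    (h : ∀ k, m k = g k - ∑ i ∈ Finset.Icc 1 k, s k i * m (k - i))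
    (h' : ∀ k, m' k = g k - ∑ i ∈ Finset.Icc 1 k, s k i * m' (k - i)) (k : ℕ) : m k = m' k := by
  induction k using Nat.strong_induction_on with
  | _ k ih =>
    rw [h, h']
    congr 1
    refine Finset.sum_congr rfl fun i hi => ?_
    rw [Finset.mem_Icc] at hi
    rw [ih (k - i) (by omega)]

/-! ### Moment determinacy of exponentially bounded measures -/

open ProbabilityTheory Filter in
theorem IsExpBounded.zero_mem_interior {μ : Measure ℝ} (h : IsExpBounded μ) :
    ∃ a > 0, Ioo (-a) a ⊆ interior (integrableExpSet id μ) := by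
  obtain ⟨a, ha, hi⟩ := h
  refine ⟨a, ha, interior_maximal (fun t ht => ?_) isOpen_Ioo⟩
  refine hi.mono' (by fun_prop) (.of_forall fun x => ?_)
  rw [Real.norm_of_nonneg (Real.exp_pos _).le]
  refine Real.exp_le_exp.2 ((le_abs_self _).trans ?_)
  rw [abs_mul, id]
  exact mul_le_mul_of_nonneg_right (abs_le.2 ⟨ht.1.le, ht.2.le⟩) (abs_nonneg x)

theorem IsExpBounded.integrable_pow {μ : Measure ℝ} (h : IsExpBounded μ) (k : ℕ) :
    Integrable (fun x : ℝ => x ^ k) μ := by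
  obtain ⟨a, ha, hs⟩ := h.zero_mem_interior
  exact ProbabilityTheory.integrable_pow_of_mem_interior_integrableExpSet
    (hs ⟨neg_lt_zero.2 ha, ha⟩) k

/-- The terms of the cosh series are even powers with nonnegative coefficients, so sum and integral
may be exchanged in [0, ∞] without knowing that cosh is integrable. -/
theorem lintegral_cosh_eq {μ : Measure ℝ} (h : ∀ k : ℕ, Integrable (fun x : ℝ => x ^ k) μ)
    (a : ℝ) : ∫⁻ x, ENNReal.ofReal (Real.cosh (a * x)) ∂μ =
      ∑' n : ℕ, ENNReal.ofReal (a ^ (2 * n) / (2 * n).factorial * ∫ x, x ^ (2 * n) ∂μ) := by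
  have h1 : ∀ x : ℝ, ENNReal.ofReal (Real.cosh (a * x)) =
      ∑' n : ℕ, ENNReal.ofReal (a ^ (2 * n) / (2 * n).factorial * x ^ (2 * n)) := by
    intro x
    have hs := Real.hasSum_cosh (a * x)
    have hn : ∀ n : ℕ, 0 ≤ (a * x) ^ (2 * n) / (2 * n).factorial := fun n =>
      div_nonneg ((even_two_mul n).pow_nonneg _) (Nat.cast_nonneg _)
    rw [← hs.tsum_eq, ENNReal.ofReal_tsum_of_nonneg hn hs.summable]
    refine tsum_congr fun n => ?_
    rw [mul_pow, mul_div_right_comm]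
  simp only [h1]
  rw [lintegral_tsum fun n => by fun_prop]
  refine tsum_congr fun n => ?_
  rw [← integral_const_mul, ofReal_integral_eq_lintegral_ofReal ((h _).const_mul _)
    (.of_forall fun x => ?_)]
  exact mul_nonneg (div_nonneg ((even_two_mul n).pow_nonneg _) (Nat.cast_nonneg _))
    ((even_two_mul n).pow_nonneg _)

theorem exp_mul_abs_le_two_cosh (a x : ℝ) : Real.exp (a * |x|) ≤ 2 * Real.cosh (a * x) := by
  rw [Real.cosh_eq]
  have h1 := Real.exp_pos (a * x)
  have h2 := Real.exp_pos (-(a * x))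
  rcases abs_cases x with ⟨h, -⟩ | ⟨h, -⟩
  · rw [h]; linarith
  · rw [h, mul_neg]; linarith

theorem cosh_mul_le_exp {a : ℝ} (ha : 0 ≤ a) (x : ℝ) : Real.cosh (a * x) ≤ Real.exp (a * |x|) := by
  rw [Real.cosh_eq]
  have h1 : Real.exp (a * x) ≤ Real.exp (a * |x|) :=
    Real.exp_le_exp.2 (mul_le_mul_of_nonneg_left (le_abs_self x) ha)
  have h2 : Real.exp (-(a * x)) ≤ Real.exp (a * |x|) :=
    Real.exp_le_exp.2 (by rw [← mul_neg]; exact mul_le_mul_of_nonneg_left (neg_le_abs x) ha)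
  linarith

/-- The integral of cosh(ax) depends only on the even moments, and cosh(ax) is comparable with
e^{a|x|}. -/
theorem IsExpBounded.of_moments_eq {μ ν : Measure ℝ} (h : IsExpBounded μ)
    (hν : ∀ k : ℕ, Integrable (fun x : ℝ => x ^ k) ν ∧ ∫ x, x ^ k ∂ν = ∫ x, x ^ k ∂μ) :
    IsExpBounded ν := by
  have hμ := h.integrable_pow
  obtain ⟨a, ha, hi⟩ := h
  refine ⟨a, ha, ?_⟩
  have h1 : ∫⁻ x, ENNReal.ofReal (Real.cosh (a * x)) ∂ν < ∞ := by
    rw [lintegral_cosh_eq fun k => (hν k).1]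
    simp only [(hν _).2]
    rw [← lintegral_cosh_eq hμ]
    refine (lintegral_mono fun x => ?_).trans_lt hi.lintegral_lt_top
    exact ENNReal.ofReal_le_ofReal (cosh_mul_le_exp ha.le x)
  have h2 : Integrable (fun x => Real.cosh (a * x)) ν :=
    (lintegral_ofReal_ne_top_iff_integrable (by fun_prop)
      (.of_forall fun x => (Real.cosh_pos _).le)).1 h1.ne
  refine (h2.const_mul 2).mono' (by fun_prop) (.of_forall fun x => ?_)
  rw [Real.norm_of_nonneg (Real.exp_pos _).le]
  exact exp_mul_abs_le_two_cosh a x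

open ProbabilityTheory Filter Topology in
-- The moments are the Taylor coefficients at 0, up to factorials, of the complex moment generating
-- function. This function is analytic on a strip around the imaginary axis and restricts there to
-- the characteristic function.
theorem IsExpBounded.isMomentDeterminate {μ : Measure ℝ} (h : IsExpBounded μ) :
    IsMomentDeterminate μ := by
  refine ⟨h.integrable_pow, fun ν hν => ?_⟩
  -- An arbitrary competing measure is finite because its zeroth moment is.
  have hfin : ∀ ρ : Measure ℝ, Integrable (fun x : ℝ => x ^ 0) ρ → IsFiniteMeasure ρ := by
    intro ρ hρ
    simpa [integrable_const_iff] using hρ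
  have := hfin μ (h.integrable_pow 0)
  have := hfin ν (hν 0).1
  obtain ⟨a, ha, hs⟩ := h.zero_mem_interior
  obtain ⟨b, hb, hs'⟩ := (h.of_moments_eq hν).zero_mem_interior
  set c := min a b with hc
  have hc0 : 0 < c := lt_min ha hb
  set U : Set ℂ := Complex.re ⁻¹' Ioo (-c) c with hU
  have hUμ : ∀ z ∈ U, z.re ∈ interior (integrableExpSet id μ) := fun z hz =>
    hs ⟨by linarith [hz.1, min_le_left a b], hz.2.trans_le (min_le_left a b)⟩
  have hUν : ∀ z ∈ U, z.re ∈ interior (integrableExpSet id ν) := fun z hz =>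
    hs' ⟨by linarith [hz.1, min_le_right a b], hz.2.trans_le (min_le_right a b)⟩
  have h0 : (0 : ℂ) ∈ U := ⟨by simpa using hc0, by simpa using hc0⟩
  have hμ : AnalyticOnNhd ℂ (complexMGF id μ) U := fun z hz => analyticAt_complexMGF (hUμ z hz)
  have hν' : AnalyticOnNhd ℂ (complexMGF id ν) U := fun z hz => analyticAt_complexMGF (hUν z hz)
  have hder : ∀ n, iteratedDeriv n (complexMGF id ν) 0 = iteratedDeriv n (complexMGF id μ) 0 := by
    intro n
    rw [iteratedDeriv_complexMGF (hUν 0 h0), iteratedDeriv_complexMGF (hUμ 0 h0)]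
    simp only [id, zero_mul, Complex.exp_zero, mul_one, ← Complex.ofReal_pow]
    rw [integral_complex_ofReal, integral_complex_ofReal, (hν n).2]
  have hloc : complexMGF id ν =ᶠ[𝓝 0] complexMGF id μ := by
    have e1 := (hν' 0 h0).hasFPowerSeriesAt.eventually_hasSum_sub
    have e2 := (hμ 0 h0).hasFPowerSeriesAt.eventually_hasSum_sub
    filter_upwards [e1, e2] with z z1 z2
    simp only [hder] at z1
    exact z1.unique z2
  -- The strip is convex, so the local equality at 0 propagates to all of it, in particular to the
  -- imaginary axis.
  have hpre : IsPreconnected U :=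
    ((convex_Ioo (-c) c).linear_preimage Complex.reLm).isPreconnected
  have heq := hν'.eqOn_of_preconnected_of_eventuallyEq hμ hpre h0 hloc
  refine Measure.ext_of_charFun ?_
  ext t
  rw [← complexMGF_id_mul_I, ← complexMGF_id_mul_I]
  exact heq ⟨by simpa using hc0, by simpa using hc0⟩

theorem IsMomentDeterminate.eq_of_recursion {μ ν : Measure ℝ} (h : IsMomentDeterminate μ)
    (hν : ∀ k : ℕ, Integrable (fun x : ℝ => x ^ k) ν) {s : ℕ → ℕ → ℝ} {g : ℕ → ℝ}
    (h1 : ∀ k, ∫ x, x ^ k ∂μ = g k - ∑ i ∈ Finset.Icc 1 k, s k i * ∫ x, x ^ (k - i) ∂μ)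
    (h2 : ∀ k, ∫ x, x ^ k ∂ν = g k - ∑ i ∈ Finset.Icc 1 k, s k i * ∫ x, x ^ (k - i) ∂ν) :
    ν = μ :=
  h.2 ν fun k => ⟨hν k, moments_eq_of_recursion (m := fun k => ∫ x, x ^ k ∂ν)
    (m' := fun k => ∫ x, x ^ k ∂μ) h2 h1 k⟩

/-! ### Products of polynomials and Gaussians -/

open Polynomial in
/-- The function `p(x) e^{-c x²}`. -/
def polyGauss (c : ℝ) (p : ℂ[X]) (x : ℝ) : ℂ := p.eval (x : ℂ) * (Real.exp (-c * x ^ 2) : ℂ)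

section polyGauss

open Polynomial FourierTransform

theorem continuous_polyGauss (c : ℝ) (p : ℂ[X]) : Continuous (polyGauss c p) := by
  unfold polyGauss
  have : Continuous fun x : ℝ => p.eval (x : ℂ) := p.continuous.comp Complex.continuous_ofReal
  fun_prop

theorem integrable_polyGauss {c : ℝ} (hc : 0 < c) (p : ℂ[X]) : Integrable (polyGauss c p) := by
  induction p using Polynomial.induction_on' with
  | add p q hp hq =>
    have : polyGauss c (p + q) = polyGauss c p + polyGauss c q := by
      ext x
      simp [polyGauss, add_mul]
    rw [this]
    exact hp.add hq
  | monomial n a =>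
    have h := integrable_rpow_mul_exp_neg_mul_sq hc (s := n) (by linarith [n.cast_nonneg (α := ℝ)])
    refine (h.ofReal (𝕜 := ℂ)).const_mul a |>.congr (.of_forall fun x => ?_)
    simp [polyGauss, mul_assoc]

theorem polyGauss_mul (c c' : ℝ) (p q : ℂ[X]) (x : ℝ) :
    polyGauss c p x * polyGauss c' q x = polyGauss (c + c') (p * q) x := by
  simp only [polyGauss, eval_mul]
  rw [mul_mul_mul_comm, ← Complex.ofReal_mul, ← Real.exp_add]
  ring_nf

theorem memLp_polyGauss {c : ℝ} (hc : 0 < c) (p : ℂ[X]) : MemLp (polyGauss c p) 2 := by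
  rw [memLp_two_iff_integrable_sq_norm (continuous_polyGauss c p).aestronglyMeasurable]
  refine (integrable_polyGauss (add_pos hc hc) (p * p)).norm.congr (.of_forall fun x => ?_)
  simp only [← polyGauss_mul, norm_mul, sq]

/-- Completing the square. Part of a Gaussian thus absorbs any exponential factor. -/
theorem exp_mul_abs_le {b : ℝ} (hb : 0 < b) (a x : ℝ) :
    Real.exp (a * |x|) ≤ Real.exp (a ^ 2 / (4 * b)) * Real.exp (b * x ^ 2) := by
  rw [← Real.exp_add]
  refine Real.exp_le_exp.2 ?_
  have h : 0 ≤ b * (|x| - a / (2 * b)) ^ 2 := by positivity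
  have h2 : b * (|x| - a / (2 * b)) ^ 2 = a ^ 2 / (4 * b) + b * x ^ 2 - a * |x| := by
    rw [← sq_abs x]
    field_simp
    ring
  linarith

theorem integrable_exp_mul_norm_polyGauss {c : ℝ} (hc : 0 < c) (p : ℂ[X]) (a : ℝ) :
    Integrable fun x : ℝ => Real.exp (a * |x|) * ‖polyGauss c p x‖ := by
  have hc2 : 0 < c / 2 := by positivity
  refine ((integrable_polyGauss hc2 p).norm.const_mul (Real.exp (a ^ 2 / (4 * (c / 2))))).mono'
    (by have := continuous_polyGauss c p; fun_prop) (.of_forall fun x => ?_)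
  rw [Real.norm_of_nonneg (by positivity)]
  refine (mul_le_mul_of_nonneg_right (exp_mul_abs_le hc2 a x) (norm_nonneg _)).trans_eq ?_
  simp only [polyGauss, norm_mul, Complex.norm_real, Real.norm_eq_abs, Real.abs_exp]
  have : Real.exp (-(c / 2) * x ^ 2) = Real.exp (c / 2 * x ^ 2) * Real.exp (-c * x ^ 2) := by
    rw [← Real.exp_add]
    ring_nf
  rw [this]
  ring

theorem integrable_exp_positionObservable_dist {c : ℝ} (hc : 0 < c) {ψ : QHilbert} {p : ℂ[X]}
    (hψ : ψ =ᵐ[volume] polyGauss c p) (a : ℝ) :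
    Integrable (fun x : ℝ => Real.exp (a * |x|)) (positionObservable.dist ψ) := by
  rw [integrable_positionObservable_dist_iff]
  refine (integrable_exp_mul_norm_polyGauss (add_pos hc hc) (p * p) a).congr ?_
  filter_upwards [hψ] with x hx
  rw [hx, ← polyGauss_mul, norm_mul]
  ring

theorem hasDerivAt_polyGauss (c : ℝ) (p : ℂ[X]) (x : ℝ) :
    HasDerivAt (polyGauss c p)
      (polyGauss c (derivative p - C (2 * c : ℂ) * X * p) x) x := by
  have h1 : HasDerivAt (fun x : ℝ => p.eval (x : ℂ)) ((derivative p).eval (x : ℂ)) x :=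
    (p.hasDerivAt (x : ℂ)).comp_ofReal
  have h2 : HasDerivAt (fun x : ℝ => Real.exp (-c * x ^ 2))
      (Real.exp (-c * x ^ 2) * (-c * (2 * x))) x := by
    have h3 : HasDerivAt (fun x : ℝ => -c * x ^ 2) (-c * (2 * x)) x := by
      simpa using (hasDerivAt_pow 2 x).const_mul (-c)
    exact h3.exp
  refine (h1.mul h2.ofReal_comp).congr_deriv ?_
  simp only [polyGauss, eval_sub, eval_mul, eval_C, eval_X]
  push_cast
  ring

/-- The Fourier transform of a polynomial times `e^{-x²/2}` is a polynomial times
`e^{-2π²ξ²}`. -/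
theorem exists_fourier_polyGauss (p : ℂ[X]) :
    ∃ q : ℂ[X], 𝓕 (polyGauss (1 / 2) p) = polyGauss (2 * Real.pi ^ 2) q := by
  have hc : (0 : ℝ) < 1 / 2 := by norm_num
  have hpi := Complex.ofReal_ne_zero.2 Real.pi_ne_zero
  induction p using Polynomial.induction_on with
  | C a =>
    have hb : 0 < ((1 / (2 * Real.pi) : ℝ) : ℂ).re := by
      rw [Complex.ofReal_re]
      have := Real.pi_pos
      positivity
    -- In the form e^{-πbx²} the Gaussian e^{-x²/2} has b = 1/2π.
    have h := fourier_gaussian_pi hb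
    refine ⟨C (a * (1 / ((1 / (2 * Real.pi) : ℝ) : ℂ) ^ (1 / 2 : ℂ))), ?_⟩
    have e : polyGauss (1 / 2) (C a) = a • fun x : ℝ =>
        Complex.exp (-Real.pi * ((1 / (2 * Real.pi) : ℝ) : ℂ) * x ^ 2) := by
      ext x
      simp only [polyGauss, eval_C, Pi.smul_apply, smul_eq_mul, Complex.ofReal_exp]
      congr 2
      push_cast
      field_simp
    have e2 : ∀ f : ℝ → ℂ, 𝓕 (a • f) = a • 𝓕 f := by
      intro f
      ext ξ
      simp only [Real.fourier_real_eq_integral_exp_smul, Pi.smul_apply, smul_eq_mul]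
      rw [← integral_const_mul]
      congr 1
      ext x
      ring
    rw [e, e2, h]
    ext ξ
    simp only [polyGauss, eval_C, Pi.smul_apply, smul_eq_mul, Complex.ofReal_exp, mul_assoc]
    congr 3
    push_cast
    field_simp
  | add p q hp hq =>
    obtain ⟨p', hp'⟩ := hp
    obtain ⟨q', hq'⟩ := hq
    refine ⟨p' + q', ?_⟩
    have e : ∀ (c : ℝ) (p q : ℂ[X]), polyGauss c (p + q) = polyGauss c p + polyGauss c q := by
      intro c p q
      ext x
      simp [polyGauss, add_mul]
    rw [e, e, ← hp', ← hq']
    exact VectorFourier.fourierIntegral_add Real.continuous_fourierChar (L := innerₗ ℝ)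
      continuous_inner (integrable_polyGauss hc p) (integrable_polyGauss hc q)
  | monomial n a h =>
    obtain ⟨q, hq⟩ := h
    have hx : ∀ p : ℂ[X], Integrable fun x : ℝ => x • polyGauss (1 / 2) p x := by
      intro p
      refine (integrable_polyGauss hc (X * p)).congr (.of_forall fun x => ?_)
      simp [polyGauss, mul_assoc]
    refine ⟨C ((-2 * Real.pi * Complex.I)⁻¹) *
      (derivative q - C (2 * (2 * Real.pi ^ 2 : ℝ) : ℂ) * X * q), ?_⟩
    ext ξ
    -- Multiplication by x becomes, up to the factor -2πi, differentiation of the transform, and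
    -- derivatives of polynomials times Gaussians are again of that form.
    have h1 := Real.hasDerivAt_fourier (integrable_polyGauss hc (C a * X ^ n)) (hx _) ξ
    rw [hq] at h1
    have h2 := h1.unique (hasDerivAt_polyGauss _ q ξ)
    have hne : (-2 * Real.pi * Complex.I : ℂ) ≠ 0 := by
      simp [Complex.I_ne_zero]
    have h3 : 𝓕 (fun x : ℝ => (-2 * Real.pi * Complex.I * x) • polyGauss (1 / 2) (C a * X ^ n) x) ξ
        = (-2 * Real.pi * Complex.I) * 𝓕 (polyGauss (1 / 2) (C a * X ^ (n + 1))) ξ := by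
      simp only [Real.fourier_real_eq_integral_exp_smul, smul_eq_mul]
      rw [← integral_const_mul]
      congr 1
      ext x
      simp only [polyGauss, eval_mul, eval_C, eval_pow, eval_X]
      ring
    rw [h3] at h2
    have h4 : polyGauss (2 * Real.pi ^ 2) (C ((-2 * Real.pi * Complex.I)⁻¹) *
        (derivative q - C (2 * (2 * Real.pi ^ 2 : ℝ) : ℂ) * X * q)) ξ =
        (-2 * Real.pi * Complex.I)⁻¹ * polyGauss (2 * Real.pi ^ 2)
        (derivative q - C (2 * (2 * Real.pi ^ 2 : ℝ) : ℂ) * X * q) ξ := by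
      simp only [polyGauss, eval_mul, eval_C]
      ring
    rw [h4, ← h2, inv_mul_cancel_left₀ hne]

theorem exists_fourierL2_polyGauss {ψ : QHilbert} {p : ℂ[X]}
    (hψ : ψ =ᵐ[volume] polyGauss (1 / 2) p) :
    ∃ q : ℂ[X], fourierL2 ψ =ᵐ[volume] polyGauss (2 * Real.pi ^ 2) q := by
  have hc : (0 : ℝ) < 1 / 2 := by norm_num
  obtain ⟨q, hq⟩ := exists_fourier_polyGauss p
  refine ⟨q, ?_⟩
  have e : ψ = (memLp_polyGauss hc p).toLp := Lp.ext (hψ.trans (MemLp.coeFn_toLp _).symm)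
  rw [e, ← hq]
  exact fourierL2_toLp_ae_eq (integrable_polyGauss hc p) (memLp_polyGauss hc p)

/-! ### The span of the Hermite functions -/

/-- The polynomial factor of the `n`-th Hermite function, up to normalization. -/
def hermitePoly (n : ℕ) : ℂ[X] :=
  ((hermite n).map (Int.castRingHom ℂ)).comp (C (Real.sqrt 2 : ℂ) * X)

theorem sqrt_two_ne_zero : (Real.sqrt 2 : ℂ) ≠ 0 :=
  Complex.ofReal_ne_zero.2 (Real.sqrt_ne_zero'.2 two_pos)

theorem hermiteFunction_eq (n : ℕ) (x : ℝ) : (hermiteFunction n x : ℂ) =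
    ((Real.sqrt (n.factorial * Real.sqrt Real.pi))⁻¹ : ℝ) * polyGauss (1 / 2) (hermitePoly n) x := by
  have h : ((aeval (Real.sqrt 2 * x) (hermite n) : ℝ) : ℂ) = (hermitePoly n).eval (x : ℂ) := by
    rw [hermitePoly, eval_comp, eval_mul, eval_C, eval_X, eval_map, ← Complex.ofReal_mul,
      ← Complex.coe_algebraMap, ← aeval_algebraMap_apply]
    rfl
  rw [hermiteFunction, Complex.ofReal_mul, Complex.ofReal_mul, h, polyGauss, mul_assoc]
  congr 4
  ring

theorem degree_hermitePoly (n : ℕ) : (hermitePoly n).degree = n := by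
  have h1 : ((hermite n).map (Int.castRingHom ℂ)).natDegree = n := by
    rw [(hermite_monic n).natDegree_map, natDegree_hermite]
  have h2 : (hermitePoly n).natDegree = n := by
    rw [hermitePoly, natDegree_comp, h1, natDegree_C_mul_X _ sqrt_two_ne_zero, mul_one]
  have h3 : hermitePoly n ≠ 0 := by
    intro h0
    have h4 : (hermitePoly n).leadingCoeff = 0 := by rw [h0, leadingCoeff_zero]
    rw [hermitePoly, leadingCoeff_comp
      (by rw [natDegree_C_mul_X _ sqrt_two_ne_zero]; exact one_ne_zero),
      ((hermite_monic n).map _).leadingCoeff, one_mul, leadingCoeff_C_mul_X] at h4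
    exact pow_ne_zero _ sqrt_two_ne_zero h4
  rw [degree_eq_natDegree h3, h2]

/-- There is one polynomial of each degree, with invertible leading coefficient. Orthogonality to D
is therefore orthogonality to every polynomial times e^{-x²/2}. -/
theorem span_hermitePoly : Submodule.span ℂ (range hermitePoly) = ⊤ :=
  Polynomial.Sequence.span ⟨hermitePoly, degree_hermitePoly⟩
    fun i => (leadingCoeff_ne_zero.2 (Polynomial.Sequence.ne_zero
      ⟨hermitePoly, degree_hermitePoly⟩ i)).isUnit

theorem exists_polyGauss_of_mem_hermiteSpan {ψ : QHilbert} (hψ : ψ ∈ hermiteSpan) :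
    ∃ p : ℂ[X], ψ =ᵐ[volume] polyGauss (1 / 2) p := by
  induction hψ using Submodule.span_induction with
  | mem ψ h =>
    obtain ⟨n, hn⟩ := h
    refine ⟨C (((Real.sqrt (n.factorial * Real.sqrt Real.pi))⁻¹ : ℝ) : ℂ) * hermitePoly n, ?_⟩
    filter_upwards [hn] with x hx
    rw [hx, hermiteFunction_eq]
    simp only [polyGauss, eval_mul, eval_C]
    ring
  | zero =>
    refine ⟨0, ?_⟩
    filter_upwards [Lp.coeFn_zero ℂ 2 (volume : Measure ℝ)] with x hx
    rw [hx]
    simp [polyGauss]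
  | add φ ψ _ _ h1 h2 =>
    obtain ⟨p, hp⟩ := h1
    obtain ⟨q, hq⟩ := h2
    refine ⟨p + q, ?_⟩
    filter_upwards [Lp.coeFn_add φ ψ, hp, hq] with x h h1 h2
    rw [h, Pi.add_apply, h1, h2]
    simp [polyGauss, add_mul]
  | smul a ψ _ h =>
    obtain ⟨p, hp⟩ := h
    refine ⟨C a * p, ?_⟩
    filter_upwards [Lp.coeFn_smul a ψ, hp] with x h h1
    rw [h, Pi.smul_apply, h1]
    simp [polyGauss, mul_assoc]

theorem isExpBounded_positionObservable_dist {ψ : QHilbert} (hψ : ψ ∈ hermiteSpan) :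
    IsExpBounded (positionObservable.dist ψ) := by
  obtain ⟨p, hp⟩ := exists_polyGauss_of_mem_hermiteSpan hψ
  exact ⟨1, one_pos, integrable_exp_positionObservable_dist (by norm_num) hp 1⟩

theorem isExpBounded_momentumObservable_dist {ψ : QHilbert} (hψ : ψ ∈ hermiteSpan) :
    IsExpBounded (momentumObservable.dist ψ) := by
  obtain ⟨p, hp⟩ := exists_polyGauss_of_mem_hermiteSpan hψ
  obtain ⟨q, hq⟩ := exists_fourierL2_polyGauss hp
  have hpi := Real.pi_pos
  refine ⟨1, one_pos, ?_⟩
  rw [momentumObservable_dist, integrable_map_measure (by fun_prop)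
    measurable_two_pi_mul.aemeasurable]
  refine (integrable_exp_positionObservable_dist (by positivity) hq (2 * Real.pi)).congr
    (.of_forall fun x => ?_)
  simp [abs_mul, abs_of_pos hpi]

theorem lintegral_enorm_pow_sq_lt_top {μ : Measure ℝ} {k : ℕ}
    (h : Integrable (fun x : ℝ => x ^ (k * 2)) μ) : ∫⁻ x, ‖x ^ k‖ₑ ^ 2 ∂μ < ∞ := by
  simpa only [HasFiniteIntegral, pow_mul, enorm_pow] using h.hasFiniteIntegral

theorem mem_positionPow_domain_of_mem_hermiteSpan {ψ : QHilbert} (hψ : ψ ∈ hermiteSpan) (k : ℕ) :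
    ψ ∈ (positionPow k).domain :=
  (mem_positionPow_domain_iff k ψ).2 (lintegral_enorm_pow_sq_lt_top
    ((isExpBounded_positionObservable_dist hψ).integrable_pow _))

theorem mem_momentumPow_domain_of_mem_hermiteSpan {ψ : QHilbert} (hψ : ψ ∈ hermiteSpan) (k : ℕ) :
    ψ ∈ (momentumPow k).domain :=
  (mem_momentumPow_domain_iff_lintegral k ψ).2 (lintegral_enorm_pow_sq_lt_top
    ((isExpBounded_momentumObservable_dist hψ).integrable_pow _))

/-! ### Density -/

theorem integrable_polyGauss_mul {c : ℝ} (hc : 0 < c) (p : ℂ[X]) (ψ : QHilbert) :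
    Integrable fun x => polyGauss c p x * ψ x :=
  (memLp_polyGauss hc p).integrable_mul (Lp.memLp ψ)

/-- Hermite functions are real, so the inner product carries no conjugation and the vanishing
extends linearly to all polynomials. -/
theorem integral_polyGauss_mul_eq_zero {ψ : QHilbert} (hψ : ψ ∈ hermiteSpanᗮ) (p : ℂ[X]) :
    ∫ x, polyGauss (1 / 2) p x * ψ x = 0 := by
  have hc : (0 : ℝ) < 1 / 2 := by norm_num
  have hp : p ∈ Submodule.span ℂ (range hermitePoly) := by
    rw [span_hermitePoly]
    trivial
  induction hp using Submodule.span_induction with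
  | mem p h =>
    obtain ⟨n, rfl⟩ := h
    have hm : MemLp (fun x : ℝ => (hermiteFunction n x : ℂ)) 2 volume := by
      simp only [hermiteFunction_eq]
      exact (memLp_polyGauss hc _).const_mul _
    have h1 : hm.toLp ∈ hermiteSpan := Submodule.subset_span ⟨n, hm.coeFn_toLp⟩
    have h2 := (Submodule.mem_orthogonal _ _).1 hψ _ h1
    rw [L2.inner_def] at h2
    have h3 : ∫ x, ⟪hm.toLp _ x, ψ x⟫_ℂ =
        ((Real.sqrt (n.factorial * Real.sqrt Real.pi))⁻¹ : ℝ) *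
          ∫ x, polyGauss (1 / 2) (hermitePoly n) x * ψ x := by
      rw [← integral_const_mul]
      refine integral_congr_ae ?_
      filter_upwards [hm.coeFn_toLp] with x hx
      rw [hx, RCLike.inner_apply, Complex.conj_ofReal, hermiteFunction_eq]
      ring
    rw [h3] at h2
    refine (mul_eq_zero.1 h2).resolve_left (Complex.ofReal_ne_zero.2 (inv_ne_zero ?_))
    have := Real.pi_pos
    positivity
  | zero => simp [polyGauss]
  | add p q _ _ h1 h2 =>
    have e : ∀ x, polyGauss (1 / 2) (p + q) x * ψ x =
        polyGauss (1 / 2) p x * ψ x + polyGauss (1 / 2) q x * ψ x := by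
      intro x
      simp only [polyGauss, eval_add]
      ring
    simp only [e]
    rw [integral_add (integrable_polyGauss_mul hc p ψ) (integrable_polyGauss_mul hc q ψ), h1, h2,
      add_zero]
  | smul a p _ h =>
    have e : ∀ x, polyGauss (1 / 2) (a • p) x * ψ x = a * (polyGauss (1 / 2) p x * ψ x) := by
      intro x
      simp only [polyGauss, eval_smul, smul_eq_mul]
      ring
    simp only [e]
    rw [integral_const_mul, h, mul_zero]

/-- The kernel e^{-2πixξ} is expanded in its power series; the series is dominated by
e^{2π|ξ||x|}|g(x)|, and every term integrates to a multiple of a moment. -/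
theorem fourier_eq_zero_of_moments_eq_zero {g : ℝ → ℂ}
    (hg : AEStronglyMeasurable g volume)
    (hexp : ∀ a : ℝ, Integrable fun x : ℝ => Real.exp (a * |x|) * ‖g x‖)
    (h : ∀ n : ℕ, ∫ x : ℝ, (x : ℂ) ^ n * g x = 0) (ξ : ℝ) : 𝓕 g ξ = 0 := by
  rw [Real.fourier_real_eq_integral_exp_smul]
  have hbs : ∀ x : ℝ, HasSum
      (fun n : ℕ => (2 * Real.pi * |ξ| * |x|) ^ n / n.factorial * ‖g x‖)
      (Real.exp (2 * Real.pi * |ξ| * |x|) * ‖g x‖) := by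
    intro x
    have := NormedSpace.expSeries_div_hasSum_exp (𝔸 := ℝ) (2 * Real.pi * |ξ| * |x|)
    rw [← Real.exp_eq_exp_ℝ] at this
    exact this.mul_right _
  have key := hasSum_integral_of_dominated_convergence (μ := volume)
    (F := fun (n : ℕ) (x : ℝ) => (((-2 * Real.pi * x * ξ : ℝ) : ℂ) * Complex.I) ^ n /
      n.factorial * g x)
    (f := fun x : ℝ => Complex.exp (((-2 * Real.pi * x * ξ : ℝ) : ℂ) * Complex.I) • g x)
    (fun n x => (2 * Real.pi * |ξ| * |x|) ^ n / n.factorial * ‖g x‖)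
    (fun n => AEStronglyMeasurable.mul (by fun_prop) hg)
    (fun n => .of_forall fun x => ?_)
    (.of_forall fun x => (hbs x).summable)
    (by simpa only [(hbs _).tsum_eq] using hexp (2 * Real.pi * |ξ|))
    (.of_forall fun x => ?_)
  · have h0 : ∀ n : ℕ, ∫ x : ℝ, (((-2 * Real.pi * x * ξ : ℝ) : ℂ) * Complex.I) ^ n /
        n.factorial * g x = 0 := by
      intro n
      have e : ∀ x : ℝ, (((-2 * Real.pi * x * ξ : ℝ) : ℂ) * Complex.I) ^ n / n.factorial * g x =
          ((-2 * Real.pi * ξ) * Complex.I) ^ n / n.factorial * ((x : ℂ) ^ n * g x) := by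
        intro x
        push_cast
        rw [show (-2 * Real.pi * x * ξ * Complex.I : ℂ) = (-2 * Real.pi * ξ) * Complex.I * x by ring,
          mul_pow]
        ring
      simp only [e]
      rw [integral_const_mul, h, mul_zero]
    simp only [h0] at key
    exact key.unique hasSum_zero
  · have hpi := Real.pi_pos
    rw [norm_mul, norm_div, norm_pow, norm_mul, Complex.norm_I, mul_one, Complex.norm_real,
      Real.norm_eq_abs, abs_mul, abs_mul, abs_mul, abs_neg, abs_two, abs_of_pos hpi]
    simp only [Complex.norm_natCast]
    refine le_of_eq ?_
    ring
  · have := NormedSpace.expSeries_div_hasSum_exp (𝔸 := ℂ)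
      (((-2 * Real.pi * x * ξ : ℝ) : ℂ) * Complex.I)
    rw [← Complex.exp_eq_exp_ℂ] at this
    exact this.mul_right _

/-- For ψ orthogonal to D, the function g = e^{-x²/2}ψ has vanishing moments and hence vanishing
Fourier transform. Plancherel gives g = 0, and the Gaussian factor has no zeros. -/
theorem dense_hermiteSpan : Dense (hermiteSpan : Set QHilbert) := by
  have hc : (0 : ℝ) < 1 / 2 := by norm_num
  have hc4 : (0 : ℝ) < 1 / 4 := by norm_num
  rw [Submodule.dense_iff_topologicalClosure_eq_top, Submodule.topologicalClosure_eq_top_iff,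
    Submodule.eq_bot_iff]
  intro ψ hψ
  set g : ℝ → ℂ := fun x => polyGauss (1 / 2) 1 x * ψ x with hg
  have h1 : Integrable g := integrable_polyGauss_mul hc 1 ψ
  have hle : ∀ x, ‖polyGauss (1 / 2) 1 x‖ ≤ 1 := by
    intro x
    simp only [polyGauss, eval_one, one_mul, Complex.norm_real, Real.norm_eq_abs, Real.abs_exp,
      Real.exp_le_one_iff]
    nlinarith [sq_nonneg x]
  have h2 : MemLp g 2 := memLp_mul_of_norm_le_one _ (continuous_polyGauss _ _).measurable hle ψ
  have hexp : ∀ a : ℝ, Integrable fun x : ℝ => Real.exp (a * |x|) * ‖g x‖ := by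
    intro a
    -- Half of the Gaussian absorbs e^{a|x|}; the remaining e^{-x²/4}ψ is integrable as a product of
    -- L² functions.
    refine ((integrable_polyGauss_mul hc4 1 ψ).norm.const_mul
      (Real.exp (a ^ 2 / (4 * (1 / 4))))).mono'
      (AEStronglyMeasurable.mul (by fun_prop) h1.aestronglyMeasurable.norm)
      (.of_forall fun x => ?_)
    rw [Real.norm_of_nonneg (by positivity)]
    refine (mul_le_mul_of_nonneg_right (exp_mul_abs_le hc4 a x) (norm_nonneg _)).trans_eq ?_
    simp only [hg, polyGauss, norm_mul, Complex.norm_real, Real.norm_eq_abs, Real.abs_exp]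
    have : Real.exp (-(1 / 4) * x ^ 2) =
        Real.exp (1 / 4 * x ^ 2) * Real.exp (-(1 / 2) * x ^ 2) := by
      rw [← Real.exp_add]
      ring_nf
    rw [this]
    ring
  have hmom : ∀ n : ℕ, ∫ x : ℝ, (x : ℂ) ^ n * g x = 0 := by
    intro n
    rw [← integral_polyGauss_mul_eq_zero hψ (X ^ n)]
    congr 1
    ext x
    simp only [hg, polyGauss, eval_one, eval_pow, eval_X]
    ring
  have hzero := fourier_eq_zero_of_moments_eq_zero h1.aestronglyMeasurable hexp hmom
  have h3 := lintegral_enorm_fourier_sq h1 h2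
  simp only [hzero, enorm_zero, ne_eq, OfNat.ofNat_ne_zero, not_false_eq_true, zero_pow,
    lintegral_zero] at h3
  rw [eq_comm, lintegral_eq_zero_iff' (by have := h1.aestronglyMeasurable; fun_prop)] at h3
  rw [Lp.eq_zero_iff_ae_eq_zero]
  filter_upwards [h3] with x hx
  have hx' : g x = 0 := by simpa using hx
  refine (mul_eq_zero.1 hx').resolve_left ?_
  simp [polyGauss]

end polyGauss

/-! ### Operators given by weak integrals of rank one operators -/

/-- Since |u⟩⟨u| has norm ‖u‖², the integral of the rank one operators converges in operator norm as
a Bochner integral. -/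
theorem exists_isPositive_integral_rankOne {H S : Type*} [NormedAddCommGroup H]
    [InnerProductSpace ℂ H] [CompleteSpace H] [MeasurableSpace S] {ν : Measure S} {u : S → H}
    (hu : StronglyMeasurable u) (hi : Integrable (fun s => ‖u s‖ ^ 2) ν) :
    ∃ T : H →L[ℂ] H, T.IsPositive ∧
      ∀ ψ, ⟪ψ, T ψ⟫_ℂ = ((∫ s, ‖⟪u s, ψ⟫_ℂ‖ ^ 2 ∂ν : ℝ) : ℂ) := by
  have hc : Continuous fun x : H => InnerProductSpace.rankOne ℂ x x := by
    have h1 : Continuous fun x : H =>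
        ContinuousLinearMap.smulRightL ℂ H H (innerSL ℂ x) x :=
      ((ContinuousLinearMap.smulRightL ℂ H H).continuous.comp
        (innerSL ℂ).continuous).clm_apply continuous_id
    exact h1
  have hint : Integrable (fun s => InnerProductSpace.rankOne ℂ (u s) (u s)) ν := by
    refine hi.mono (hc.comp_stronglyMeasurable hu).aestronglyMeasurable (.of_forall fun s => ?_)
    rw [InnerProductSpace.norm_rankOne, Real.norm_of_nonneg (sq_nonneg _), sq]
  have key : ∀ ψ, ⟪ψ, (∫ s, InnerProductSpace.rankOne ℂ (u s) (u s) ∂ν) ψ⟫_ℂ =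
      ((∫ s, ‖⟪u s, ψ⟫_ℂ‖ ^ 2 ∂ν : ℝ) : ℂ) := by
    intro ψ
    rw [ContinuousLinearMap.integral_apply hint, ← integral_inner (hint.apply_continuousLinearMap ψ),
      ← integral_complex_ofReal]
    refine integral_congr_ae (.of_forall fun s => ?_)
    simp only [InnerProductSpace.rankOne_apply, inner_smul_right]
    rw [← inner_conj_symm ψ, Complex.mul_conj']
    norm_cast
  refine ⟨_, ?_, key⟩
  rw [ContinuousLinearMap.isPositive_iff_complex]
  intro ψ
  rw [← inner_conj_symm, key, Complex.conj_ofReal]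
  refine ⟨rfl, ?_⟩
  exact integral_nonneg fun s => sq_nonneg _

theorem exists_isFrame {S : Type*} [MeasurableSpace S] {ν : Measure S} {u : S → QHilbert}
    (hu : StronglyMeasurable u) (hi : ∫⁻ s, ‖u s‖ₑ ^ 2 ∂ν < ∞) :
    ∃ T : QHilbert →L[ℂ] QHilbert, IsFrame ν u T := by
  have hi' : Integrable (fun s => ‖u s‖ ^ 2) ν := by
    refine ⟨(hu.norm.pow 2).aestronglyMeasurable, ?_⟩
    simpa only [HasFiniteIntegral, enorm_pow, enorm_norm] using hi
  obtain ⟨T, hT, h⟩ := exists_isPositive_integral_rankOne hu hi'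
  refine ⟨T, hT, hu, fun ψ => ?_⟩
  have h1 := h ψ
  rw [inner_self_eq_norm_opSqrt_sq hT] at h1
  have h2 : ‖opSqrt T ψ‖ ^ 2 = ∫ s, ‖⟪u s, ψ⟫_ℂ‖ ^ 2 ∂ν := Complex.ofReal_injective h1
  have hm : StronglyMeasurable fun s => ⟪u s, ψ⟫_ℂ := hu.inner stronglyMeasurable_const
  have h3 : Integrable (fun s => ‖⟪u s, ψ⟫_ℂ‖ ^ 2) ν := by
    refine (hi'.mul_const (‖ψ‖ ^ 2)).mono' (hm.norm.pow 2).aestronglyMeasurable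
      (.of_forall fun s => ?_)
    rw [Real.norm_of_nonneg (sq_nonneg _), ← mul_pow]
    exact pow_le_pow_left₀ (norm_nonneg _) (norm_inner_le_norm _ _) 2
  rw [← ofReal_norm, ← ENNReal.ofReal_pow (norm_nonneg _), h2,
    ofReal_integral_eq_lintegral_ofReal h3 (.of_forall fun s => sq_nonneg _)]
  simp only [enorm_sq_eq_ofReal]

/-! ### Complex conjugation -/

theorem coeFn_reflection (ψ : QHilbert) :
    Lp.compMeasurePreserving Neg.neg (Measure.measurePreserving_neg (volume : Measure ℝ)) ψ
      =ᵐ[volume] fun x => ψ (-x) :=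
  Lp.coeFn_compMeasurePreserving ψ (Measure.measurePreserving_neg (volume : Measure ℝ))

open FourierTransform in
theorem fourier_conj (f : ℝ → ℂ) (ξ : ℝ) :
    𝓕 (fun x => (starRingEnd ℂ) (f x)) ξ = (starRingEnd ℂ) (𝓕 f (-ξ)) := by
  rw [Real.fourier_real_eq_integral_exp_smul, Real.fourier_real_eq_integral_exp_smul,
    ← integral_conj]
  refine integral_congr_ae (.of_forall fun x => ?_)
  simp only [smul_eq_mul, map_mul, ← Complex.exp_conj, Complex.conj_ofReal, Complex.conj_I]
  congr 2
  push_cast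
  ring

open FourierTransform in
-- Checked on Schwartz functions and extended by continuity. The reflection is harmless, because
-- only even moments enter the Hilbert–Schmidt conditions.
theorem fourierL2_conjL2 (ψ : QHilbert) :
    fourierL2 (conjL2 ψ) = conjL2 (Lp.compMeasurePreserving Neg.neg
      (Measure.measurePreserving_neg (volume : Measure ℝ)) (fourierL2 ψ)) := by
  have hd := SchwartzMap.denseRange_toLpCLM (E := ℝ) (F := ℂ) (p := 2) (μ := volume)
    ENNReal.ofNat_ne_top
  have hneg := Measure.measurePreserving_neg (volume : Measure ℝ)
  refine congrFun (f := fun ψ => fourierL2 (conjL2 ψ)) (hd.equalizer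
    (fourierL2.continuous.comp conjL2.continuous)
    (h := fun ψ => conjL2 (Lp.compMeasurePreserving Neg.neg hneg (fourierL2 ψ)))
    (conjL2.continuous.comp ((Lp.isometry_compMeasurePreserving hneg).continuous.comp
      fourierL2.continuous)) ?_) ψ
  ext1 f
  simp only [Function.comp_apply, SchwartzMap.toLpCLM_apply]
  rw [fourierL2_toLp]
  have hae : conjL2 (f.toLp 2) =ᵐ[volume] fun x => (starRingEnd ℂ) (f x) := by
    filter_upwards [coeFn_conjL2 (f.toLp 2), f.coeFn_toLp 2 volume] with x h1 h2
    rw [h1, h2]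
  have h2 : MemLp (fun x => (starRingEnd ℂ) (f x)) 2 := (memLp_congr_ae hae).1 (Lp.memLp _)
  have h1 : Integrable (fun x => (starRingEnd ℂ) (f x)) :=
    Complex.conjCLE.integrable_comp_iff.2 (f.integrable (μ := volume))
  have e : conjL2 (f.toLp 2) = h2.toLp := Lp.ext (hae.trans h2.coeFn_toLp.symm)
  refine Lp.ext ?_
  rw [e]
  filter_upwards [fourierL2_toLp_ae_eq h1 h2,
    coeFn_conjL2 (Lp.compMeasurePreserving Neg.neg hneg ((𝓕 f).toLp 2)),
    coeFn_reflection ((𝓕 f).toLp 2),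
    hneg.quasiMeasurePreserving.ae ((𝓕 f).coeFn_toLp 2 volume)] with x e1 e2 e3 e4
  rw [e1, e2, e3, e4, fourier_conj, SchwartzMap.fourier_coe]

theorem positionObservable_dist_congr {φ ψ : QHilbert} (h : ∀ᵐ x, ‖φ x‖ₑ = ‖ψ x‖ₑ) :
    positionObservable.dist φ = positionObservable.dist ψ := by
  rw [positionObservable_dist, positionObservable_dist]
  refine withDensity_congr_ae ?_
  filter_upwards [h] with x hx
  rw [hx]

theorem positionObservable_dist_conjL2 (ψ : QHilbert) :
    positionObservable.dist (conjL2 ψ) = positionObservable.dist ψ :=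
  positionObservable_dist_congr (by
    filter_upwards [coeFn_conjL2 ψ] with x hx
    rw [hx, RCLike.enorm_conj])

theorem lintegral_positionObservable_dist_reflection (ψ : QHilbert) (k : ℕ) :
    ∫⁻ x, ‖x ^ k‖ₑ ^ 2 ∂(positionObservable.dist (Lp.compMeasurePreserving Neg.neg
      (Measure.measurePreserving_neg (volume : Measure ℝ)) ψ)) =
      ∫⁻ x, ‖x ^ k‖ₑ ^ 2 ∂(positionObservable.dist ψ) := by
  rw [lintegral_positionObservable_dist _ (by fun_prop),
    lintegral_positionObservable_dist _ (by fun_prop),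
    ← lintegral_neg_eq_self (fun x => ‖ψ x‖ₑ ^ 2 * ‖x ^ k‖ₑ ^ 2)]
  refine lintegral_congr_ae ?_
  filter_upwards [coeFn_reflection ψ] with x hx
  rw [hx, enorm_neg_pow_sq]

theorem lintegral_momentumObservable_dist_conjL2 (ψ : QHilbert) (k : ℕ) :
    ∫⁻ x, ‖x ^ k‖ₑ ^ 2 ∂(momentumObservable.dist (conjL2 ψ)) =
      ∫⁻ x, ‖x ^ k‖ₑ ^ 2 ∂(momentumObservable.dist ψ) := by
  rw [lintegral_momentumObservable_dist_pow, lintegral_momentumObservable_dist_pow,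
    fourierL2_conjL2, positionObservable_dist_conjL2, lintegral_positionObservable_dist_reflection]

theorem inner_conjL2_left (φ ψ : QHilbert) :
    ⟪conjL2 φ, ψ⟫_ℂ = (starRingEnd ℂ) ⟪φ, conjL2 ψ⟫_ℂ := by
  rw [L2.inner_def, L2.inner_def, ← integral_conj]
  refine integral_congr_ae ?_
  filter_upwards [coeFn_conjL2 φ, coeFn_conjL2 ψ] with x h1 h2
  rw [h1, h2]
  simp [RCLike.inner_apply]

theorem conjL2_conjL2 (ψ : QHilbert) : conjL2 (conjL2 ψ) = ψ := by
  refine Lp.ext ?_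
  filter_upwards [coeFn_conjL2 ψ, coeFn_conjL2 (conjL2 ψ)] with x h1 h2
  rw [h2, h1, Complex.conj_conj]

theorem enorm_conjL2 (ψ : QHilbert) : ‖conjL2 ψ‖ₑ = ‖ψ‖ₑ := by
  rw [← ofReal_norm, ← ofReal_norm]
  congr 1
  refine le_antisymm (norm_conjL2 ψ) ?_
  conv_lhs => rw [← conjL2_conjL2 ψ]
  exact norm_conjL2 _

theorem inner_conjOp (σ : QHilbert →L[ℂ] QHilbert) (φ ψ : QHilbert) :
    ⟪conjOp σ φ, ψ⟫_ℂ = (starRingEnd ℂ) ⟪σ (conjL2 φ), conjL2 ψ⟫_ℂ :=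
  inner_conjL2_left _ _

theorem isPositive_conjOp {σ : QHilbert →L[ℂ] QHilbert} (hσ : σ.IsPositive) :
    (conjOp σ).IsPositive := by
  rw [ContinuousLinearMap.isPositive_iff_complex] at hσ ⊢
  intro ψ
  obtain ⟨h1, h2⟩ := hσ (conjL2 ψ)
  rw [inner_conjOp, ← h1]
  simpa using h2

/-- C is an antiunitary involution, so |⟨Cu|ψ⟩| = |⟨u|Cψ⟩|. Working with frames avoids determining
the square root of CσC. -/
theorem IsFrame.conjOp {S : Type*} [MeasurableSpace S] {ν : Measure S} {u : S → QHilbert}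
    {σ : QHilbert →L[ℂ] QHilbert} (h : IsFrame ν u σ) :
    IsFrame ν (fun s => conjL2 (u s)) (_root_.conjOp σ) := by
  refine ⟨isPositive_conjOp h.isPositive,
    conjL2.continuous.comp_stronglyMeasurable h.stronglyMeasurable, fun ψ => ?_⟩
  simp only [inner_conjL2_left, RCLike.enorm_conj]
  rw [h.lintegral_eq]
  have h1 := inner_self_eq_norm_opSqrt_sq h.isPositive (conjL2 ψ)
  have h2 := inner_self_eq_norm_opSqrt_sq (isPositive_conjOp h.isPositive) ψ
  rw [← inner_conj_symm, inner_conjOp, Complex.conj_conj, ← inner_conj_symm, h1,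
    Complex.conj_ofReal] at h2
  have h3 := Complex.ofReal_injective h2
  rw [← ofReal_norm, ← ofReal_norm, ← ENNReal.ofReal_pow (norm_nonneg _), h3,
    ENNReal.ofReal_pow (norm_nonneg _)]

theorem conjOp_isQState_and_hasHSMoments {σ : QHilbert →L[ℂ] QHilbert} (hσ : IsQState σ)
    (hs : HasHSMoments σ) : IsQState (conjOp σ) ∧ HasHSMoments (conjOp σ) := by
  obtain ⟨u, hu⟩ := hσ.exists_frame
  have hu' := hu.conjOp
  have hg : ∀ k : ℕ, Measurable fun x : ℝ => ‖x ^ k‖ₑ ^ 2 := fun k => by fun_prop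
  refine ⟨hu'.isQState_iff.2 ?_, hu'.hasHSMoments_iff.2 fun k => ?_⟩
  · simp only [enorm_conjL2]
    exact hu.isQState_iff.1 hσ
  · have h := hu.hasHSMoments_iff.1 hs k
    rw [lintegral_noiseMeasure positionObservable_isSharp hu.stronglyMeasurable (hg k),
      lintegral_noiseMeasure momentumObservable_isSharp hu.stronglyMeasurable (hg k)] at h
    rw [lintegral_noiseMeasure positionObservable_isSharp hu'.stronglyMeasurable (hg k),
      lintegral_noiseMeasure momentumObservable_isSharp hu'.stronglyMeasurable (hg k)]
    simp only [enorm_neg_pow_sq, positionObservable_dist_conjL2,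
      lintegral_momentumObservable_dist_conjL2] at h ⊢
    exact h

/-! ### States mixed from translates of a Schwartz function -/

theorem lintegral_schwartz_pow_lt_top (f : 𝓢(ℝ, ℂ)) (k : ℕ) :
    ∫⁻ x, ‖f x‖ₑ ^ 2 * ‖x ^ k‖ₑ ^ 2 < ∞ := by
  obtain ⟨C, hC⟩ := f.decay k 0
  have hi := (f.integrable_pow_mul volume k).const_mul C
  have h : Integrable fun x : ℝ => ‖f x‖ ^ 2 * (x ^ k) ^ 2 := by
    refine hi.mono' (by have := f.continuous; fun_prop) (.of_forall fun x => ?_)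
    have h1 := hC.2 x
    rw [norm_iteratedFDeriv_zero] at h1
    have h2 : ‖‖f x‖ ^ 2 * (x ^ k) ^ 2‖ = (‖x‖ ^ k * ‖f x‖) * (‖x‖ ^ k * ‖f x‖) := by
      rw [norm_mul, norm_pow, norm_pow, norm_norm, norm_pow]
      ring
    rw [h2]
    exact mul_le_mul_of_nonneg_right h1 (by positivity)
  have h' := h.hasFiniteIntegral
  simpa only [HasFiniteIntegral, enorm_mul, enorm_pow, enorm_norm] using h'

theorem lintegral_positionObservable_dist_schwartz (f : 𝓢(ℝ, ℂ)) (k : ℕ) :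
    ∫⁻ x, ‖x ^ k‖ₑ ^ 2 ∂(positionObservable.dist (f.toLp 2)) =
      ∫⁻ x, ‖f x‖ₑ ^ 2 * ‖x ^ k‖ₑ ^ 2 := by
  rw [lintegral_positionObservable_dist _ (by fun_prop)]
  refine lintegral_congr_ae ?_
  filter_upwards [f.coeFn_toLp 2 volume] with x hx
  rw [hx]

theorem enorm_translationOp (a : ℝ) (v : QHilbert) : ‖translationOp a v‖ₑ = ‖v‖ₑ := by
  rw [← weylOp_zero_right, ← ofReal_norm, norm_weylOp, ofReal_norm]

theorem lintegral_positionObservable_dist_smul (c : ℂ) (v : QHilbert) {g : ℝ → ℝ≥0∞}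
    (hg : Measurable g) :
    ∫⁻ x, g x ∂(positionObservable.dist (c • v)) =
      ‖c‖ₑ ^ 2 * ∫⁻ x, g x ∂(positionObservable.dist v) := by
  rw [lintegral_positionObservable_dist _ hg, lintegral_positionObservable_dist _ hg,
    ← lintegral_const_mul' _ _ (by finiteness)]
  refine lintegral_congr_ae ?_
  filter_upwards [Lp.coeFn_smul c v] with x hx
  rw [hx, Pi.smul_apply, smul_eq_mul, enorm_mul, mul_pow, mul_assoc]

theorem enorm_add_pow_sq_le (x a : ℝ) (k : ℕ) :
    ‖(x + a) ^ k‖ₑ ^ 2 ≤ 2 ^ (2 * k) * (‖x ^ k‖ₑ ^ 2 + ‖a ^ k‖ₑ ^ 2) := by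
  have h : ((x + a) ^ k) ^ 2 ≤ 2 ^ (2 * k) * ((x ^ k) ^ 2 + (a ^ k) ^ 2) := by
    rw [← pow_mul, ← pow_mul, ← pow_mul, mul_comm k 2, pow_mul (x + a), pow_mul x, pow_mul a,
      pow_mul (2 : ℝ)]
    calc ((x + a) ^ 2) ^ k ≤ (2 * (x ^ 2 + a ^ 2)) ^ k :=
          pow_le_pow_left₀ (sq_nonneg _) (by nlinarith [sq_nonneg (x - a)]) k
      _ ≤ 2 ^ k * (2 ^ (k - 1) * ((x ^ 2) ^ k + (a ^ 2) ^ k)) := by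
          rw [mul_pow]
          exact mul_le_mul_of_nonneg_left (add_pow_le (sq_nonneg _) (sq_nonneg _) k) (by positivity)
      _ ≤ 2 ^ k * (2 ^ k * ((x ^ 2) ^ k + (a ^ 2) ^ k)) := by
          gcongr
          · norm_num
          · omega
      _ = _ := by rw [sq (2 : ℝ), mul_pow, mul_assoc]
  have h' := ENNReal.ofReal_le_ofReal h
  rw [ENNReal.ofReal_mul (by positivity), ENNReal.ofReal_add (by positivity) (by positivity)] at h'
  have e : ∀ y : ℝ, ENNReal.ofReal (y ^ 2) = ‖y‖ₑ ^ 2 := fun y => by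
    rw [← sq_abs, ENNReal.ofReal_pow (abs_nonneg _), ← Real.norm_eq_abs, ofReal_norm]
  rw [e, e, e, ENNReal.ofReal_pow (by norm_num), ENNReal.ofReal_ofNat] at h'
  exact h'

theorem lintegral_positionObservable_dist_translationOp_le (a : ℝ) (v : QHilbert) (k : ℕ) :
    ∫⁻ x, ‖x ^ k‖ₑ ^ 2 ∂(positionObservable.dist (translationOp a v)) ≤
      2 ^ (2 * k) * (∫⁻ x, ‖x ^ k‖ₑ ^ 2 ∂(positionObservable.dist v) +
        ‖v‖ₑ ^ 2 * ‖a ^ k‖ₑ ^ 2) := by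
  have hv := measurable_coeFn v
  rw [lintegral_positionObservable_dist _ (by fun_prop),
    lintegral_positionObservable_dist _ (by fun_prop), ← lintegral_enorm_sq_eq,
    ← lintegral_mul_const _ (by fun_prop), ← lintegral_add_left (by fun_prop),
    ← lintegral_const_mul _ (by fun_prop)]
  calc ∫⁻ x, ‖translationOp a v x‖ₑ ^ 2 * ‖x ^ k‖ₑ ^ 2
      = ∫⁻ x, ‖v (x - a)‖ₑ ^ 2 * ‖(x - a + a) ^ k‖ₑ ^ 2 := by
        refine lintegral_congr_ae ?_
        filter_upwards [coeFn_translationOp a v] with x hx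
        rw [hx, sub_add_cancel]
    _ = ∫⁻ x, ‖v x‖ₑ ^ 2 * ‖(x + a) ^ k‖ₑ ^ 2 :=
        lintegral_sub_right_eq_self (fun x => ‖v x‖ₑ ^ 2 * ‖(x + a) ^ k‖ₑ ^ 2) a
    _ ≤ _ := by
        refine lintegral_mono fun x => ?_
        calc _ ≤ ‖v x‖ₑ ^ 2 * (2 ^ (2 * k) * (‖x ^ k‖ₑ ^ 2 + ‖a ^ k‖ₑ ^ 2)) := by
              gcongr; exact enorm_add_pow_sq_le x a k
          _ = _ := by ring

/-- A translation acts in Fourier space as multiplication by a phase. -/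
theorem lintegral_momentumObservable_dist_translationOp (a : ℝ) (v : QHilbert) (k : ℕ) :
    ∫⁻ x, ‖x ^ k‖ₑ ^ 2 ∂(momentumObservable.dist (translationOp a v)) =
      ∫⁻ x, ‖x ^ k‖ₑ ^ 2 ∂(momentumObservable.dist v) := by
  rw [lintegral_momentumObservable_dist_pow, lintegral_momentumObservable_dist_pow,
    ← weylOp_zero_right, fourierL2_weylOp]
  rw [positionObservable_dist_congr]
  filter_upwards [coeFn_weylOp (0 / (2 * Real.pi)) (-2 * Real.pi * a) (fourierL2 v)] with x hx
  rw [hx, enorm_mul, ← ofReal_norm (Complex.exp _), Complex.norm_exp_ofReal_mul_I]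
  simp

theorem lintegral_momentumObservable_dist_smul (c : ℂ) (v : QHilbert) (k : ℕ) :
    ∫⁻ x, ‖x ^ k‖ₑ ^ 2 ∂(momentumObservable.dist (c • v)) =
      ‖c‖ₑ ^ 2 * ∫⁻ x, ‖x ^ k‖ₑ ^ 2 ∂(momentumObservable.dist v) := by
  rw [lintegral_momentumObservable_dist_pow, lintegral_momentumObservable_dist_pow, map_smul,
    lintegral_positionObservable_dist_smul _ _ (by fun_prop)]
  ring

theorem lintegral_momentumObservable_dist_schwartz_lt_top (f : 𝓢(ℝ, ℂ)) (k : ℕ) :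
    ∫⁻ x, ‖x ^ k‖ₑ ^ 2 ∂(momentumObservable.dist (f.toLp 2)) < ∞ := by
  rw [lintegral_momentumObservable_dist_pow, fourierL2_toLp,
    lintegral_positionObservable_dist_schwartz]
  exact ENNReal.mul_lt_top (by finiteness) (lintegral_schwartz_pow_lt_top _ k)

theorem enorm_toLp_sq (f : 𝓢(ℝ, ℂ)) : ‖f.toLp 2 (volume : Measure ℝ)‖ₑ ^ 2 = ∫⁻ x, ‖f x‖ₑ ^ 2 := by
  rw [← lintegral_enorm_sq_eq]
  refine lintegral_congr_ae ?_
  filter_upwards [f.coeFn_toLp 2 volume] with x hx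
  rw [hx]

/-- The conjugation C cancels the one in the inner product, so the window is the probe function
itself, as in the measurement models. -/
theorem enorm_inner_weylOp_translationOp (q p a : ℝ) (f : 𝓢(ℝ, ℂ)) (ψ : QHilbert) :
    ‖⟪weylOp (q, p) (translationOp a (conjL2 (f.toLp 2))), ψ⟫_ℂ‖ₑ =
      ‖∫ x : ℝ, Complex.exp (-(p * x : ℝ) * Complex.I) * (f (x - (q + a)) * ψ x)‖ₑ := by
  rw [enorm_inner_weylOp]
  congr 1
  refine integral_congr_ae ?_
  have hq := measurePreserving_sub_right (volume : Measure ℝ) q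
  have hqa := measurePreserving_sub_right (volume : Measure ℝ) (q + a)
  filter_upwards [hq.quasiMeasurePreserving.ae (coeFn_translationOp a (conjL2 (f.toLp 2))),
    hqa.quasiMeasurePreserving.ae (coeFn_conjL2 (f.toLp 2)),
    hqa.quasiMeasurePreserving.ae (f.coeFn_toLp 2 volume)] with x h1 h2 h3
  rw [h1, sub_sub, h2, h3, Complex.conj_conj]

/-- The state is T = ∫ |c(s)|² |v_s⟩⟨v_s| dν(s), with v_s the translate of v by a(s). Translating
changes position moments at most by powers of a(s), controlled by `hca`, and leaves momentum
distributions alone. -/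
theorem exists_isPhaseSpaceObservable_of_translates_vector {S : Type*} [MeasurableSpace S]
    {ν : Measure S} [SFinite ν] {c : S → ℂ} {a : S → ℝ} (hc : Measurable c) (ha : Measurable a)
    {v : QHilbert} (hca : ∀ k : ℕ, ∫⁻ s, ‖c s‖ₑ ^ 2 * ‖a s ^ k‖ₑ ^ 2 ∂ν < ∞)
    (hQ : ∀ k : ℕ, ∫⁻ x, ‖x ^ k‖ₑ ^ 2 ∂(positionObservable.dist v) < ∞)
    (hP : ∀ k : ℕ, ∫⁻ x, ‖x ^ k‖ₑ ^ 2 ∂(momentumObservable.dist v) < ∞)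
    (h1 : (∫⁻ s, ‖c s‖ₑ ^ 2 ∂ν) * ‖v‖ₑ ^ 2 = 1) :
    ∃ (T : QHilbert →L[ℂ] QHilbert) (G : QObservable (ℝ × ℝ)),
      IsQState T ∧ HasHSMoments T ∧ IsPhaseSpaceObservable T G ∧
      ∀ ψ Z, MeasurableSet Z → G.dist ψ Z = ENNReal.ofReal (1 / (2 * Real.pi)) *
        ∫⁻ s, ∫⁻ z in Z, ‖c s‖ₑ ^ 2 *
          ‖⟪weylOp z (translationOp (a s) v), ψ⟫_ℂ‖ₑ ^ 2 ∂volume ∂ν := by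
  have hu : StronglyMeasurable fun s => c s • translationOp (a s) v := by
    have ht : Continuous fun q => translationOp q v :=
      continuous_translationOp.comp (continuous_id.prodMk continuous_const)
    have h := ht.comp_stronglyMeasurable ha.stronglyMeasurable
    exact hc.stronglyMeasurable.smul h
  have hun : ∫⁻ s, ‖c s • translationOp (a s) v‖ₑ ^ 2 ∂ν = 1 := by
    simp only [enorm_smul, enorm_translationOp, mul_pow]
    rw [lintegral_mul_const _ (by fun_prop), h1]
  obtain ⟨T, hT⟩ := exists_isFrame hu (by rw [hun]; exact ENNReal.one_lt_top)
  have hTs : IsQState T := hT.isQState_iff.2 hun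
  have hct : ∫⁻ s, ‖c s‖ₑ ^ 2 ∂ν < ∞ := by simpa using hca 0
  refine ⟨T, phaseSpaceObservable hTs, hTs, hT.hasHSMoments_iff.2 fun k => ⟨?_, ?_⟩,
    isPhaseSpaceObservable_phaseSpaceObservable hTs, fun ψ Z hZ => ?_⟩
  · rw [lintegral_noiseMeasure positionObservable_isSharp hu (by fun_prop)]
    simp only [enorm_neg_pow_sq]
    calc _ ≤ ∫⁻ s, (‖c s‖ₑ ^ 2 * (2 ^ (2 * k) *
              ∫⁻ x, ‖x ^ k‖ₑ ^ 2 ∂(positionObservable.dist v)) +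
            ‖c s‖ₑ ^ 2 * ‖a s ^ k‖ₑ ^ 2 * (2 ^ (2 * k) * ‖v‖ₑ ^ 2)) ∂ν := by
          refine lintegral_mono fun s => ?_
          rw [lintegral_positionObservable_dist_smul _ _ (by fun_prop)]
          refine (mul_le_mul_right
            (lintegral_positionObservable_dist_translationOp_le (a s) v k) _).trans_eq ?_
          ring
      _ < ∞ := by
          rw [lintegral_add_left (by fun_prop), lintegral_mul_const _ (by fun_prop),
            lintegral_mul_const _ (by fun_prop)]
          exact ENNReal.add_lt_top.2
            ⟨ENNReal.mul_lt_top hct (ENNReal.mul_lt_top (by finiteness) (hQ k)),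
              ENNReal.mul_lt_top (hca k) (by finiteness)⟩
  · rw [lintegral_noiseMeasure momentumObservable_isSharp hu (by fun_prop)]
    simp only [enorm_neg_pow_sq, lintegral_momentumObservable_dist_smul,
      lintegral_momentumObservable_dist_translationOp]
    rw [lintegral_mul_const _ (by fun_prop)]
    exact ENNReal.mul_lt_top hct (hP k)
  · rw [(isPhaseSpaceObservable_phaseSpaceObservable hTs).dist_apply hTs hT ψ hZ]
    congr 1
    refine lintegral_congr fun s => lintegral_congr fun z => ?_
    rw [map_smul, inner_smul_left, enorm_mul, RCLike.enorm_conj, mul_pow]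

/-- `∫_Y |∫ e^{-ipw} f(w - x) ψ(w) dw|² dp`. -/
def windowedEnergy (f : 𝓢(ℝ, ℂ)) (ψ : QHilbert) (Y : Set ℝ) (x : ℝ) : ℝ≥0∞ :=
  ∫⁻ p in Y, ‖∫ w : ℝ, Complex.exp (-(p * w : ℝ) * Complex.I) * (f (w - x) * ψ w)‖ₑ ^ 2

theorem windowedEnergy_add (f : 𝓢(ℝ, ℂ)) (ψ : QHilbert) (Y : Set ℝ) (q a : ℝ) :
    windowedEnergy f ψ Y (q + a) =
      ∫⁻ p in Y, ‖⟪weylOp (q, p) (translationOp a (conjL2 (f.toLp 2))), ψ⟫_ℂ‖ₑ ^ 2 := by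
  simp only [enorm_inner_weylOp_translationOp]
  rfl

theorem measurable_windowedEnergy (f : 𝓢(ℝ, ℂ)) (ψ : QHilbert) (Y : Set ℝ) :
    Measurable (windowedEnergy f ψ Y) := by
  have h : windowedEnergy f ψ Y = fun q =>
      ∫⁻ p in Y, ‖⟪weylOp (q, p) (translationOp 0 (conjL2 (f.toLp 2))), ψ⟫_ℂ‖ₑ ^ 2 := by
    funext q
    rw [← windowedEnergy_add, add_zero]
  rw [h]
  exact (measurable_weylOp_inner_single _ ψ).lintegral_prod_right'

/-- The common form of two models, with v the conjugate of f: a point mass for ν gives the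
sequential model, Lebesgue measure the Arthurs–Kelly model. -/
theorem exists_isPhaseSpaceObservable_of_translates {S : Type*} [MeasurableSpace S]
    {ν : Measure S} [SFinite ν] {c : S → ℂ} {a : S → ℝ} (hc : Measurable c) (ha : Measurable a)
    (f : 𝓢(ℝ, ℂ)) (hca : ∀ k : ℕ, ∫⁻ s, ‖c s‖ₑ ^ 2 * ‖a s ^ k‖ₑ ^ 2 ∂ν < ∞)
    (h1 : (∫⁻ s, ‖c s‖ₑ ^ 2 ∂ν) * ∫⁻ x, ‖f x‖ₑ ^ 2 = 1) :
    ∃ (T : QHilbert →L[ℂ] QHilbert) (G : QObservable (ℝ × ℝ)),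
      IsQState T ∧ HasHSMoments T ∧ IsPhaseSpaceObservable T G ∧
      ∀ ψ X Y, MeasurableSet X → MeasurableSet Y →
        G.dist ψ (X ×ˢ Y) = ENNReal.ofReal (1 / (2 * Real.pi)) *
          ∫⁻ s, ‖c s‖ₑ ^ 2 * (∫⁻ q in X, windowedEnergy f ψ Y (q + a s)) ∂ν := by
  obtain ⟨T, G, hT, hs, hG, h⟩ := exists_isPhaseSpaceObservable_of_translates_vector hc ha
    (v := conjL2 (f.toLp 2)) hca
    (fun k => by
      rw [positionObservable_dist_conjL2, lintegral_positionObservable_dist_schwartz]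
      exact lintegral_schwartz_pow_lt_top f k)
    (fun k => by
      rw [lintegral_momentumObservable_dist_conjL2]
      exact lintegral_momentumObservable_dist_schwartz_lt_top f k)
    (by rw [enorm_conjL2, enorm_toLp_sq, h1])
  refine ⟨T, G, hT, hs, hG, fun ψ X Y hX hY => ?_⟩
  rw [h ψ _ (hX.prod hY)]
  congr 1
  refine lintegral_congr fun s => ?_
  rw [lintegral_const_mul' _ _ (by finiteness), Measure.volume_eq_prod,
    setLIntegral_prod _ (measurable_weylOp_inner_single _ ψ).aemeasurable]
  simp only [windowedEnergy_add]

/-! ### The measurement models -/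

theorem exists_schwartz_dilation (f : 𝓢(ℝ, ℂ)) {r : ℝ} (hr : r ≠ 0) :
    ∃ g : 𝓢(ℝ, ℂ), (∀ x, g x = f (r * x)) ∧
      ENNReal.ofReal |r| * ∫⁻ x, ‖g x‖ₑ ^ 2 = ∫⁻ x, ‖f x‖ₑ ^ 2 := by
  let e := ContinuousLinearEquiv.unitsEquivAut ℝ (Units.mk0 r hr)
  have he : ∀ x, SchwartzMap.compCLMOfContinuousLinearEquiv ℂ e f x = f (r * x) := fun x => by
    rw [SchwartzMap.compCLMOfContinuousLinearEquiv_apply, Function.comp_apply,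
      ContinuousLinearEquiv.unitsEquivAut_apply, Units.val_mk0, mul_comm]
  refine ⟨_, he, ?_⟩
  simp only [he]
  have h := Real.map_volume_mul_left hr
  have hm : MeasurableEmbedding fun x : ℝ => r * x :=
    (Homeomorph.mulLeft₀ r hr).measurableEmbedding
  rw [← hm.lintegral_map (f := fun x => ‖f x‖ₑ ^ 2), h, lintegral_smul_measure, smul_eq_mul,
    ← mul_assoc, abs_inv, ← ENNReal.ofReal_mul (abs_nonneg r),
    mul_inv_cancel₀ (abs_ne_zero.2 hr), ENNReal.ofReal_one, one_mul]

theorem lintegral_enorm_sq_of_integral_eq_one {f : ℝ → ℂ} (h : ∫ x, ‖f x‖ ^ 2 = 1) :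
    ∫⁻ x, ‖f x‖ₑ ^ 2 = 1 := by
  have hi : Integrable fun x => ‖f x‖ ^ 2 := by
    by_contra hi
    rw [integral_undef hi] at h
    exact zero_ne_one h
  simp only [enorm_sq_eq_ofReal]
  rw [← ofReal_integral_eq_lintegral_ofReal hi (.of_forall fun x => sq_nonneg _), h,
    ENNReal.ofReal_one]

theorem setLIntegral_div_mem {c : ℝ} (hc : 0 < c) {X : Set ℝ} (hX : MeasurableSet X)
    (F : ℝ → ℝ≥0∞) :
    ∫⁻ y in {y | y / c ∈ X}, F y = ENNReal.ofReal c * ∫⁻ q in X, F (c * q) := by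
  have hm : MeasurableSet {y | y / c ∈ X} := (measurable_id.div_const c) hX
  rw [← lintegral_indicator hm, lintegral_comp_mul_left _ hc, ← lintegral_indicator hX]
  congr 1
  refine lintegral_congr fun q => ?_
  have h : c * q / c = q := mul_div_cancel_left₀ q hc.ne'
  by_cases hq : q ∈ X
  · rw [indicator_of_mem hq, indicator_of_mem]
    rwa [mem_ofPred_eq, h]
  · rw [indicator_of_notMem hq, indicator_of_notMem]
    rwa [mem_ofPred_eq, h]

theorem enorm_fourierHat_sq (u : ℝ → ℂ) (p : ℝ) :
    ‖fourierHat u p‖ₑ ^ 2 = ENNReal.ofReal (1 / (2 * Real.pi)) *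
      ‖∫ x : ℝ, Complex.exp (-(p * x : ℝ) * Complex.I) * u x‖ₑ ^ 2 := by
  rw [fourierHat, enorm_mul, mul_pow]
  congr 1
  rw [enorm_sq_eq_ofReal, norm_inv, Complex.norm_real, Real.norm_of_nonneg (Real.sqrt_nonneg _),
    inv_pow, Real.sq_sqrt Real.two_pi_pos.le, one_div]

theorem enorm_ofReal_sqrt_sq {r : ℝ} (hr : 0 ≤ r) :
    ‖((Real.sqrt r : ℝ) : ℂ)‖ₑ ^ 2 = ENNReal.ofReal r := by
  rw [enorm_sq_eq_ofReal, Complex.norm_real, Real.norm_of_nonneg (Real.sqrt_nonneg _),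
    Real.sq_sqrt hr]

/-- Here T = |η⟩⟨η| with η(x) = √λ conj(φ(-λx)). At y = λq the probe factor φ(y - λx) is a function
of x - q, and the Jacobian λ of y = λq is the normalization of η. -/
theorem exists_phaseSpaceObservable_sequentialProb {lam : ℝ} {φ : 𝓢(ℝ, ℂ)} (hl : 0 < lam)
    (hφ : ∫ x, ‖φ x‖ ^ 2 = 1) :
    ∃ (T : QHilbert →L[ℂ] QHilbert) (G : QObservable (ℝ × ℝ)),
      IsQState T ∧ HasHSMoments T ∧ IsPhaseSpaceObservable T G ∧
      ∀ ψ X Y, MeasurableSet X → MeasurableSet Y →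
        G.dist ψ (X ×ˢ Y) = sequentialProb lam φ ψ X Y := by
  obtain ⟨f, hf, hf1⟩ := exists_schwartz_dilation φ (neg_ne_zero.2 hl.ne')
  rw [abs_neg, abs_of_pos hl, lintegral_enorm_sq_of_integral_eq_one hφ] at hf1
  have hc := enorm_ofReal_sqrt_sq hl.le
  obtain ⟨T, G, hT, hs, hG, h⟩ := exists_isPhaseSpaceObservable_of_translates
    (ν := Measure.dirac ()) (c := fun _ => (Real.sqrt lam : ℂ)) (a := fun _ => 0)
    measurable_const measurable_const f
    (fun k => by
      rw [lintegral_dirac]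
      finiteness)
    (by rw [lintegral_dirac, hc, hf1])
  refine ⟨T, G, hT, hs, hG, fun ψ X Y hX hY => ?_⟩
  rw [h ψ X Y hX hY, lintegral_dirac, hc, sequentialProb, setLIntegral_div_mem hl hX,
    mul_left_comm, ← lintegral_const_mul' _ _ ENNReal.ofReal_ne_top]
  congr 1
  refine lintegral_congr fun q => ?_
  rw [windowedEnergy, ← lintegral_const_mul' _ _ ENNReal.ofReal_ne_top]
  refine lintegral_congr fun p => ?_
  rw [enorm_fourierHat_sq]
  congr 4
  funext w
  rw [sequentialState, hf, mul_comm (ψ w)]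
  congr 3
  ring

/-- The substitution w = x + μz turns the transform in z at frequency μp into the transform in w at
p. The phase e^{ipx} drops out of the modulus, and the Jacobian μ⁻¹ appears squared. -/
theorem enorm_fourierHat_arthursKellyState_sq {mu : ℝ} (hm : 0 < mu) (lam : ℝ)
    (φ₁ φ₂ : 𝓢(ℝ, ℂ)) {f : 𝓢(ℝ, ℂ)} (hf : ∀ x, f x = φ₂ (mu⁻¹ * x)) (ψ : QHilbert) (x y p : ℝ) :
    ‖fourierHat (fun z => arthursKellyState lam mu φ₁ φ₂ ψ x y z) (mu * p)‖ₑ ^ 2 =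
      ENNReal.ofReal (1 / (2 * Real.pi)) * (‖φ₁ (y - lam * x)‖ₑ ^ 2 * (ENNReal.ofReal mu⁻¹ ^ 2 *
        ‖∫ w : ℝ, Complex.exp (-(p * w : ℝ) * Complex.I) * (f (w - x) * ψ w)‖ₑ ^ 2)) := by
  set F : ℝ → ℂ := fun w => Complex.exp (-(p * w : ℝ) * Complex.I) * (f (w - x) * ψ w) with hF
  have h1 : ∀ z : ℝ, Complex.exp (-(mu * p * z : ℝ) * Complex.I) *
      arthursKellyState lam mu φ₁ φ₂ ψ x y z =
      (φ₁ (y - lam * x) * Complex.exp ((p * x : ℝ) * Complex.I)) * F (mu * z + x) := by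
    intro z
    have he : Complex.exp (-(mu * p * z : ℝ) * Complex.I) = Complex.exp ((p * x : ℝ) * Complex.I) *
        Complex.exp (-(p * (mu * z + x) : ℝ) * Complex.I) := by
      rw [← Complex.exp_add]
      congr 1
      push_cast
      ring
    simp only [arthursKellyState, hF]
    rw [he, hf, add_sub_cancel_right, inv_mul_cancel_left₀ hm.ne', add_comm x]
    ring
  have h2 : ∫ z : ℝ, F (mu * z + x) = |mu⁻¹| • ∫ w, F w := by
    rw [← integral_add_right_eq_self F x]
    exact Measure.integral_comp_mul_left (fun z => F (z + x)) mu
  rw [enorm_fourierHat_sq, integral_congr_ae (.of_forall h1), integral_const_mul, h2, enorm_mul,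
    enorm_mul, enorm_smul, ← ofReal_norm (Complex.exp _), Complex.norm_exp_ofReal_mul_I,
    ENNReal.ofReal_one, mul_one, mul_pow, mul_pow, abs_of_pos (inv_pos.2 hm), ← ofReal_norm mu⁻¹,
    Real.norm_of_nonneg (inv_pos.2 hm).le]

/-- With y = λq the first probe contributes g(x - q), and x = q + s makes s the mixing variable. The
windowed transform of the second probe is centred at x = q + s. -/
theorem arthursKellyProb_eq {lam mu : ℝ} (hl : 0 < lam) (hm : 0 < mu)
    (φ₁ φ₂ : 𝓢(ℝ, ℂ)) {f g : 𝓢(ℝ, ℂ)} (hg : ∀ x, g x = φ₁ (-lam * x))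
    (hf : ∀ x, f x = φ₂ (mu⁻¹ * x)) (ψ : QHilbert) {X Y : Set ℝ}
    (hX : MeasurableSet X) (hY : MeasurableSet Y) :
    arthursKellyProb lam mu φ₁ φ₂ ψ X Y = ENNReal.ofReal (1 / (2 * Real.pi)) *
      ∫⁻ s, ENNReal.ofReal (lam / mu) * ‖g s‖ₑ ^ 2 *
        ∫⁻ q in X, windowedEnergy f ψ Y (q + s) := by
  have hL := measurable_windowedEnergy f ψ Y
  have hgm : Measurable g := g.continuous.measurable
  have h1 : ∀ x : ℝ, ∫⁻ y in {y | y / lam ∈ X}, ∫⁻ p in {p | p / mu ∈ Y},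
      ‖fourierHat (fun z => arthursKellyState lam mu φ₁ φ₂ ψ x y z) p‖ₑ ^ 2 =
      ∫⁻ q in X, ENNReal.ofReal (1 / (2 * Real.pi)) *
        (ENNReal.ofReal (lam / mu) * ‖g (x - q)‖ₑ ^ 2 * windowedEnergy f ψ Y x) := by
    intro x
    rw [setLIntegral_div_mem hl hX, ← lintegral_const_mul' _ _ ENNReal.ofReal_ne_top]
    refine lintegral_congr fun q => ?_
    rw [setLIntegral_div_mem hm hY]
    simp only [enorm_fourierHat_arthursKellyState_sq hm lam φ₁ φ₂ hf]
    -- The constant λ/μ collects λ from y = λq, μ from rescaling the momentum of the second probe,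
    -- and μ⁻² from the squared Jacobian of w = x + μz.
    rw [lintegral_const_mul' _ _ ENNReal.ofReal_ne_top, lintegral_const_mul' _ _ (by finiteness),
      lintegral_const_mul' _ _ (by finiteness), hg, show lam * q - lam * x = -lam * (x - q) by ring,
      show lam / mu = lam * (mu * (mu⁻¹ * mu⁻¹)) by field_simp, ENNReal.ofReal_mul hl.le,
      ENNReal.ofReal_mul hm.le, ENNReal.ofReal_mul (inv_pos.2 hm).le]
    rw [← windowedEnergy]
    ring
  have hm2 : Measurable fun a : ℝ × ℝ => ENNReal.ofReal (lam / mu) * ‖g (a.1 - a.2)‖ₑ ^ 2 *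
      windowedEnergy f ψ Y a.1 := by fun_prop
  have hm3 : Measurable fun a : ℝ × ℝ => ENNReal.ofReal (lam / mu) * ‖g a.1‖ₑ ^ 2 *
      windowedEnergy f ψ Y (a.2 + a.1) := by fun_prop
  have h2 : ∀ s, ENNReal.ofReal (lam / mu) * ‖g s‖ₑ ^ 2 *
      ∫⁻ q in X, windowedEnergy f ψ Y (q + s) = ∫⁻ q in X,
        ENNReal.ofReal (lam / mu) * ‖g s‖ₑ ^ 2 * windowedEnergy f ψ Y (q + s) :=
    fun s => (lintegral_const_mul' _ _ (by finiteness)).symm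
  rw [arthursKellyProb]
  simp only [h1, h2]
  simp only [lintegral_const_mul' _ _ (ENNReal.ofReal_ne_top (r := 1 / (2 * Real.pi)))]
  congr 1
  -- With q as outer variable on both sides, translation invariance gives x = q + s.
  refine (lintegral_lintegral_swap hm2.aemeasurable).trans
    (Eq.trans ?_ (lintegral_lintegral_swap hm3.aemeasurable).symm)
  refine lintegral_congr fun q => ?_
  rw [← lintegral_add_right_eq_self _ q]
  refine lintegral_congr fun x => ?_
  rw [add_sub_cancel_right, add_comm x q]

/-- The state is a mixture of the translates by s of the conjugate of f(x) = φ₂(x/μ), with weight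
(λ/μ)|φ₁(-λs)|² ds. It has trace one because the dilated squares have integrals 1/λ and μ. -/
theorem exists_phaseSpaceObservable_arthursKellyProb {lam mu : ℝ} {φ₁ φ₂ : 𝓢(ℝ, ℂ)}
    (hl : 0 < lam) (hm : 0 < mu) (h1 : ∫ x, ‖φ₁ x‖ ^ 2 = 1) (h2 : ∫ x, ‖φ₂ x‖ ^ 2 = 1) :
    ∃ (T : QHilbert →L[ℂ] QHilbert) (G : QObservable (ℝ × ℝ)),
      IsQState T ∧ HasHSMoments T ∧ IsPhaseSpaceObservable T G ∧
      ∀ ψ X Y, MeasurableSet X → MeasurableSet Y →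
        G.dist ψ (X ×ˢ Y) = arthursKellyProb lam mu φ₁ φ₂ ψ X Y := by
  obtain ⟨g, hg, hg1⟩ := exists_schwartz_dilation φ₁ (neg_ne_zero.2 hl.ne')
  obtain ⟨f, hf, hf1⟩ := exists_schwartz_dilation φ₂ (inv_ne_zero hm.ne')
  rw [abs_neg, abs_of_pos hl, lintegral_enorm_sq_of_integral_eq_one h1] at hg1
  rw [abs_of_pos (inv_pos.2 hm), lintegral_enorm_sq_of_integral_eq_one h2] at hf1
  have hc : ∀ s, ‖(Real.sqrt (lam / mu) : ℂ) * g s‖ₑ ^ 2 =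
      ENNReal.ofReal (lam / mu) * ‖g s‖ₑ ^ 2 := fun s => by
    rw [enorm_mul, mul_pow, enorm_ofReal_sqrt_sq (div_pos hl hm).le]
  have hgm : Measurable g := g.continuous.measurable
  obtain ⟨T, G, hT, hs, hG, h⟩ := exists_isPhaseSpaceObservable_of_translates
    (ν := (volume : Measure ℝ)) (c := fun s => (Real.sqrt (lam / mu) : ℂ) * g s) (a := fun s => s)
    (by fun_prop) measurable_id f
    (fun k => by
      simp only [hc, mul_assoc]
      rw [lintegral_const_mul' _ _ ENNReal.ofReal_ne_top]
      exact ENNReal.mul_lt_top ENNReal.ofReal_lt_top (lintegral_schwartz_pow_lt_top g k))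
    (by
      simp only [hc]
      rw [lintegral_const_mul' _ _ ENNReal.ofReal_ne_top, div_eq_mul_inv,
        ENNReal.ofReal_mul hl.le, mul_right_comm (ENNReal.ofReal lam), hg1, one_mul, hf1])
  refine ⟨T, G, hT, hs, hG, fun ψ X Y hX hY => ?_⟩
  rw [h ψ X Y hX hY, arthursKellyProb_eq hl hm φ₁ φ₂ hg hf ψ hX hY]
  simp only [hc]

/-! ### Reconstruction of position and momentum -/

theorem QObservable.sameAs_of_moments_eq {E O : QObservable ℝ} {D : Submodule ℂ QHilbert}
    (hD : Dense (D : Set QHilbert)) (hO : ∀ ψ ∈ D, IsMomentDeterminate (O.dist ψ))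
    (h : ∀ ψ ∈ D, ∀ k, E.HasMoment k ψ ∧ E.moment k ψ = O.moment k ψ) : E.SameAs O :=
  E.effect_eq_of_inner_eq O hD fun ψ hψ => (hO ψ hψ).2 _ (h ψ hψ)

/-- The sharp distribution satisfies the recursion itself, so ν has the same moments and determinacy
applies. -/
theorem dist_eq_of_moment_recursion {O M : QObservable ℝ} {f : Measure ℝ} [IsProbabilityMeasure f]
    (hf : ∀ k : ℕ, Integrable (fun x : ℝ => x ^ k) f)
    (h : ∀ ψ, M.dist ψ = (O.dist ψ).conv f) {ψ : QHilbert}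
    (hψ : IsMomentDeterminate (O.dist ψ)) {ν : Measure ℝ}
    (hν : ∀ k : ℕ, Integrable (fun x : ℝ => x ^ k) ν)
    (hr : ∀ k : ℕ, ∫ x, x ^ k ∂ν = M.moment k ψ - ∑ i ∈ Finset.Icc 1 k,
      ((k.choose i : ℝ) * ∫ x, x ^ i ∂f) * ∫ x, x ^ (k - i) ∂ν) :
    ν = O.dist ψ :=
  hψ.eq_of_recursion hν (fun k => ((moments_of_dist_eq_conv hf h ψ k).2 (hψ.1 k)).2) hr

/-- The noise measures come from one arbitrarily chosen frame; frame independence identifies them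
with those of every spectral decomposition, so the coefficients depend on T alone. -/
theorem exists_moment_coefficients {T : QHilbert →L[ℂ] QHilbert} {G : QObservable (ℝ × ℝ)}
    (hT : IsQState T) (hs : HasHSMoments T) (hG : IsPhaseSpaceObservable T G) :
    ∃ f g : Measure ℝ, IsProbabilityMeasure f ∧ IsProbabilityMeasure g ∧
      (∀ k : ℕ, Integrable (fun x : ℝ => x ^ k) f) ∧
      (∀ k : ℕ, Integrable (fun x : ℝ => x ^ k) g) ∧
      (∀ ψ, G.fst.dist ψ = (positionObservable.dist ψ).conv f) ∧
      (∀ ψ, G.snd.dist ψ = (momentumObservable.dist ψ).conv g) ∧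
      ∀ (t : ℕ → ℝ) (η : ℕ → QHilbert), IsSpectralDecomposition T t η →
        positionNoise t η = f ∧ momentumNoise t η = g := by
  obtain ⟨u, hu⟩ := hT.exists_frame
  have hf := hu.isProbabilityMeasure_noiseMeasure positionObservable_isSharp hT
  have hg := hu.isProbabilityMeasure_noiseMeasure momentumObservable_isSharp hT
  have hm := hu.hasHSMoments_iff.1 hs
  refine ⟨_, _, hf, hg, fun k => integrable_pow_of_lintegral (hm k).1,
    fun k => integrable_pow_of_lintegral (hm k).2, hG.fst_dist hT hu, hG.snd_dist hT hu,
    fun t η h => ?_⟩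
  have h' := isFrame_of_isSpectralDecomposition hT.1 h
  rw [positionNoise_eq_noiseMeasure h.1, momentumNoise_eq_noiseMeasure h.1]
  exact ⟨h'.noiseMeasure_eq positionObservable_isSharp hu,
    h'.noiseMeasure_eq momentumObservable_isSharp hu⟩

end

/-! ### The main theorem -/

theorem mainTheorem2 :
    -- `Q` and `P` are spectral measures, and their moments are those of the operators `Q^k`, `P^k`
    (positionObservable.IsSharp ∧ momentumObservable.IsSharp ∧
      (∀ (k : ℕ) (ψ : (positionPow k).domain), positionObservable.HasMoment k ψ ∧
        ⟪(ψ : QHilbert), positionPow k ψ⟫_ℂ = ((positionObservable.moment k ψ : ℝ) : ℂ)) ∧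
      (∀ (k : ℕ) (ψ : (momentumPow k).domain), momentumObservable.HasMoment k ψ ∧
        ⟪(ψ : QHilbert), momentumPow k ψ⟫_ℂ = ((momentumObservable.moment k ψ : ℝ) : ℂ))) ∧
    -- every state `T` generates exactly one phase space observable
    (∀ T : QHilbert →L[ℂ] QHilbert, IsQState T →
      ∃ G, IsPhaseSpaceObservable T G ∧ ∀ G', IsPhaseSpaceObservable T G' → G'.SameAs G) ∧
    -- the moments of the marginals, the recursion, and the reconstruction
    (∀ (T : QHilbert →L[ℂ] QHilbert) (G : QObservable (ℝ × ℝ)), IsQState T → HasHSMoments T →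
      IsPhaseSpaceObservable T G →
      ∃ sQ sP : ℕ → ℕ → ℝ,
        (∀ k, sQ k 0 = 1 ∧ sP k 0 = 1) ∧
        (∀ (t : ℕ → ℝ) (η : ℕ → QHilbert), IsSpectralDecomposition T t η →
          IsProbabilityMeasure (positionNoise t η) ∧ IsProbabilityMeasure (momentumNoise t η) ∧
          (∀ ψ, G.fst.dist ψ = (positionObservable.dist ψ).conv (positionNoise t η) ∧
            G.snd.dist ψ = (momentumObservable.dist ψ).conv (momentumNoise t η)) ∧
          (∀ i : ℕ, Integrable (fun x : ℝ => x ^ i) (positionNoise t η) ∧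
            Integrable (fun x : ℝ => x ^ i) (momentumNoise t η)) ∧
          (∀ k i : ℕ, i ≤ k → sQ k i = (k.choose i : ℝ) * ∫ x, x ^ i ∂(positionNoise t η)) ∧
          (∀ k i : ℕ, i ≤ k → sP k i = (k.choose i : ℝ) * ∫ x, x ^ i ∂(momentumNoise t η))) ∧
        (∀ (ψ : QHilbert) (k : ℕ),
          (G.fst.HasMoment k ψ ↔ positionObservable.HasMoment k ψ) ∧
          (positionObservable.HasMoment k ψ →
            G.fst.moment k ψ =
              ∑ i ∈ Finset.range (k + 1), sQ k i * positionObservable.moment (k - i) ψ ∧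
            positionObservable.moment k ψ = G.fst.moment k ψ -
              ∑ i ∈ Finset.Icc 1 k, sQ k i * positionObservable.moment (k - i) ψ)) ∧
        (∀ (ψ : QHilbert) (k : ℕ),
          (G.snd.HasMoment k ψ ↔ momentumObservable.HasMoment k ψ) ∧
          (momentumObservable.HasMoment k ψ →
            G.snd.moment k ψ =
              ∑ i ∈ Finset.range (k + 1), sP k i * momentumObservable.moment (k - i) ψ ∧
            momentumObservable.moment k ψ = G.snd.moment k ψ -
              ∑ i ∈ Finset.Icc 1 k, sP k i * momentumObservable.moment (k - i) ψ)) ∧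
        (∀ ψ ∈ hermiteSpan, ∀ ν : Measure ℝ,
          (∀ k : ℕ, Integrable (fun x : ℝ => x ^ k) ν) →
          ((∀ k : ℕ, ∫ x, x ^ k ∂ν = G.fst.moment k ψ -
              ∑ i ∈ Finset.Icc 1 k, sQ k i * ∫ x, x ^ (k - i) ∂ν) →
            ν = positionObservable.dist ψ) ∧
          ((∀ k : ℕ, ∫ x, x ^ k ∂ν = G.snd.moment k ψ -
              ∑ i ∈ Finset.Icc 1 k, sP k i * ∫ x, x ^ (k - i) ∂ν) →
            ν = momentumObservable.dist ψ))) ∧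
    -- exponential boundedness and determinacy on the span of the Hermite functions
    (∀ ψ ∈ hermiteSpan,
      (∀ k, ψ ∈ (positionPow k).domain ∧ ψ ∈ (momentumPow k).domain) ∧
      IsExpBounded (positionObservable.dist ψ) ∧ IsExpBounded (momentumObservable.dist ψ) ∧
      IsMomentDeterminate (positionObservable.dist ψ) ∧
      IsMomentDeterminate (momentumObservable.dist ψ)) ∧
    -- this span is dense, and its distributions (or their moments) determine `Q` and `P`
    Dense (hermiteSpan : Set QHilbert) ∧
    (∀ E : QObservable ℝ,
      ((∀ ψ ∈ hermiteSpan, E.dist ψ = positionObservable.dist ψ) → E.SameAs positionObservable) ∧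
      ((∀ ψ ∈ hermiteSpan, E.dist ψ = momentumObservable.dist ψ) → E.SameAs momentumObservable) ∧
      ((∀ ψ ∈ hermiteSpan, ∀ k, E.HasMoment k ψ ∧ E.moment k ψ = positionObservable.moment k ψ) →
        E.SameAs positionObservable) ∧
      ((∀ ψ ∈ hermiteSpan, ∀ k, E.HasMoment k ψ ∧ E.moment k ψ = momentumObservable.moment k ψ) →
        E.SameAs momentumObservable)) ∧
    -- the three measurement models
    (∀ (lam : ℝ) (φ : 𝓢(ℝ, ℂ)), 0 < lam → ∫ x, ‖φ x‖ ^ 2 = 1 →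
      ∃ (T : QHilbert →L[ℂ] QHilbert) (G : QObservable (ℝ × ℝ)),
        IsQState T ∧ HasHSMoments T ∧ IsPhaseSpaceObservable T G ∧
        ∀ ψ X Y, MeasurableSet X → MeasurableSet Y →
          G.dist ψ (X ×ˢ Y) = sequentialProb lam φ ψ X Y) ∧
    (∀ (lam mu : ℝ) (φ₁ φ₂ : 𝓢(ℝ, ℂ)), 0 < lam → 0 < mu →
      ∫ x, ‖φ₁ x‖ ^ 2 = 1 → ∫ x, ‖φ₂ x‖ ^ 2 = 1 →
      ∃ (T : QHilbert →L[ℂ] QHilbert) (G : QObservable (ℝ × ℝ)),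
        IsQState T ∧ HasHSMoments T ∧ IsPhaseSpaceObservable T G ∧
        ∀ ψ X Y, MeasurableSet X → MeasurableSet Y →
          G.dist ψ (X ×ˢ Y) = arthursKellyProb lam mu φ₁ φ₂ ψ X Y) ∧
    (∀ σ : QHilbert →L[ℂ] QHilbert, IsQState σ → HasHSMoments σ →
      IsQState (conjOp σ) ∧ HasHSMoments (conjOp σ)) := by
  have hdQ : ∀ ψ ∈ hermiteSpan, IsMomentDeterminate (positionObservable.dist ψ) :=
    fun ψ hψ => (isExpBounded_positionObservable_dist hψ).isMomentDeterminate
  have hdP : ∀ ψ ∈ hermiteSpan, IsMomentDeterminate (momentumObservable.dist ψ) :=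
    fun ψ hψ => (isExpBounded_momentumObservable_dist hψ).isMomentDeterminate
  refine ⟨⟨positionObservable_isSharp, momentumObservable_isSharp,
      positionObservable_hasMoment_and_inner, momentumObservable_hasMoment_and_inner⟩,
    fun T hT => ⟨phaseSpaceObservable hT, isPhaseSpaceObservable_phaseSpaceObservable hT,
      fun G' hG' => (isPhaseSpaceObservable_phaseSpaceObservable hT).sameAs hG'⟩,
    fun T G hT hs hG => ?_,
    fun ψ hψ => ⟨fun k => ⟨mem_positionPow_domain_of_mem_hermiteSpan hψ k,
      mem_momentumPow_domain_of_mem_hermiteSpan hψ k⟩, isExpBounded_positionObservable_dist hψ,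
      isExpBounded_momentumObservable_dist hψ, hdQ ψ hψ, hdP ψ hψ⟩,
    dense_hermiteSpan,
    fun E => ⟨E.effect_eq_of_inner_eq _ dense_hermiteSpan, E.effect_eq_of_inner_eq _ dense_hermiteSpan,
      QObservable.sameAs_of_moments_eq dense_hermiteSpan hdQ,
      QObservable.sameAs_of_moments_eq dense_hermiteSpan hdP⟩,
    fun lam φ hl hφ => exists_phaseSpaceObservable_sequentialProb hl hφ,
    fun lam mu φ₁ φ₂ hl hm h1 h2 => exists_phaseSpaceObservable_arthursKellyProb hl hm h1 h2,
    fun σ hσ hs => conjOp_isQState_and_hasHSMoments hσ hs⟩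
  obtain ⟨f, g, hf, hg, hfi, hgi, hfst, hsnd, hdec⟩ := exists_moment_coefficients hT hs hG
  refine ⟨fun k i => (k.choose i : ℝ) * ∫ x, x ^ i ∂f, fun k i => (k.choose i : ℝ) * ∫ x, x ^ i ∂g,
    fun k => by simp, fun t η h => ?_, moments_of_dist_eq_conv hfi hfst,
    moments_of_dist_eq_conv hgi hsnd, fun ψ hψ ν hν =>
      ⟨dist_eq_of_moment_recursion hfi hfst (hdQ ψ hψ) hν,
        dist_eq_of_moment_recursion hgi hsnd (hdP ψ hψ) hν⟩⟩
  obtain ⟨h1, h2⟩ := hdec t η h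
  rw [h1, h2]
  exact ⟨hf, hg, fun ψ => ⟨hfst ψ, hsnd ψ⟩, fun i => ⟨hfi i, hgi i⟩, fun _ _ _ => rfl,
    fun _ _ _ => rfl⟩
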